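/- **Automata.** A cellular automaton (CA) has a finite state set $Q$, a local transition function $\delta\colon Q^3\to Q$ (left neighbour, cell, right neighbour), an input alphabet $\Sigma\subsetneq Q$, an inactive state $q\in Q\setminus\Sigma$ with $\delta(q_1,q,q_2)=q$ for all $q_1,q_2$, and a set of accepting states $A\subseteq Q\setminus\{q\}$. Its configurations are the maps $\mathbb Z\to Q$; an input $w$ is written into the cells $0,\dots,|w|-1$, all other cells being inactive. A shrinking CA (SCA) has in addition a delete state $\otimes\in Q\setminus(\Sigma\cup\{q\})$; in each step $\delta$ is applied to all cells simultaneously, and then all cells in state $\otimes$ are removed, the configuration being contracted towards cell $0$. An SCA accepts a nonempty word $w$ if cell $0$ is in an accepting state at some time; the least such time is its time complexity on $w$. For a function $T$, $\mathsf{SCA}[T]$ is the class of languages $L$ that are the set of accepted words of some SCA whose time complexity on the words of $L$ of length $N$ is $O(T(N))$. **Block versions.** For $m\ge 1$ let $n=n(m)=\max\{1,\lceil\log_2 m\rceil\}$. For a word $z\in\{0,1\}^+$ of length $m$, the block word of $z$ is $w_0\#w_1\#\cdots\#w_{m-1}$, where $w_i$ is the two-track word of length $n$ with the $n$-bit binary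 representation of $i$ on the upper track and $z(i)0^{n-1}$ on the lower track. Its length is $N=(n+1)m-1$, and $N$ determines $m$ and $n$. For $L\subseteq\{0,1\}^+$, $\mathsf{Block}_n(L)$ is the set of the block words of all $z\in L$. **Languages.** Let $q>2$ be an integer, let $t_k\colon\mathbb N_+\to\mathbb N_0$, and let $k\colon\mathbb N_+\to\mathbb N_+$ be constructible in place by a CA in at most $t_k(n)$ time, i.e. $k(n)\le 2^n$ and there is a CA which, for every $n\ge1$, started on $n$ in unary, reaches within $t_k(n)$ steps, and then keeps, the configuration that consists of the $n$-bit binary representation of $k(n)-1$ in the cells $0,\dots,n-1$ (all other cells being inactive). Let $\mathrm{PAR}$, $\mathrm{MOD}_q$, $\mathrm{MAJ}$ be the languages of the words $w\in\{0,1\}^+$ with $|w|_1$ even, $|w|_1\equiv0\pmod q$, and $|w|_1\ge|w|_0$, respectively, and let $\mathrm{THR}_k$ be the language of the words $w\in\{0,1\}^+$ with $|w|_1\ge k(n)$, where $n=n(|w|)$. **Proposition.** For $L\in\{\mathrm{PAR},\mathrm{MOD}_q,\mathrm{MAJ}\}$, $\mathsf{Block}_n(L)\in\mathsf{SCA}[(\log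 N)^2]$, where $N$ is the input length. Also, $\mathsf{Block}_n(\mathrm{THR}_k)\in\mathsf{SCA}[(\log N)^2+t_k(n)]$, where $n$ is the parameter determined by $N$ as above. -/

import Mathlib

/-! ### Cellular automata -/

/-- A cellular automaton with state set `Q` (required to be finite where automata are quantified
over) and input alphabet `α`, which is identified with a set of states through the injection `inp`.
-/
structure CA (α Q : Type) where
  /-- the local transition function: left neighbour, cell itself, right neighbour -/
  δ : Q → Q → Q → Q
  /-- the input symbols, as states -/
  inp : α → Q
  inp_injective : Function.Injective inp
  /-- the inactive state -/
  inactive : Q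
  inactive_not_inp : ∀ a, inp a ≠ inactive
  δ_inactive : ∀ q₁ q₂, δ q₁ inactive q₂ = inactive
  /-- the accepting states -/
  accept : Set Q
  inactive_not_accept : inactive ∉ accept

namespace CA

variable {α Q : Type}

/-- The global transition function on configurations `ℤ → Q`. -/
def step (C : CA α Q) (c : ℤ → Q) : ℤ → Q :=
  fun i => C.δ (c (i - 1)) (c i) (c (i + 1))

/-- The configuration in which the cells `0, …, |u| - 1` hold the word `u` of states and all other
cells are inactive. -/
def wordConfig (C : CA α Q) (u : List Q) : ℤ → Q
  | Int.ofNat i => u.getD i C.inactive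
  | Int.negSucc _ => C.inactive

/-- The initial configuration for the input word `w`. -/
def init (C : CA α Q) (w : List α) : ℤ → Q :=
  C.wordConfig (w.map C.inp)

end CA

/-- A shrinking cellular automaton: a cellular automaton with a delete state. -/
structure SCA (α Q : Type) extends CA α Q where
  /-- the delete state -/
  del : Q
  del_not_inp : ∀ a, inp a ≠ del
  del_ne_inactive : del ≠ inactive

namespace SCA

variable {α Q : Type}

/-- Removal of all cells in the delete state. The cells with index `≥ 0` and those with index `< 0`
are each contracted towards the origin: the new cell `i ≥ 0` is the `i`-th cell (counting from zero)
among the cells with nonnegative index that are not in the delete state, and symmetrically on the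
negative side. (This is meaningful whenever only finitely many cells are in the delete state, as is
the case for all configurations that arise from finite inputs.) -/
noncomputable def contract (S : SCA α Q) (c : ℤ → Q) : ℤ → Q
  | Int.ofNat i => c (Int.ofNat (Nat.nth (fun j => c (Int.ofNat j) ≠ S.del) i))
  | Int.negSucc i => c (Int.negSucc (Nat.nth (fun j => c (Int.negSucc j) ≠ S.del) i))

/-- The global transition function of a shrinking automaton. -/
noncomputable def shrinkStep (S : SCA α Q) (c : ℤ → Q) : ℤ → Q :=
  S.contract (S.toCA.step c)

/-- On input `w`, cell zero is in an accepting state after `s` steps. -/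
def AcceptsAt (S : SCA α Q) (w : List α) (s : ℕ) : Prop :=
  (S.shrinkStep^[s] (S.toCA.init w)) 0 ∈ S.accept

/-- The language of nonempty words accepted by `S`. -/
def language (S : SCA α Q) : Language α :=
  {w | w ≠ [] ∧ ∃ s, S.AcceptsAt w s}

/-- The time complexity of `S` on an accepted word: the first step at which cell zero is in an
accepting state. -/
noncomputable def acceptTime (S : SCA α Q) (w : List α) : ℕ :=
  sInf {s | S.AcceptsAt w s}

end SCA

/-- The class `SCA[t]` of the languages accepted by shrinking automata with time complexity
`O(t(N))`, where `N` is the input length. Only accepted words are subject to the time bound. -/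
def SCATime {α : Type} (t : ℕ → ℝ) : Set (Language α) :=
  {L | ∃ (Q : Type) (_ : Finite Q) (S : SCA α Q), S.language = L ∧
    ∃ (C : ℝ) (N₀ : ℕ), ∀ w ∈ L, N₀ ≤ w.length → (S.acceptTime w : ℝ) ≤ C * t w.length}

/-! ### Binary numbers and constructibility in place -/

/-- The binary representation of `x < 2 ^ n` of length `n`, most significant bit first. -/
def binWord (n x : ℕ) : List Bool :=
  (List.range n).map fun i => x.testBit (n - 1 - i)

/-- `g` is constructible in place by a cellular automaton in at most `t(n)` time: `g(n) ≤ 2 ^ n` and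
there is a (non-shrinking) automaton which, started on `n` in unary (`n` copies of one input
symbol), produces the `n`-bit representation of `g(n) - 1` in at most `t(n)` steps. Producing the
word means that the configuration that consists of this word is reached and then kept. -/
def ConstructibleInPlace (g t : ℕ → ℕ) : Prop :=
  (∀ n, 1 ≤ n → g n ≤ 2 ^ n) ∧
  ∃ (Q : Type) (_ : Finite Q) (C : CA Unit Q) (bit : Bool → Q),
    Function.Injective bit ∧ (∀ b, bit b ≠ C.inactive) ∧
    ∀ n, 1 ≤ n → ∃ s ≤ t n,
      C.step^[s] (C.init (List.replicate n ())) = C.wordConfig ((binWord n (g n - 1)).map bit) ∧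
      C.step (C.wordConfig ((binWord n (g n - 1)).map bit)) =
        C.wordConfig ((binWord n (g n - 1)).map bit)

/-! ### Block versions of binary languages -/

/-- The alphabet of block words: the separator `#`, and pairs of symbols from the two tracks, where
`none` stands for the empty word (a track that has ended). -/
inductive BlockSymbol : Type where
  | sep : BlockSymbol
  | pair (upper lower : Option Bool) : BlockSymbol

/-- The two-track word with `x` on the upper and `y` on the lower track. -/
def twoTrack (x y : List Bool) : List BlockSymbol :=
  (List.range (max x.length y.length)).map fun i => BlockSymbol.pair x[i]? y[i]?

/-- The parameter `n` (the number of bits of a block number) that belongs to `m` blocks: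
`⌈log₂ m⌉`, but at least `1`, since block numbers are nonempty words. -/
def blockParam (m : ℕ) : ℕ := max 1 (Nat.clog 2 m)

/-- The block word with block length `b(n)` that represents `z`: it has `|z|` blocks, numbered from
`0`, and the `i`-th block carries the number `i` in `n` bits on its upper and `z(i) 0^{b(n)-1}` on
its lower track. -/
def blockEncode (b : ℕ → ℕ) (z : List Bool) : List BlockSymbol :=
  List.intercalate [BlockSymbol.sep] <| z.mapIdx fun i a =>
    twoTrack (binWord (blockParam z.length) i)
      (a :: List.replicate (b (blockParam z.length) - 1) false)

/-- The block version of `L` with blocks of length `b(n)`. -/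
def BlockVersion (b : ℕ → ℕ) (L : Language Bool) : Language BlockSymbol :=
  {w | ∃ z ∈ L, z ≠ [] ∧ w = blockEncode b z}

/-- The parameter `n` of the block words (with blocks of length `n`) that have total length `N`; it
is determined by `N`, see `blockIndex_length_blockEncode`. -/
noncomputable def blockIndex (N : ℕ) : ℕ :=
  sInf {n | ∃ z : List Bool, z ≠ [] ∧ (blockEncode id z).length = N ∧ n = blockParam z.length}

theorem length_intercalate_sep (l : List (List BlockSymbol)) (r : ℕ) (hl : l ≠ [])
    (h : ∀ u ∈ l, u.length = r) :
    (List.intercalate [BlockSymbol.sep] l).length + 1 = (r + 1) * l.length := by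
  induction l with
  | nil => exact absurd rfl hl
  | cons a t ih =>
    cases t with
    | nil => simp [List.intercalate, h a (by simp)]
    | cons b t =>
      have h1 := ih (by simp) (fun u hu => h u (by simp [hu]))
      have h2 := h a (by simp)
      simp only [List.intercalate, List.intersperse, List.flatten_cons, List.length_append,
        List.length_cons, List.length_nil] at h1 ⊢
      rw [h2]
      nlinarith

theorem length_blockEncode (z : List Bool) (hz : z ≠ []) :
    (blockEncode id z).length + 1 = (blockParam z.length + 1) * z.length := by
  have h1 : 1 ≤ blockParam z.length := le_max_left _ _
  have := length_intercalate_sep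
    (z.mapIdx fun i a => twoTrack (binWord (blockParam z.length) i)
      (a :: List.replicate (blockParam z.length - 1) false)) (blockParam z.length)
    (by simpa using hz)
    (by
      intro u hu
      obtain ⟨i, hi, rfl⟩ := List.mem_mapIdx.1 hu
      simp [twoTrack, binWord]
      omega)
  simpa [blockEncode] using this

theorem blockIndex_length_blockEncode (z : List Bool) (hz : z ≠ []) :
    blockIndex (blockEncode id z).length = blockParam z.length := by
  have key : {n | ∃ z' : List Bool, z' ≠ [] ∧
      (blockEncode id z').length = (blockEncode id z).length ∧ n = blockParam z'.length} =
      {blockParam z.length} := by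
    ext n
    simp only [Set.mem_ofPred_eq, Set.mem_singleton_iff]
    constructor
    · rintro ⟨z', hz', h, rfl⟩
      have h1 := length_blockEncode z hz
      have h2 := length_blockEncode z' hz'
      have hp : 0 < z.length := List.length_pos_of_ne_nil hz
      have hp' : 0 < z'.length := List.length_pos_of_ne_nil hz'
      have mono : Monotone blockParam := fun a b hab =>
        max_le_max le_rfl (Nat.clog_mono_right 2 hab)
      rcases lt_trichotomy z.length z'.length with hlt | heq | hgt
      · have := mono hlt.le
        nlinarith
      · rw [heq]
      · have := mono hgt.le
        nlinarith
    · rintro rfl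
      exact ⟨z, hz, rfl, rfl⟩
  rw [blockIndex, key, csInf_singleton]

/-! ### The counting languages -/

/-- The nonempty binary words with an even number of ones. -/
def PAR : Language Bool := {w | w ≠ [] ∧ Even (w.count true)}

/-- The nonempty binary words whose number of ones is divisible by `q`. -/
def MODq (q : ℕ) : Language Bool := {w | w ≠ [] ∧ w.count true ≡ 0 [MOD q]}

/-- The nonempty binary words with at least as many ones as zeros. -/
def MAJ : Language Bool := {w | w ≠ [] ∧ w.count false ≤ w.count true}

/-- The nonempty binary words `w` with at least `k(|w|)` ones. -/
def THR (k : ℕ → ℕ) : Language Bool := {w | w ≠ [] ∧ k w.length ≤ w.count true}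

/-!
A block word for `z` consists of `m = |z|` blocks of length `n = blockParam m`. The idea is to add
up the zeros and ones of `z` by merging neighbouring blocks, which halves the number of blocks
within `2 * n` steps (a phase). After about `n` phases, that is, after `O(n ^ 2)` steps, where `n`
is at most `log N` by `blockParam_le_logb`, a single block of length `n` is left. It holds the
numbers of zeros and of ones in binary, and the membership of `z` is decided by a finite automaton
that reads these digits. The shrinking automaton `machine` does this for arbitrary data `Prog`; the
theorem follows from `blockVersion_mem_SCATime` with the evaluations `modProg`, `majProg` and
`thrProg`.

*A phase.* Every block contains its number and the two counters. An even-numbered block moves to the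
right onto its odd-numbered partner. Its symbols travel through the partner, a symbol moving on
whenever the next cell is free, and the cells that it leaves behind are deleted. As soon as the last
cell of the partner has received its symbol, a pulse runs from there to the left through the block
and meets the other symbols at their destinations: it adds the counters with carry, compares the
numbers of the partners, which may differ in the last bit only, and shifts the number by one
position, which removes that last bit. The parity of the shortened number is the role of the block
in the next phase. When the pulse reaches the first cell, the roles of neighbouring blocks are
compared: they have to alternate, starting with an even block, and only the rightmost block can be
without a partner. All of this happens at the same times in all blocks. In the first phase, nothing
is merged; it only determines the roles of the blocks. The configuration at every time of a phase is
described by `Seg.conf`; that the local rule leads from one time to the next is `Seg.next_conf`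
inside a phase and `Seg.next_conf_of_alt` between two phases.

*Correctness of the input.* The blocks are numbered consecutively from zero if and only if roles
alternate and all comparisons succeed in all phases (`Seg.Start.alt_of_numbered` and
`Seg.Start.numbered_of_alt`): one phase turns the numbers `0, 1, 2, 3, …` into `0, 1, …`, and
conversely the pairs `2 * y, 2 * y + 1` can be recovered from `y` (`Seg.numbered_of_merge`). That
`n` is the right length for `m` blocks means `m ≤ 2 ^ n`, which is automatic, and `2 ^ (n - 1) < m`
if `2 ≤ n`. The latter fails exactly if the leftmost bit of all numbers is zero, so that a single
block is left already before that bit is removed. Equal lengths of blocks are checked in the first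
phase by tokens that pass through the blocks at half speed (`Seg.poisoned_of_ne`), and the format of
blocks is checked in the first step (`exists_encode_of_err_notMem`).

*Errors.* A failed check leads to a permanent error state. It prevents acceptance, which would need
a pulse of role `lone` in cell zero. Such pulses start at the right end of the configuration and
cannot pass an error (`not_accept_of_poisoned`).

*The threshold.* The automaton that constructs `k(n)` in place runs in every block of length `n`,
from the first step on and without being restarted, so that its result is present in the last
remaining block. As the time of its construction is not known to the block, each cell records
whether it has changed since the last pulse. If a pulse finds no change, the whole automaton has
been at rest in the step that is common to the periods observed by the cells, and hence forever
(`Seg.fst_auxAt_of_quiet`). The single block is therefore evaluated, from the phase after the last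
merging on, by the first pulse that finds no change, within `O(n ^ 2 + t(n))` steps.
-/

/-! ### Configurations as lists -/

/-- One synchronous step of the local rule `δ` on the list `u` of cells, where `l` and `r` are the
cells beyond its left and right end. -/
def listStep {Q : Type} (δ : Q → Q → Q → Q) : Q → List Q → Q → List Q
  | _, [], _ => []
  | l, x :: u, r => δ l x (u.headD r) :: listStep δ x u r

section ListStep

variable {Q : Type} (δ : Q → Q → Q → Q)

theorem listStep_append (l : Q) (u v : List Q) (r : Q) :
    listStep δ l (u ++ v) r =
      listStep δ l u (v.headD r) ++ listStep δ (u.getLastD l) v r := by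
  induction u generalizing l with
  | nil => simp [listStep]
  | cons a u ih =>
    cases u with
    | nil => simp [listStep]
    | cons b u =>
      rw [List.cons_append, listStep, ih, listStep, List.cons_append]
      congr 2

theorem listStep_map_range' (l : Q) (f : ℕ → Q) (s m : ℕ) (r : Q) :
    listStep δ l ((List.range' s m).map f) r =
      (List.range' s m).map fun k => δ (if k = s then l else f (k - 1)) (f k)
        (if k + 1 = s + m then r else f (k + 1)) := by
  induction m generalizing s l with
  | zero => simp [listStep]
  | succ m ih =>
    rw [List.range'_succ, List.map_cons, listStep, ih, List.map_cons]
    congr 1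
    · cases m with
      | zero => simp
      | succ m => simp [List.range'_succ]
    · apply List.map_congr_left
      intro k hk
      rw [List.mem_range'_1] at hk
      have h1 : k ≠ s := by omega
      have h3 : (k + 1 = s + 1 + m) = (k + 1 = s + (m + 1)) := by
        rw [Nat.add_assoc, Nat.add_comm 1 m]
      by_cases h2 : k = s + 1
      · subst h2
        simp only [h1, h3, if_true, if_false, Nat.add_sub_cancel]
      · simp only [h1, h2, h3, if_false]

theorem length_listStep (l : Q) (u : List Q) (r : Q) : (listStep δ l u r).length = u.length := by
  induction u generalizing l with
  | nil => rfl
  | cons a u ih => simp [listStep, ih]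

theorem getElem?_listStep (l : Q) (u : List Q) (r : Q) (i : ℕ) (hi : i < u.length) :
    (listStep δ l u r)[i]? = some (δ (if i = 0 then l else u.getD (i - 1) r) (u.getD i r)
      (u.getD (i + 1) r)) := by
  induction u generalizing l i with
  | nil => simp at hi
  | cons a u ih =>
    cases i with
    | zero => cases u <;> simp [listStep]
    | succ i =>
      have hi' : i < u.length := by simpa using hi
      rw [listStep, List.getElem?_cons_succ, ih a i hi']
      cases i with
      | zero => simp
      | succ i => simp

end ListStep

/-- Selecting the cells with nonnegative index that satisfy a predicate, when they are given by a
list followed by infinitely many cells that satisfy it, amounts to filtering the list. -/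
theorem getD_nth_ne {Q : Type} [DecidableEq Q] (d q : Q) (hq : q ≠ d) (u : List Q) (i : ℕ) :
    u.getD (Nat.nth (fun j => u.getD j q ≠ d) i) q = (u.filter (fun x => x ≠ d)).getD i q := by
  induction u generalizing i with
  | nil => simp
  | cons a u ih =>
    have hinf : {j | u.getD j q ≠ d}.Infinite := by
      apply Set.infinite_of_forall_exists_gt
      intro n
      refine ⟨max n u.length + 1, ?_, by omega⟩
      have h : u.getD (max n u.length + 1) q = q := by
        rw [List.getD_eq_default]; omega
      change u.getD (max n u.length + 1) q ≠ d
      rwa [h]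
    have key : ∀ j, Nat.nth (fun j => (a :: u).getD j q ≠ d) (j + if a ≠ d then 1 else 0) =
        Nat.nth (fun j => u.getD j q ≠ d) j + 1 := by
      intro j
      have hp := Nat.nth_mem_of_infinite hinf j
      have hc : Nat.count (fun j => (a :: u).getD j q ≠ d)
          (Nat.nth (fun j => u.getD j q ≠ d) j + 1) = j + if a ≠ d then 1 else 0 := by
        rw [Nat.count_succ']
        congr 1
        exact Nat.count_nth_of_infinite hinf j
      rw [← hc]
      exact Nat.nth_count (p := fun j => (a :: u).getD j q ≠ d) hp
    by_cases ha : a = d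
    · have h := key i
      simp only [ha, ne_eq, not_true_eq_false, if_false, Nat.add_zero] at h
      subst ha
      simp only [ne_eq, decide_not] at h ih ⊢
      rw [h]
      simpa using ih i
    · cases i with
      | zero =>
        have h0 : Nat.nth (fun j => (a :: u).getD j q ≠ d) 0 = 0 := by
          rw [Nat.nth_zero_of_zero]
          simpa using ha
        rw [h0]
        simp [ha]
      | succ i =>
        have h := key i
        simp only [ne_eq, ha, not_false_eq_true, if_true] at h
        simp only [ne_eq] at ih ⊢
        rw [h]
        have := ih i
        simpa [ha] using this

namespace SCA

variable {α Q : Type}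

open Classical in
/-- The global transition of a shrinking automaton on configurations given by the list of the cells
`0, 1, …` up to the last active one. -/
noncomputable def listNext (S : SCA α Q) (u : List Q) : List Q :=
  (listStep S.δ S.inactive u S.inactive).filter fun x => x ≠ S.del

theorem step_wordConfig (S : SCA α Q) (u : List Q) :
    S.toCA.step (S.toCA.wordConfig u) =
      S.toCA.wordConfig (listStep S.δ S.inactive u S.inactive) := by
  funext i
  cases i with
  | ofNat i =>
    have e1 : S.toCA.wordConfig u (Int.ofNat i) = u.getD i S.inactive := rfl
    have e2 : S.toCA.wordConfig u (Int.ofNat i + 1) = u.getD (i + 1) S.inactive := rfl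
    have e3 : S.toCA.wordConfig u (Int.ofNat i - 1) =
        if i = 0 then S.inactive else u.getD (i - 1) S.inactive := by
      cases i with
      | zero => rfl
      | succ i =>
        have : (Int.ofNat (i + 1) - 1 : ℤ) = Int.ofNat i := by simp
        rw [this]
        rfl
    have e4 : S.toCA.wordConfig (listStep S.δ S.inactive u S.inactive) (Int.ofNat i) =
      (listStep S.δ S.inactive u S.inactive).getD i S.inactive := rfl
    rw [CA.step, e1, e2, e3, e4]
    by_cases hi : i < u.length
    · rw [List.getD_eq_getElem?_getD (l := listStep S.δ S.inactive u S.inactive),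
        getElem?_listStep _ _ _ _ _ hi, Option.getD_some]
    · rw [List.getD_eq_default (l := listStep S.δ S.inactive u S.inactive)]
      · rw [List.getD_eq_default (n := i) (l := u) _ (by omega), S.δ_inactive]
      · rw [length_listStep]; omega
  | negSucc i => exact S.δ_inactive _ _

theorem shrinkStep_wordConfig (S : SCA α Q) (u : List Q) :
    S.shrinkStep (S.toCA.wordConfig u) = S.toCA.wordConfig (S.listNext u) := by
  classical
  rw [shrinkStep, step_wordConfig]
  funext i
  cases i with
  | ofNat i =>
    refine (getD_nth_ne S.del S.inactive S.del_ne_inactive.symm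
      (listStep S.δ S.inactive u S.inactive) i).trans ?_
    change _ = List.getD (S.listNext u) i S.inactive
    rw [listNext]
  | negSucc i => rfl

theorem iterate_shrinkStep_wordConfig (S : SCA α Q) (s : ℕ) (u : List Q) :
    S.shrinkStep^[s] (S.toCA.wordConfig u) = S.toCA.wordConfig (S.listNext^[s] u) := by
  induction s generalizing u with
  | zero => rfl
  | succ s ih => rw [Function.iterate_succ_apply, Function.iterate_succ_apply,
      shrinkStep_wordConfig, ih]

theorem acceptsAt_iff (S : SCA α Q) (w : List α) (s : ℕ) :
    S.AcceptsAt w s ↔ (S.listNext^[s] (w.map S.inp)).headD S.inactive ∈ S.accept := by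
  rw [AcceptsAt, CA.init, iterate_shrinkStep_wordConfig]
  have : ∀ v : List Q, S.toCA.wordConfig v 0 = v.headD S.inactive := by
    intro v; cases v <;> rfl
  rw [this]

end SCA

/-! ### The automaton -/

namespace BlockCount

/-- A digit of the two binary counters: the counter `true` counts ones, the counter `false` counts
zeros. Digits above `1` occur only at the most significant position and as intermediate sums. -/
abbrev Dig := Bool → Fin 4

/-- The symbols that travel through the blocks. -/
inductive Sym : Type where
  /-- a cell of an even-numbered block: a bit of its number (`none` once that bit is used up) and a
  digit of its counters -/
  | real (num : Option Bool) (d : Dig) : Sym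
  /-- the substitute for the symbols of the missing partner of a last, even-numbered block -/
  | dummy : Sym
  /-- a symbol of the first phase, in which block numbers are not shortened -/
  | keep (d : Dig) : Sym

/-- The counter digit of a symbol. -/
def Sym.cnt : Sym → Dig
  | .real _ d => d
  | .dummy => 0
  | .keep d => d

/-- The part a block plays in a phase: a block with an even number moves onto the block to its
right, a block with an odd number is joined by its left neighbour, and a block with an even number
that is the rightmost one stays alone. -/
inductive Role : Type where
  | even : Role
  | odd : Role
  | lone : Role

/-- The pulse that runs through each block from right to left at the end of a phase. Its components
are the new role of the block, whether all comparisons in the block have succeeded, the carry of the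
addition, the state of the evaluating automaton, whether the evaluation is conclusive (the block
number is used up and the auxiliary automaton has come to rest), and whether the input is accepted.
-/
structure Pulse (σ : Type) where
  role : Role
  ok : Bool
  carry : Dig
  reg : σ
  good : Bool
  acc : Bool

/-- The states of the token that travels at half speed through each block in the first phase:
absent, in the first or second half of its stay in a cell, or having left the last cell. -/
inductive Tok : Type where
  | none : Tok
  | half : Tok
  | full : Tok
  | done : Tok

/-- The contents of a cell that belongs to a block: whether it is the first or last cell of the
block; the token; the state of the auxiliary automaton, and whether that state has changed since the
previous pulse; the resident bit of the block number and counter digit (absent in blocks that move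
to the right); the travelling symbol; the symbol that is fed into the block at its first cell, if it
has no partner; and the pulse. -/
structure Cell (κ σ : Type) where
  first : Bool
  last : Bool
  tok : Tok
  aux : κ × Bool
  base : Option (Option Bool × Dig)
  top : Option Sym
  src : Option Sym
  pulse : Option (Pulse σ)

/-- The states of the shrinking automaton. -/
inductive St (κ σ : Type) : Type where
  | inp (s : BlockSymbol) : St κ σ
  | off : St κ σ
  | del : St κ σ
  /-- the error state, which is never left -/
  | err : St κ σ
  | cell (x : Cell κ σ) : St κ σ

instance : Finite BlockSymbol :=
  Finite.of_injective (β := Option (Option Bool × Option Bool))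
    (fun s => match s with
      | .sep => none
      | .pair a b => some (a, b))
    (by rintro (_ | ⟨a, b⟩) (_ | ⟨c, d⟩) h <;> simp_all)

instance : Finite Sym :=
  Finite.of_injective (β := (Option Bool × Dig) ⊕ Option Dig)
    (fun s => match s with
      | .real a b => .inl (a, b)
      | .dummy => .inr none
      | .keep d => .inr (some d))
    (by rintro (⟨a, b⟩ | _ | a) (⟨c, d⟩ | _ | c) h <;> simp_all)

instance : Finite Role :=
  Finite.of_injective (β := Fin 3)
    (fun s => match s with
      | .even => 0
      | .odd => 1
      | .lone => 2)
    (by rintro (_ | _ | _) (_ | _ | _) h <;> simp_all)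

instance : Finite Tok :=
  Finite.of_injective (β := Fin 4)
    (fun s => match s with
      | .none => 0
      | .half => 1
      | .full => 2
      | .done => 3)
    (by rintro (_ | _ | _ | _) (_ | _ | _ | _) h <;> simp_all)

instance {σ : Type} [Finite σ] : Finite (Pulse σ) :=
  Finite.of_injective (fun p : Pulse σ => (p.role, p.ok, p.carry, p.reg, p.good, p.acc))
    (by rintro ⟨⟩ ⟨⟩ h; simp_all)

instance {κ σ : Type} [Finite κ] [Finite σ] : Finite (Cell κ σ) :=
  Finite.of_injective (fun x : Cell κ σ =>
      (x.first, x.last, x.tok, x.aux, x.base, x.top, x.src, x.pulse))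
    (by rintro ⟨⟩ ⟨⟩ h; simp_all)

instance {κ σ : Type} [Finite κ] [Finite σ] : Finite (St κ σ) :=
  Finite.of_injective (β := BlockSymbol ⊕ Fin 3 ⊕ Cell κ σ)
    (fun s => match s with
      | .inp s => .inl s
      | .off => .inr (.inl 0)
      | .del => .inr (.inl 1)
      | .err => .inr (.inl 2)
      | .cell x => .inr (.inr x))
    (by rintro (_ | _ | _ | _ | _) (_ | _ | _ | _ | _) h <;> simp_all)

/-- The data on which the shrinking automaton depends: the auxiliary automaton, which constructs a
binary number in each block, its state for the digit one, and a finite automaton that evaluates the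
digits of the two counters and of the constructed number, least significant digits first. -/
structure Prog (κ σ : Type) where
  C : CA Unit κ
  one : κ
  start : σ
  next : σ → Dig → Bool → σ
  final : σ → Prop

namespace St

variable {κ σ : Type}

/-- The contents of a cell, if it belongs to a block. -/
def cell? : St κ σ → Option (Cell κ σ)
  | .cell x => some x
  | _ => none

-- The components of a cell, with default values for the states that belong to no block.

def first (s : St κ σ) : Bool := s.cell?.elim false Cell.first
def last (s : St κ σ) : Bool := s.cell?.elim false Cell.last
def tok (s : St κ σ) : Tok := s.cell?.elim .none Cell.tok
def base (s : St κ σ) : Option (Option Bool × Dig) := s.cell?.bind Cell.base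
def top (s : St κ σ) : Option Sym := s.cell?.bind Cell.top
def src (s : St κ σ) : Option Sym := s.cell?.bind Cell.src
def pulse (s : St κ σ) : Option (Pulse σ) := s.cell?.bind Cell.pulse
def num (s : St κ σ) : Option Bool := s.base.bind Prod.fst

@[simp] theorem first_cell (x : Cell κ σ) : (St.cell x).first = x.first := rfl
@[simp] theorem last_cell (x : Cell κ σ) : (St.cell x).last = x.last := rfl
@[simp] theorem tok_cell (x : Cell κ σ) : (St.cell x).tok = x.tok := rfl
@[simp] theorem base_cell (x : Cell κ σ) : (St.cell x).base = x.base := rfl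
@[simp] theorem top_cell (x : Cell κ σ) : (St.cell x).top = x.top := rfl
@[simp] theorem src_cell (x : Cell κ σ) : (St.cell x).src = x.src := rfl
@[simp] theorem pulse_cell (x : Cell κ σ) : (St.cell x).pulse = x.pulse := rfl
@[simp] theorem tok_off : (St.off : St κ σ).tok = .none := rfl
@[simp] theorem pulse_off : (St.off : St κ σ).pulse = none := rfl
@[simp] theorem pulse_err : (St.err : St κ σ).pulse = none := rfl
@[simp] theorem pulse_inp (s : BlockSymbol) : (St.inp s : St κ σ).pulse = none := rfl

end St

/-- The new bit of the block number in a cell: block numbers are shifted to the right by one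
position, which removes the least significant bit, except in the first phase. -/
def newNum (first : Bool) (lnum num : Option Bool) (s : Sym) : Option Bool :=
  match s with
  | .keep _ => num
  | _ => if first then none else lnum

section

variable {κ σ : Type} (M : Prog κ σ)

open Classical in
/-- The pulse that starts at the last cell of a block, where `re` says whether the block is the
rightmost one, `num` and `nn` are the old and new bit of the block number in this cell. It is not
`ok` if other blocks follow although the block number is used up, or if the block had no partner for
the most significant bit of its number, unless block numbers have only one bit. -/
noncomputable def startPulse (first re : Bool) (num nn : Option Bool) (s : Sym) : Pulse σ where
  role := if nn = some true then .odd else if re then .lone else .even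
  ok := decide ((nn = none → re = true) ∧
    ¬ (s = .dummy ∧ num = some false ∧ nn = none ∧ first = false))
  carry := 0
  reg := M.start
  good := true
  acc := false

/-- The sum of the resident digit, the digit of the travelling symbol and the carry. -/
def total (d : Dig) (s : Sym) (p : Pulse σ) (b : Bool) : ℕ := d b + s.cnt b + p.carry b

/-- The new counter digit of a cell. The most significant digit is not reduced. -/
def newDig (first : Bool) (d : Dig) (s : Sym) (p : Pulse σ) : Dig :=
  fun b => if first then Fin.ofNat 4 (total d s p b) else Fin.ofNat 4 (total d s p b % 2)

open Classical in
/-- The pulse that leaves a cell which the pulse `p` has entered. -/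
noncomputable def outPulse (first last loff : Bool) (num nn : Option Bool) (d : Dig) (s : Sym)
    (aux : κ × Bool) (p : Pulse σ) : Pulse σ :=
  let ok := p.ok && match s with
    | .real a _ => last || decide (a = num)
    | _ => true
  let reg := M.next p.reg (newDig first d s p) (decide (aux.1 = M.one))
  let good := p.good && nn.isNone && !aux.2
  { role := p.role
    ok := ok
    carry := fun b => if first then 0 else Fin.ofNat 4 (total d s p b / 2)
    reg := reg
    good := good
    acc := first && loff && decide (p.role = .lone) && ok && good && decide (M.final reg) }

open Classical in
/-- The auxiliary layer of a cell when the state of the auxiliary automaton becomes `c`. -/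
noncomputable def auxUpdate (a : κ × Bool) (c : κ) : κ × Bool := (c, a.2 || decide (c ≠ a.1))

/-- One step of the auxiliary automaton in a cell. -/
noncomputable def auxStep (l : St κ σ) (x : Cell κ σ) (r : St κ σ) : κ × Bool :=
  auxUpdate x.aux <|
    M.C.δ (if x.first then M.C.inactive else l.cell?.elim M.C.inactive fun y => y.aux.1)
      x.aux.1 (if x.last then M.C.inactive else r.cell?.elim M.C.inactive fun y => y.aux.1)

/-- One step of the token in a cell. -/
def tokStep (l : St κ σ) (x : Cell κ σ) : Tok :=
  match x.tok with
  | .half => .full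
  | .full => if x.last then .done else .none
  | .done => .done
  | .none => if x.first || l.last then .none else match l.tok with
    | .full => .half
    | _ => .none

open Classical in
/-- The symbol that enters a cell without travelling symbol: from the source or from the even block
to the left, in the first cell of a block, and from the left neighbour in other cells. -/
noncomputable def inflow (l : St κ σ) (x : Cell κ σ) : Option Sym :=
  if x.first then
    match x.src with
    | some s => some s
    | none => if l.last = true ∧ l.base = none ∧ x.base ≠ none then l.top else none
  else if l.last = false ∧ x.pulse = none then l.top else none

/-- Whether the right neighbour `r` takes the travelling symbol of the cell `x`. -/
def Outflow (x : Cell κ σ) (r : St κ σ) : Prop :=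
  r.top = none ∧ ((x.last = true ∧ r.first = true ∧ x.base = none ∧ r.base ≠ none ∧ r.src = none) ∨
    (x.last = false ∧ r.first = false ∧ r.pulse = none))

open Classical in
/-- The next travelling symbol of a cell that no pulse enters. -/
noncomputable def topNext (l : St κ σ) (x : Cell κ σ) (r : St κ σ) : Option Sym :=
  match x.top with
  | none => inflow l x
  | some s => if Outflow x r then none else some s

/-- The next contents of a cell that no pulse enters. -/
noncomputable def idle (l : St κ σ) (x : Cell κ σ) (r : St κ σ) : Cell κ σ :=
  { x with
    tok := tokStep l x
    aux := auxStep M l x r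
    top := topNext l x r
    pulse := none }

open Classical in
/-- The next contents of a cell that the pulse `p` enters. -/
noncomputable def process (l : St κ σ) (x : Cell κ σ) (r : St κ σ) (num : Option Bool) (d : Dig)
    (s : Sym) (p : Pulse σ) : Cell κ σ :=
  let nn := newNum x.first l.num num s
  let nd := newDig x.first d s p
  { first := x.first
    last := x.last
    tok := tokStep l x
    aux := if p.role = .even then (M.C.inactive, false) else ((auxStep M l x r).1, false)
    base := if p.role = .even then none else some (nn, nd)
    top := if p.role = .even then some (.real nn nd) else none
    src := if p.role = .lone then some .dummy else none
    pulse := some (outPulse M x.first x.last (decide (l = .off)) num nn d s x.aux p) }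

open Classical in
/-- The pulse that enters the cell `x` from the right. It starts at the last cell. -/
noncomputable def pulseIn (l : St κ σ) (x : Cell κ σ) (r : St κ σ) (num : Option Bool) (s : Sym) :
    Option (Pulse σ) :=
  if x.last then
    some (startPulse M x.first (decide (r = .off)) num (newNum x.first l.num num s) s)
  else r.pulse

/-- The next contents of a cell that is neither deleted nor becomes an error. -/
noncomputable def cellNext (l : St κ σ) (x : Cell κ σ) (r : St κ σ) : Cell κ σ :=
  match x.base, x.top with
  | some b, some s => match pulseIn M l x r b.1 s with
    | some p => process M l x r b.1 b.2 s p
    | none => idle M l x r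
  | _, _ => idle M l x r

/-- Whether a first cell with pulse `p` may have the left neighbour `l`: even and odd blocks
alternate, starting with an even one, and the token is at the end of the block to the left or has
been there. -/
def Compat (l : St κ σ) (p : Pulse σ) : Prop :=
  p.ok = true ∧ ((l = .off ∧ p.role ≠ .odd) ∨
    ((l.tok = .full ∨ l.tok = .done) ∧ (p.role = .odd ↔ l.base = none)))

/-- The conditions under which a cell becomes an error. -/
def Bad (l : St κ σ) (x : Cell κ σ) (r : St κ σ) : Prop :=
  (x.first = true ∧ ∃ p, x.pulse = some p ∧ ¬ Compat l p) ∨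
    (x.last = true ∧ x.tok = .full ∧ r ≠ .off ∧ r.pulse = none)

/-- Whether a cell can be deleted: it is the leftmost cell of an even block, and its symbol and
those of the cells to the left have moved away. -/
def Dead (l : St κ σ) (x : Cell κ σ) : Prop :=
  x.base = none ∧ x.top = none ∧ (l = .off ∨ l.last = true)

/-- Whether the cell next to a block is a separator or lies beyond the input. -/
def IsEdge (s : St κ σ) : Prop := s = .off ∨ s = .inp .sep

/-- The counter digit of an input symbol. -/
def bitDig (z : Bool) : Dig := fun b => if b = z then 1 else 0

open Classical in
/-- The first step, in which the separators are deleted and blocks get their form. -/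
noncomputable def inpNext (l : St κ σ) (s : BlockSymbol) (r : St κ σ) : St κ σ :=
  match s with
  | .sep => if IsEdge l ∨ IsEdge r then .err else .del
  | .pair (some b) (some z) =>
    if ¬ IsEdge l ∧ z = true then .err
    else .cell
      { first := decide (IsEdge l)
        last := decide (IsEdge r)
        tok := if IsEdge l then .half else .none
        aux := (M.C.inp (), true)
        base := some (some b, 0)
        top := if IsEdge l then some (.keep (bitDig z)) else none
        src := some (.keep 0)
        pulse := none }
  | _ => .err

open Classical in
/-- The local transition function. -/
noncomputable def rule (l x r : St κ σ) : St κ σ :=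
  match x with
  | .off => .off
  | .inp s => inpNext M l s r
  | .cell x => if Bad l x r then .err else if Dead l x then .del else .cell (cellNext M l x r)
  | _ => .err

/-- The shrinking automaton. -/
noncomputable def machine : SCA BlockSymbol (St κ σ) where
  δ := rule M
  inp := .inp
  inp_injective := fun _ _ h => by simpa using h
  inactive := .off
  inactive_not_inp := by simp
  δ_inactive := fun _ _ => rfl
  accept := {s | ∃ p, s.pulse = some p ∧ p.acc = true}
  inactive_not_accept := by simp
  del := .del
  del_not_inp := by simp
  del_ne_inactive := by simp

open Classical in
/-- One step of the automaton, on the list of its active cells. -/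
noncomputable def next (u : List (St κ σ)) : List (St κ σ) :=
  (listStep (rule M) .off u .off).filter fun x => x ≠ .del

/-! ### Errors are permanent and prevent acceptance -/

/-- A pulse of role `lone` is visible in the cell. -/
def LonePulse (x : St κ σ) : Prop := ∃ p, x.pulse = some p ∧ p.role = .lone

/-- The configuration contains an error that no pulse on its left can contradict. -/
def Poisoned (u : List (St κ σ)) : Prop :=
  ∃ l r, u = l ++ .err :: r ∧ ∀ x ∈ l, ¬ LonePulse x

/-- A cell accepts only with a pulse of role `lone`. -/
def AccSound (x : St κ σ) : Prop := ∀ p, x.pulse = some p → p.acc = true → p.role = .lone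

/-- A pulse in a cell has been started there, if the cell is the last one of its block, or comes
from the right neighbour otherwise. It keeps its role, which is `lone` only in the rightmost block,
and it accepts only with that role. -/
theorem pulse_cellNext {l : St κ σ} {x : Cell κ σ} {r : St κ σ} {p : Pulse σ}
    (h : (cellNext M l x r).pulse = some p) :
    (∃ q, (x.last = true → q.role = .lone → r = .off) ∧
      (x.last = false → r.pulse = some q) ∧ p.role = q.role ∧ (p.acc = true → p.role = .lone)) ∧
      x.base ≠ none ∧ x.top ≠ none := by
  unfold cellNext at h
  split at h
  · rename_i b s hb hs
    refine ⟨?_, by simp [hb], by simp [hs]⟩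
    split at h
    · rename_i q hq
      simp only [process, Option.some.injEq] at h
      refine ⟨q, fun hl hr => ?_, fun hl => ?_, ?_, ?_⟩
      · simp only [pulseIn, hl, if_true, Option.some.injEq] at hq
        subst hq
        by_contra hoff
        simp only [startPulse, hoff] at hr
        split at hr <;> simp at hr
      · simpa [pulseIn, hl] using hq
      · rw [← h]; rfl
      · rw [← h]; simp +contextual [outPulse]
    · simp [idle] at h
  · simp [idle] at h

theorem pulse_rule_inp (l r : St κ σ) (s : BlockSymbol) : (rule M l (.inp s) r).pulse = none := by
  rcases s with _ | ⟨_ | b, _ | z⟩ <;> simp only [rule, inpNext] <;> (try split_ifs) <;> rfl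

theorem rule_ne_off (l : St κ σ) {x : St κ σ} (r : St κ σ) (hx : x ≠ .off) :
    rule M l x r ≠ .off := by
  cases x with
  | inp s =>
    rcases s with _ | ⟨_ | b, _ | z⟩ <;> simp only [rule, inpNext] <;> (try split_ifs) <;> simp
  | off => exact absurd rfl hx
  | del => simp [rule]
  | err => simp [rule]
  | cell x =>
    rw [rule]
    split_ifs <;> simp

theorem rule_accSound (l x r : St κ σ) : AccSound (rule M l x r) := by
  intro p hp hacc
  cases x with
  | inp s => simp [pulse_rule_inp] at hp
  | off => simp [rule] at hp
  | del => simp [rule] at hp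
  | err => simp [rule] at hp
  | cell x =>
    simp only [rule] at hp
    split_ifs at hp
    · simp at hp
    · simp [St.pulse, St.cell?] at hp
    · obtain ⟨⟨q, -, -, -, h⟩, -⟩ := pulse_cellNext M hp
      exact h hacc

/-- Pulses of role `lone` come from the right. -/
theorem not_lonePulse_rule {l x r : St κ σ} (hr : r ≠ .off) (h : ¬ LonePulse r) :
    ¬ LonePulse (rule M l x r) := by
  rintro ⟨p, hp, hl⟩
  cases x with
  | inp s => simp [pulse_rule_inp] at hp
  | off => simp [rule] at hp
  | del => simp [rule] at hp
  | err => simp [rule] at hp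
  | cell x =>
    simp only [rule] at hp
    split_ifs at hp
    · simp at hp
    · simp [St.pulse, St.cell?] at hp
    · obtain ⟨⟨q, h1, h2, h3, -⟩, -⟩ := pulse_cellNext M hp
      cases hx : x.last with
      | true => exact hr (h1 hx (h3 ▸ hl))
      | false => exact h ⟨q, h2 hx, h3 ▸ hl⟩

theorem exists_of_mem_listStep {Q : Type} {δ : Q → Q → Q → Q} {l r x : Q} {u : List Q}
    (h : x ∈ listStep δ l u r) : ∃ a c, ∃ i, ∃ hi : i < u.length,
      c = u.getD (i + 1) r ∧ δ a u[i] c = x := by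
  rw [List.mem_iff_getElem?] at h
  obtain ⟨i, hi⟩ := h
  have hil : i < u.length := by
    rw [← length_listStep δ l u r]
    exact (List.getElem?_eq_some_iff.1 hi).1
  rw [getElem?_listStep _ _ _ _ _ hil, Option.some.injEq, List.getD_eq_getElem _ _ hil] at hi
  exact ⟨_, _, i, hil, rfl, hi⟩

/-- The cells to the left of an error remain without pulses of role `lone`, because such a pulse
would have to come from the error or to be started at the right end of the configuration. -/
theorem next_poisoned {u : List (St κ σ)} (h : Poisoned u) (hoff : .off ∉ u) :
    Poisoned (next M u) := by
  obtain ⟨l, r, rfl, hl⟩ := h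
  rw [next, listStep_append, List.filter_append, listStep]
  have herr : ∀ a b : St κ σ, rule M a .err b = .err := fun _ _ => rfl
  refine ⟨_, _, by rw [herr, List.filter_cons_of_pos (by simp)], ?_⟩
  intro x hx
  obtain ⟨a, c, i, hi, hc, rfl⟩ := exists_of_mem_listStep (List.mem_of_mem_filter hx)
  have hmem : c ∈ l ∨ c = .err := by
    by_cases h : i + 1 < l.length
    · left
      rw [hc, List.getD_eq_getElem _ _ h]
      exact List.getElem_mem h
    · right
      rw [hc, List.getD_eq_default _ _ (by omega)]
      rfl
  apply not_lonePulse_rule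
  · rcases hmem with h | h
    · rintro h'
      exact hoff (by rw [← h']; exact List.mem_append_left _ h)
    · rw [h]; simp
  · rcases hmem with h | h
    · exact hl _ h
    · rw [h]; rintro ⟨p, hp, -⟩; simp at hp

theorem off_notMem_next {u : List (St κ σ)} (hoff : .off ∉ u) : .off ∉ next M u := by
  intro h
  obtain ⟨a, c, i, hi, hc, h⟩ := exists_of_mem_listStep (List.mem_of_mem_filter h)
  exact rule_ne_off M _ _ (fun h => hoff (h ▸ List.getElem_mem hi)) h

/-- No configuration after a poisoned one is accepting. -/
theorem not_accept_of_poisoned {u : List (St κ σ)} (h : Poisoned u) (hoff : .off ∉ u)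
    (hacc : ∀ x ∈ u, AccSound x) (s : ℕ) :
    ((next M)^[s] u).headD .off ∉ (machine M).accept := by
  induction s generalizing u with
  | zero =>
    obtain ⟨l, r, rfl, hl⟩ := h
    rintro ⟨p, hp, ha⟩
    cases l with
    | nil => simp at hp
    | cons a l =>
      exact hl a (by simp) ⟨p, hp, hacc a (by simp) p hp ha⟩
  | succ s ih =>
    rw [Function.iterate_succ_apply]
    refine ih (next_poisoned M h hoff) (off_notMem_next M hoff) ?_
    intro x hx
    obtain ⟨a, c, i, hi, hc, rfl⟩ := exists_of_mem_listStep (List.mem_of_mem_filter hx)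
    exact rule_accSound M _ _ _

end

/-! ### The course of a phase in one segment -/

section

variable {κ σ : Type} (M : Prog κ σ)

/-- The auxiliary layer of cell `k` of a block of length `n`, at `τ` steps after the first one.
Pulses enter the cell in the steps that lead to a time `τ + 1` with `2 * n ∣ τ + 2 + k`. -/
noncomputable def auxAt (n : ℕ) : ℕ → ℕ → κ × Bool
  | 0, _ => (M.C.inp (), true)
  | τ + 1, k =>
    let c := M.C.δ (if k = 0 then M.C.inactive else (auxAt n τ (k - 1)).1) (auxAt n τ k).1
      (if k + 1 = n then M.C.inactive else (auxAt n τ (k + 1)).1)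
    if 2 * n ∣ τ + 2 + k then (c, false) else auxUpdate (auxAt n τ k) c

/-- The token of cell `k` of a block of length `n`, at `τ` steps after the first one. -/
def tokAt (n τ k : ℕ) : Tok :=
  if τ = 2 * k then .half else if τ = 2 * k + 1 then .full
  else if 2 * k + 1 < τ ∧ k + 1 = n then .done else .none

/-- A segment of the configuration in a phase: a block that stays, of length `n`, with the bits of
its number and the digits of its counters, and the symbols `s k` that are to arrive in its cells.
They come from a source, or, if there is none, from an even block to the left that is part of the
segment. Furthermore, whether the segment is the leftmost and the rightmost one. -/
structure Seg where
  n : ℕ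
  num : ℕ → Option Bool
  dig : ℕ → Dig
  s : ℕ → Sym
  src : Option Sym
  li : Bool
  re : Bool

namespace Seg

variable (D : Seg)

/-- The bits of the block number after the phase. -/
noncomputable def nn (k : ℕ) : Option Bool :=
  newNum (decide (k = 0)) (D.num (k - 1)) (D.num k) (D.s k)

/-- The pulse that leaves cell `k` in phase `P` if the pulse `p` enters it. -/
noncomputable def outAt (P k : ℕ) (p : Pulse σ) : Pulse σ :=
  outPulse M (decide (k = 0)) (decide (k + 1 = D.n)) (decide (k = 0) && D.li && D.src.isSome)
    (D.num k) (D.nn k) (D.dig k) (D.s k) (auxAt M D.n (2 * D.n * P + (2 * D.n - 2 - k)) k) p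

/-- The pulse of phase `P` after it has passed `j` cells. -/
noncomputable def pulse (P : ℕ) : ℕ → Pulse σ
  | 0 => startPulse M (decide (D.n = 1)) D.re (D.num (D.n - 1)) (D.nn (D.n - 1)) (D.s (D.n - 1))
  | j + 1 => D.outAt M P (D.n - 1 - j) (pulse P j)

/-- The role of the block in the next phase. -/
noncomputable def role : Role :=
  if D.nn (D.n - 1) = some true then .odd else if D.re then .lone else .even

theorem role_pulse (P j : ℕ) : (D.pulse M P j).role = D.role := by
  induction j with
  | zero => simp [pulse, startPulse, role]
  | succ j ih => rw [pulse, ← ih]; rfl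

/-- The digits of the counters after the phase. -/
noncomputable def dg (P k : ℕ) : Dig :=
  newDig (decide (k = 0)) (D.dig k) (D.s k) (D.pulse M P (D.n - 1 - k))

open Classical in
/-- The cell `k` of the block that stays, at time `u` of phase `P`, before a pulse has entered it.
The symbol for the last cell comes first, and symbols enter the block in every second step. -/
noncomputable def preCell (P u k : ℕ) : Cell κ σ where
  first := decide (k = 0)
  last := decide (k + 1 = D.n)
  tok := tokAt D.n (2 * D.n * P + u) k
  aux := auxAt M D.n (2 * D.n * P + u) k
  base := some (D.num k, D.dig k)
  top := if k ≤ u ∧ Even (u - k) then some (D.s (D.n - 1 - (u - k) / 2)) else none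
  src := D.src
  pulse := none

open Classical in
/-- The cell `k` of the block that stays, at time `u` of phase `P`, after a pulse has entered it. -/
noncomputable def postCell (P u k : ℕ) : Cell κ σ where
  first := decide (k = 0)
  last := decide (k + 1 = D.n)
  tok := tokAt D.n (2 * D.n * P + u) k
  aux := if D.role = .even then (M.C.inactive, false) else auxAt M D.n (2 * D.n * P + u) k
  base := if D.role = .even then none else some (D.nn k, D.dg M P k)
  top := if D.role = .even then some (.real (D.nn k) (D.dg M P k)) else none
  src := if D.role = .lone then some .dummy else none
  pulse := if u + k + 1 = 2 * D.n then some (D.pulse M P (D.n - k)) else none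

open Classical in
/-- The cell `k` of the block that stays, at time `u` of phase `P`. -/
noncomputable def stayCell (P u k : ℕ) : Cell κ σ :=
  if u + k + 1 < 2 * D.n then D.preCell M P u k else D.postCell M P u k

open Classical in
/-- The cell `k` of the block that moves to the right, at time `u` of phase `P`. -/
noncomputable def moveCell (P u k : ℕ) : Cell κ σ where
  first := decide (k = 0)
  last := decide (k + 1 = D.n)
  tok := tokAt D.n (2 * D.n * P + u) k
  aux := (M.C.inactive, false)
  base := none
  top := if u + k + 2 ≤ D.n then some (D.s k)
    else if Even (D.n + k - u) ∧ u + 2 ≤ D.n + k then some (D.s ((D.n + k - u) / 2 - 1)) else none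
  src := none
  pulse := none

/-- The remaining cells of the block that moves, at time `u` of phase `P`. -/
noncomputable def moving (P u : ℕ) : List (St κ σ) :=
  (List.range' (u + 1 - D.n) (D.n - (u + 1 - D.n))).map fun k => .cell (D.moveCell M P u k)

/-- The cells of the block that stays, at time `u` of phase `P`. -/
noncomputable def staying (P u : ℕ) : List (St κ σ) :=
  (List.range' 0 D.n).map fun k => .cell (D.stayCell M P u k)

open Classical in
/-- The cells of the segment, at time `u` of phase `P`. -/
noncomputable def cells (P u : ℕ) : List (St κ σ) :=
  if D.src = none then D.moving M P u ++ D.staying M P u else D.staying M P u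

variable {D}

theorem tokAt_half {n τ k : ℕ} (h : τ = 2 * k) : tokAt n τ k = .half := if_pos h

theorem tokAt_full {n τ k : ℕ} (h : τ = 2 * k + 1) : tokAt n τ k = .full := by
  rw [tokAt, if_neg (by omega), if_pos h]

theorem tokAt_done {n τ k : ℕ} (h : 2 * k + 1 < τ) (hk : k + 1 = n) : tokAt n τ k = .done := by
  rw [tokAt, if_neg (by omega), if_neg (by omega), if_pos ⟨h, hk⟩]

theorem tokAt_none {n τ k : ℕ} (h1 : τ ≠ 2 * k) (h2 : τ ≠ 2 * k + 1)
    (h3 : 2 * k + 1 < τ → k + 1 ≠ n) : tokAt n τ k = .none := by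
  rw [tokAt, if_neg h1, if_neg h2, if_neg (by tauto)]

theorem tokStep_eq {n k τ : ℕ} {x : Cell κ σ} {l : St κ σ} (hf : x.first = decide (k = 0))
    (hx : x.last = decide (k + 1 = n)) (ht : x.tok = tokAt n τ k)
    (hl : k ≠ 0 → l.last = false → k ≠ n ∧ l.tok = tokAt n τ (k - 1))
    (hl' : k ≠ 0 → l.last = true → 2 * k < τ ) :
    tokStep l x = tokAt n (τ + 1) k := by
  rw [tokStep, ht, hf, hx]
  by_cases h1 : τ = 2 * k
  · rw [tokAt_half h1, tokAt_full (by omega)]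
  by_cases h2 : τ = 2 * k + 1
  · rw [tokAt_full h2]
    by_cases h3 : k + 1 = n
    · rw [tokAt_done (by omega) h3]; simp [h3]
    · rw [tokAt_none (by omega) (by omega) (by omega)]; simp [h3]
  by_cases h3 : 2 * k + 1 < τ ∧ k + 1 = n
  · rw [tokAt_done h3.1 h3.2, tokAt_done (by omega) h3.2]
  rw [tokAt_none h1 h2 (by tauto)]
  by_cases h0 : k = 0
  · rw [tokAt_none (by omega) (by omega) (by omega)]
    simp [h0]
  cases h : l.last with
  | false =>
    obtain ⟨hkn, hl⟩ := hl h0 h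
    rw [hl]
    by_cases h4 : τ = 2 * (k - 1) + 1
    · rw [tokAt_full h4, tokAt_half (by omega)]
      simp [h0]
    · rw [tokAt_none (τ := τ + 1) (by omega) (by omega) (by omega)]
      have h5 : tokAt n τ (k - 1) ≠ .full := by
        simp only [tokAt, if_neg h4]
        split_ifs <;> simp
      simp [h0]
  | true =>
    have := hl' h0 h
    rw [tokAt_none (τ := τ + 1) (by omega) (by omega) (by omega)]
    rw [Bool.or_true, if_pos rfl]

theorem auxStep_eq {n k τ : ℕ} {x : Cell κ σ} {l r : St κ σ} (hf : x.first = decide (k = 0))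
    (hx : x.last = decide (k + 1 = n)) (ha : x.aux = auxAt M n τ k)
    (hl : k ≠ 0 → ∃ y : Cell κ σ, l = .cell y ∧ y.aux = auxAt M n τ (k - 1))
    (hr : k + 1 ≠ n → ∃ y : Cell κ σ, r = .cell y ∧ y.aux = auxAt M n τ (k + 1)) :
    (auxStep M l x r).1 = (auxAt M n (τ + 1) k).1 ∧
      (¬ 2 * n ∣ τ + 2 + k → auxStep M l x r = auxAt M n (τ + 1) k) := by
  have h1 : (if x.first = true then M.C.inactive else l.cell?.elim M.C.inactive fun y => y.aux.1) =
      if k = 0 then M.C.inactive else (auxAt M n τ (k - 1)).1 := by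
    rw [hf]
    by_cases h : k = 0
    · simp [h]
    · obtain ⟨y, rfl, hy⟩ := hl h
      simp [h, St.cell?, hy]
  have h2 : (if x.last = true then M.C.inactive else r.cell?.elim M.C.inactive fun y => y.aux.1) =
      if k + 1 = n then M.C.inactive else (auxAt M n τ (k + 1)).1 := by
    rw [hx]
    by_cases h : k + 1 = n
    · simp [h]
    · obtain ⟨y, rfl, hy⟩ := hr h
      simp [h, St.cell?, hy]
  rw [auxStep, auxAt, h1, h2, ha]
  refine ⟨?_, fun h => (if_neg h).symm⟩
  split_ifs <;> rfl

/-- A pulse resets the change flag of the auxiliary layer. -/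
theorem snd_auxAt_succ {n k τ : ℕ} (h : 2 * n ∣ τ + 2 + k) : (auxAt M n (τ + 1) k).2 = false := by
  simp [auxAt, h]

/-- What the segment requires of its right neighbour cell during a phase. -/
def Right (r : St κ σ) : Prop := r.base = none ∨ r.src ≠ none

/-- What the block that stays requires of its left neighbour cell at time `u` of a phase. -/
def Feeds (D : Seg) (u : ℕ) (l : St κ σ) : Prop :=
  (D.src = none → l.last = true ∧ l.base = none ∧
    (Odd u → l.top = some (D.s (D.n - 1 - (u + 1) / 2)))) ∧
  (∀ q, D.src = some q → ∀ j, j + 1 < D.n → D.s j = q)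

theorem not_bad_of_tok {l r : St κ σ} {x : Cell κ σ} (h : x.first = true → x.pulse = none)
    (h' : x.last = true → x.tok ≠ .full) : ¬ Bad l x r := by
  rintro (⟨h1, p, h2, -⟩ | ⟨h1, h2, -⟩)
  · rw [h h1] at h2; cases h2
  · exact h' h1 h2

/-- The token does not leave the last cell of a block before the end of the first phase. -/
theorem tokAt_ne_full {P u k : ℕ} {n : ℕ} (hu : u + 2 ≤ 2 * n) (h : k + 1 = n) :
    tokAt n (2 * n * P + u) k ≠ .full := by
  have h1 : 2 * n * P + u ≠ 2 * k + 1 := by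
    rcases P with _ | P
    · omega
    · have : 2 * n * (P + 1) = 2 * n * P + 2 * n := by ring
      omega
  simp only [tokAt, if_neg h1]
  split_ifs <;> simp

open Classical in
/-- The block that stays develops as described, whatever happens outside the segment. -/
theorem rule_stayCell {P u k : ℕ} {l r : St κ σ} (hk : k < D.n) (hu : u + 2 ≤ 2 * D.n)
    (hl : D.Feeds u l) (hli : l = .off ↔ (D.li && D.src.isSome) = true)
    (hr : Right r) (hre : r = .off ↔ D.re = true) :
    rule M (if k = 0 then l else .cell (D.stayCell M P u (k - 1))) (.cell (D.stayCell M P u k))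
      (if k + 1 = 0 + D.n then r else .cell (D.stayCell M P u (k + 1))) =
      .cell (D.stayCell M P (u + 1) k) := by
  have htok : tokStep (if k = 0 then l else .cell (D.stayCell M P u (k - 1)))
      (D.stayCell M P u k) = tokAt D.n (2 * D.n * P + u + 1) k := by
    have hfirst : (D.stayCell M P u k).first = decide (k = 0) := by
      unfold stayCell; split_ifs <;> rfl
    have hlast : (D.stayCell M P u k).last = decide (k + 1 = D.n) := by
      unfold stayCell; split_ifs <;> rfl
    have htok : (D.stayCell M P u k).tok = tokAt D.n (2 * D.n * P + u) k := by
      unfold stayCell; split_ifs <;> rfl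
    refine tokStep_eq hfirst hlast htok ?_ ?_
    · intro h0 _
      rw [if_neg h0, St.tok_cell]
      refine ⟨by omega, ?_⟩
      unfold stayCell; split_ifs <;> rfl
    · intro h0 h
      rw [if_neg h0, St.last_cell] at h
      have : (D.stayCell M P u (k - 1)).last = decide (k - 1 + 1 = D.n) := by
        unfold stayCell; split_ifs <;> rfl
      rw [this, decide_eq_true_eq] at h
      omega
  rw [Nat.zero_add]
  by_cases hpre : u + k + 1 < 2 * D.n
  -- Case distinction: no pulse has entered the cell, or one has.
  · have hx : D.stayCell M P u k = D.preCell M P u k := if_pos hpre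
    rw [hx] at htok ⊢
    have hbad : ∀ l' r', ¬ Bad l' (D.preCell M P u k) r' := fun l' r' => by
      apply not_bad_of_tok
      · intro _; rfl
      · intro h
        exact tokAt_ne_full hu (by simpa [preCell] using h)
    have hdead : ∀ l', ¬ Dead l' (D.preCell M P u k) := fun l' h => by
      simpa [preCell] using h.1
    rw [rule, if_neg (hbad _ _), if_neg (hdead _)]
    have hleft : k ≠ 0 → D.stayCell M P u (k - 1) = D.preCell M P u (k - 1) := fun h =>
      if_pos (by omega)
    by_cases hproc : u + k + 2 < 2 * D.n
    -- A pulse enters the cell in this step if and only if `u + k + 2 = 2 * D.n`.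
    · have hright : D.stayCell M P u (k + 1) = D.preCell M P u (k + 1) := if_pos (by omega)
      have hnext : D.stayCell M P (u + 1) k = D.preCell M P (u + 1) k := if_pos (by omega)
      rw [hnext]
      have haux := (auxStep_eq M (x := D.preCell M P u k) (n := D.n) (k := k)
        (τ := 2 * D.n * P + u)
        (l := if k = 0 then l else .cell (D.stayCell M P u (k - 1)))
        (r := if k + 1 = D.n then r else .cell (D.stayCell M P u (k + 1))) rfl rfl rfl
        (fun h => ⟨_, if_neg h, by rw [hleft h]; rfl⟩)
        (fun h => ⟨_, if_neg h, by rw [hright]; rfl⟩)).2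
        (by
          intro h
          have : 2 * D.n * P + u + 2 + k = 2 * D.n * P + (u + k + 2) := by ring
          rw [this, Nat.dvd_add_right (Dvd.intro _ rfl)] at h
          have := Nat.le_of_dvd (by omega) h
          omega)
      have hidle : ∀ l' r', (k + 1 = D.n ∨ r'.pulse = none) →
          cellNext M l' (D.preCell M P u k) r' = idle M l' (D.preCell M P u k) r' := by
        intro l' r' h
        by_cases hk' : k + 1 = D.n
        · have : (D.preCell M P u k).top = none := by
            simp only [preCell]
            rw [if_neg (by omega)]
          unfold cellNext
          rw [this]
          split <;> simp_all
        · unfold cellNext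
          split
          · rename_i b s hb hs
            have : pulseIn M l' (D.preCell M P u k) r' b.1 s = none := by
              simp [pulseIn, preCell, hk', h.resolve_left hk']
            rw [this]
          · rfl
      rw [hidle]
      · simp only [idle]
        rw [haux, htok]
        have htop : topNext (if k = 0 then l else .cell (D.stayCell M P u (k - 1)))
            (D.preCell M P u k) (if k + 1 = D.n then r else .cell (D.stayCell M P u (k + 1))) =
            (D.preCell M P (u + 1) k).top := by
          rw [topNext]
          by_cases hev : k ≤ u ∧ Even (u - k)
          · have h1 : (D.preCell M P u k).top = some (D.s (D.n - 1 - (u - k) / 2)) := by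
              simp only [preCell, if_pos hev]
            have h2 : (D.preCell M P (u + 1) k).top = none := by
              simp only [preCell]
              rw [if_neg]
              rintro ⟨-, h⟩
              rw [show u + 1 - k = u - k + 1 by omega] at h
              exact (Nat.even_add_one.1 h) hev.2
            rw [h1, h2]
            have hkn : k + 1 ≠ D.n := by omega
            simp only
            rw [if_pos]
            rw [if_neg hkn, hright]
            refine ⟨?_, Or.inr ⟨by simp [preCell, hkn], by simp [preCell], rfl⟩⟩
            simp only [St.top_cell, preCell]
            rw [if_neg]
            rintro ⟨h3, h⟩
            rw [show u - k = u - (k + 1) + 1 by omega] at hev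
            exact (Nat.even_add_one.1 hev.2) h
          · have h1 : (D.preCell M P u k).top = none := by
              simp only [preCell, if_neg hev]
            rw [h1]
            simp only
            by_cases h0 : k = 0
            · subst h0
              have hodd : Odd u := by
                rw [← Nat.not_even_iff_odd]
                intro h
                exact hev ⟨Nat.zero_le _, by simpa using h⟩
              have h2 : (D.preCell M P (u + 1) 0).top =
                  some (D.s (D.n - 1 - (u + 1) / 2)) := by
                simp only [preCell]
                rw [if_pos ⟨by omega, by simpa using hodd.add_one⟩]
                simp
              rw [h2]
              simp only [inflow, if_true]
              have hf : (D.preCell M P u 0).first = true := by simp [preCell]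
              have hs : (D.preCell M P u 0).src = D.src := rfl
              have hb : (D.preCell M P u 0).base ≠ none := by simp [preCell]
              rw [hf, if_pos rfl, hs]
              cases hsrc : D.src with
              | none =>
                obtain ⟨h3, h4, h5⟩ := hl.1 hsrc
                simp only
                rw [if_pos ⟨h3, h4, hb⟩, h5 hodd]
              | some q =>
                simp only
                rw [hl.2 q hsrc]
                obtain ⟨v, hv⟩ := hodd
                omega
            · have hf : (D.preCell M P u k).first = false := by simp [preCell, h0]
              have hp : (D.preCell M P u k).pulse = none := rfl
              simp only [inflow, hf, hp, h0, if_false]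
              rw [hleft h0]
              have hlast : decide (k - 1 + 1 = D.n) = false := by
                rw [decide_eq_false_iff_not]; omega
              simp only [St.last_cell, St.top_cell, preCell, hlast]
              simp only [Bool.false_eq_true, if_false, and_self, if_true]
              by_cases h : k ≤ u + 1 ∧ Even (u + 1 - k)
              · have e : u - (k - 1) = u + 1 - k := by omega
                rw [if_pos h, e, if_pos ⟨by omega, h.2⟩]
              · rw [if_neg h, if_neg]
                rintro ⟨h1, h2⟩
                exact h ⟨by omega, by rwa [show u + 1 - k = u - (k - 1) by omega]⟩
        rw [htop]
        rfl
      · by_cases h : k + 1 = D.n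
        · exact Or.inl h
        · right
          rw [if_neg h, hright]
          rfl
    · have hu' : u + k + 2 = 2 * D.n := by omega
      have hnext : D.stayCell M P (u + 1) k = D.postCell M P (u + 1) k := if_neg (by omega)
      have hright : D.stayCell M P u (k + 1) = D.postCell M P u (k + 1) := if_neg (by omega)
      rw [hnext]
      have htop : (D.preCell M P u k).top = some (D.s k) := by
        simp only [preCell]
        rw [if_pos ⟨by omega, ⟨D.n - 1 - k, by omega⟩⟩]
        congr 2
        omega
      have hbase : (D.preCell M P u k).base = some (D.num k, D.dig k) := rfl
      have hfirst : (D.preCell M P u k).first = decide (k = 0) := rfl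
      have hlast : (D.preCell M P u k).last = decide (k + 1 = D.n) := rfl
      have hnn : newNum (D.preCell M P u k).first
          (if k = 0 then l else .cell (D.stayCell M P u (k - 1))).num (D.num k) (D.s k) =
          D.nn k := by
        rw [nn, hfirst]
        by_cases h0 : k = 0
        · subst h0
          unfold newNum
          split <;> simp
        · rw [if_neg h0, hleft h0]
          rfl
      have hpin : pulseIn M (if k = 0 then l else .cell (D.stayCell M P u (k - 1)))
          (D.preCell M P u k) (if k + 1 = D.n then r else .cell (D.stayCell M P u (k + 1)))
          (D.num k) (D.s k) = some (D.pulse M P (D.n - 1 - k)) := by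
        rw [pulseIn, hnn, hlast]
        by_cases h : k + 1 = D.n
        · have h1 : k = D.n - 1 := by omega
          have h2 : decide (r = .off) = D.re := by
            rw [Bool.eq_iff_iff, decide_eq_true_eq, hre]
          have h3 : (D.preCell M P u k).first = decide (D.n = 1) := by
            rw [hfirst, decide_eq_decide]; omega
          rw [if_pos (by simpa using h), if_pos h, h3, h2, h1, Nat.sub_self]
          rfl
        · rw [if_neg (by simpa using h), if_neg h, hright]
          simp only [St.pulse_cell, postCell]
          rw [if_pos (by omega), show D.n - (k + 1) = D.n - 1 - k by omega]
      have hcell : cellNext M (if k = 0 then l else .cell (D.stayCell M P u (k - 1)))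
          (D.preCell M P u k) (if k + 1 = D.n then r else .cell (D.stayCell M P u (k + 1))) =
          process M (if k = 0 then l else .cell (D.stayCell M P u (k - 1)))
          (D.preCell M P u k) (if k + 1 = D.n then r else .cell (D.stayCell M P u (k + 1)))
          (D.num k) (D.dig k) (D.s k) (D.pulse M P (D.n - 1 - k)) := by
        unfold cellNext
        rw [htop, hbase]
        simp only
        rw [hpin]
      rw [hcell]
      simp only [process]
      rw [htok, hnn]
      have haux : (auxStep M (if k = 0 then l else .cell (D.stayCell M P u (k - 1)))
          (D.preCell M P u k)
          (if k + 1 = D.n then r else .cell (D.stayCell M P u (k + 1)))).1 =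
            (auxAt M D.n (2 * D.n * P + u + 1) k).1 ∨ D.role = .even := by
        by_cases hev : D.role = .even
        · exact Or.inr hev
        · left
          refine (auxStep_eq M (x := D.preCell M P u k) (n := D.n) (k := k)
            (τ := 2 * D.n * P + u) rfl rfl rfl
            (fun h => ⟨_, if_neg h, by rw [hleft h]; rfl⟩)
            (fun h => ⟨_, if_neg h, by rw [hright]; simp only [postCell, if_neg hev]⟩)).1
      have hrole : (D.pulse M P (D.n - 1 - k)).role = D.role := role_pulse M D P _
      have hdiv : 2 * D.n ∣ 2 * D.n * P + u + 2 + k := by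
        refine ⟨P + 1, ?_⟩
        rw [Nat.mul_add]; omega
      have haux' : (if (D.pulse M P (D.n - 1 - k)).role = .even then (M.C.inactive, false) else
          ((auxStep M (if k = 0 then l else .cell (D.stayCell M P u (k - 1)))
          (D.preCell M P u k)
          (if k + 1 = D.n then r else .cell (D.stayCell M P u (k + 1)))).1, false)) =
          (D.postCell M P (u + 1) k).aux := by
        rw [hrole]
        simp only [postCell]
        by_cases hev : D.role = .even
        · rw [if_pos hev, if_pos hev]
        · rw [if_neg hev, if_neg hev, haux.resolve_right hev]
          exact Prod.ext rfl (snd_auxAt_succ M hdiv).symm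
      rw [haux', hrole]
      have hloff : decide ((if k = 0 then l else .cell (D.stayCell M P u (k - 1))) = .off) =
          (decide (k = 0) && D.li && D.src.isSome) := by
        by_cases h0 : k = 0
        · rw [Bool.eq_iff_iff, if_pos h0, decide_eq_true_eq, hli]
          simp [h0]
        · simp [h0]
      have hpulse : outPulse M (D.preCell M P u k).first (D.preCell M P u k).last
          (decide ((if k = 0 then l else .cell (D.stayCell M P u (k - 1))) = .off)) (D.num k)
          (D.nn k) (D.dig k) (D.s k) (D.preCell M P u k).aux (D.pulse M P (D.n - 1 - k)) =
          D.pulse M P (D.n - k) := by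
        rw [hloff, show D.n - k = D.n - 1 - k + 1 by omega, pulse, outAt,
          show D.n - 1 - (D.n - 1 - k) = k by omega, show 2 * D.n - 2 - k = u by omega]
        rfl
      rw [hpulse]
      simp only [postCell]
      rw [if_pos (show u + 1 + k + 1 = 2 * D.n by omega)]
      rfl
  · have hx : D.stayCell M P u k = D.postCell M P u k := if_neg hpre
    have hnext : D.stayCell M P (u + 1) k = D.postCell M P (u + 1) k := if_neg (by omega)
    have hright : D.stayCell M P u (k + 1) = D.postCell M P u (k + 1) := if_neg (by omega)
    have h0 : k ≠ 0 := by omega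
    rw [hnext]
    rw [hx] at htok ⊢
    have hfirst : (D.postCell M P u k).first = false := by simp [postCell, h0]
    have hbad : ∀ l' r', ¬ Bad l' (D.postCell M P u k) r' := fun l' r' => by
      apply not_bad_of_tok
      · intro h; simp [hfirst] at h
      · intro h
        exact tokAt_ne_full hu (by simpa [postCell] using h)
    have hdead : ∀ l', ¬ Dead l' (D.postCell M P u k) := fun l' h => by
      obtain ⟨h1, h2, -⟩ := h
      simp only [postCell] at h1 h2
      by_cases hev : D.role = .even
      · simp [hev] at h2
      · simp [hev] at h1
    rw [rule, if_neg (hbad _ _), if_neg (hdead _), if_neg h0]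
    have hidle : ∀ l' r', cellNext M l' (D.postCell M P u k) r' =
        idle M l' (D.postCell M P u k) r' := by
      intro l' r'
      unfold cellNext
      split
      · rename_i b s hb hs
        simp only [postCell] at hb hs
        by_cases hev : D.role = .even
        · simp [hev] at hb
        · simp [hev] at hs
      · rfl
    rw [hidle]
    rw [if_neg h0] at htok
    simp only [idle]
    rw [htok]
    have haux : auxStep M (.cell (D.stayCell M P u (k - 1))) (D.postCell M P u k)
        (if k + 1 = D.n then r else .cell (D.stayCell M P u (k + 1))) =
        (D.postCell M P (u + 1) k).aux := by
      by_cases hev : D.role = .even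
      · have h1 : (D.postCell M P u k).aux = (M.C.inactive, false) := by
          simp only [postCell, if_pos hev]
        rw [auxStep, h1, M.C.δ_inactive]
        simp [postCell, hev, auxUpdate]
      · have h1 : ∀ u, (D.postCell M P u k).aux = auxAt M D.n (2 * D.n * P + u) k := fun u => by
          simp only [postCell, if_neg hev]
        rw [h1 (u + 1)]
        refine (auxStep_eq M (n := D.n) (k := k) (τ := 2 * D.n * P + u) rfl rfl (h1 u)
          (fun h => ⟨_, rfl, ?_⟩)
          (fun h => ⟨_, if_neg h, by rw [hright]; simp only [postCell, if_neg hev]⟩)).2 ?_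
        · unfold stayCell
          split_ifs
          · rfl
          · simp only [postCell, if_neg hev]
        · intro h
          have h2 : 2 * D.n * P + u + 2 + k = 2 * D.n * (P + 1) + (u + k + 2 - 2 * D.n) := by
            rw [Nat.mul_add]; omega
          rw [h2, Nat.dvd_add_right (Dvd.intro _ rfl)] at h
          have := Nat.le_of_dvd (by omega) h
          omega
    rw [haux]
    have htop : topNext (.cell (D.stayCell M P u (k - 1))) (D.postCell M P u k)
        (if k + 1 = D.n then r else .cell (D.stayCell M P u (k + 1))) =
        (D.postCell M P (u + 1) k).top := by
      rw [topNext]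
      by_cases hev : D.role = .even
      · simp only [postCell, if_pos hev]
        rw [if_neg]
        rintro ⟨h1, h2⟩
        by_cases hkn : k + 1 = D.n
        · rw [if_pos hkn] at h1 h2
          rcases h2 with ⟨-, -, -, h2, h3⟩ | ⟨h2, -⟩
          · rcases hr with hr | hr
            · exact h2 hr
            · exact hr h3
          · simp [hkn] at h2
        · rw [if_neg hkn, hright] at h1
          simp [postCell, hev] at h1
      · simp only [postCell, if_neg hev]
        simp only [inflow, h0]
        simp only [decide_false, Bool.false_eq_true, if_false]
        by_cases hpul : u + k + 1 = 2 * D.n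
        · rw [if_neg]
          rintro ⟨-, h⟩
          simp [hpul] at h
        · have : D.stayCell M P u (k - 1) = D.postCell M P u (k - 1) := if_neg (by omega)
          rw [this]
          simp [postCell, hev]
    rw [htop]
    simp only [postCell]
    rw [if_neg (show ¬ u + 1 + k + 1 = 2 * D.n by omega)]
    rfl

/-- The block that moves develops as described. -/
theorem rule_moveCell {P u k : ℕ} {l : St κ σ} (hsrc : D.src = none) (hP : 1 ≤ P) (hk : k < D.n)
    (hk' : u + 1 - D.n ≤ k) (hu : u + 2 ≤ 2 * D.n) (hl : l = .off ∨ l.last = true) :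
    rule M (if k = u + 1 - D.n then l else .cell (D.moveCell M P u (k - 1)))
      (.cell (D.moveCell M P u k))
      (if k + 1 = D.n then .cell (D.stayCell M P u 0) else .cell (D.moveCell M P u (k + 1))) =
      if u + 1 = D.n + k then .del else .cell (D.moveCell M P (u + 1) k) := by
  have hbad : ∀ l' r', ¬ Bad l' (D.moveCell M P u k) r' := fun l' r' => by
    apply not_bad_of_tok
    · intro _; rfl
    · intro h
      exact tokAt_ne_full hu (by simpa [moveCell] using h)
  rw [rule, if_neg (hbad _ _)]
  by_cases hdead : u + 1 = D.n + k
  · rw [if_pos hdead, if_pos]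
    refine ⟨rfl, ?_, ?_⟩
    · simp only [moveCell]
      rw [if_neg (by omega), if_neg (by omega)]
    · rw [if_pos (by omega)]
      exact hl
  have hdead' : ¬ Dead (if k = u + 1 - D.n then l else .cell (D.moveCell M P u (k - 1)))
      (D.moveCell M P u k) := by
    rintro ⟨-, h1, h2⟩
    by_cases h : k = u + 1 - D.n
    · simp only [moveCell] at h1
      rw [if_pos (by omega)] at h1
      cases h1
    · rw [if_neg h] at h2
      rcases h2 with h2 | h2
      · cases h2
      · simp only [St.last_cell, moveCell, decide_eq_true_eq] at h2
        omega
  rw [if_neg hdead', if_neg hdead]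
  have htok : tokStep (if k = u + 1 - D.n then l else .cell (D.moveCell M P u (k - 1)))
      (D.moveCell M P u k) = tokAt D.n (2 * D.n * P + u + 1) k := by
    refine tokStep_eq rfl rfl rfl ?_ ?_
    · intro h0 _
      rw [if_neg (by omega)]
      exact ⟨by omega, rfl⟩
    · intro _ _
      have : 2 * D.n * 1 ≤ 2 * D.n * P := Nat.mul_le_mul_left _ hP
      omega
  have hcell : ∀ l' r', cellNext M l' (D.moveCell M P u k) r' =
      idle M l' (D.moveCell M P u k) r' := by
    intro l' r'
    unfold cellNext
    simp [moveCell]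
  have haux : ∀ l' r', auxStep M l' (D.moveCell M P u k) r' = (M.C.inactive, false) := by
    intro l' r'
    simp [auxStep, moveCell, M.C.δ_inactive, auxUpdate]
  have htop : topNext (if k = u + 1 - D.n then l else .cell (D.moveCell M P u (k - 1)))
      (D.moveCell M P u k)
      (if k + 1 = D.n then .cell (D.stayCell M P u 0) else .cell (D.moveCell M P u (k + 1))) =
      (D.moveCell M P (u + 1) k).top := by
    rw [topNext]
    by_cases h1 : u + k + 2 ≤ D.n
    · have e1 : (D.moveCell M P u k).top = some (D.s k) := by simp only [moveCell, if_pos h1]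
      rw [e1]
      simp only
      rw [if_neg (show k + 1 ≠ D.n by omega)]
      by_cases h2 : u + k + 2 = D.n
      · rw [if_pos]
        · simp only [moveCell]
          rw [if_neg (by omega), if_neg]
          rintro ⟨⟨v, h⟩, -⟩
          omega
        · refine ⟨?_, Or.inr ⟨by simp [moveCell]; omega, by simp [moveCell], rfl⟩⟩
          simp only [St.top_cell, moveCell]
          rw [if_neg (by omega), if_neg]
          rintro ⟨⟨v, h⟩, -⟩
          omega
      · rw [if_neg]
        · simp only [moveCell]
          rw [if_pos (by omega)]
        · rintro ⟨h, -⟩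
          simp only [St.top_cell, moveCell] at h
          rw [if_pos (by omega)] at h
          cases h
    · by_cases h2 : Even (D.n + k - u) ∧ u + 2 ≤ D.n + k
      · have e1 : (D.moveCell M P u k).top = some (D.s ((D.n + k - u) / 2 - 1)) := by
          simp only [moveCell, if_neg h1, if_pos h2]
        obtain ⟨⟨v, h2⟩, h3⟩ := h2
        rw [e1]
        simp only
        rw [if_pos]
        · simp only [moveCell]
          rw [if_neg (by omega), if_neg]
          rintro ⟨⟨w, h⟩, -⟩
          omega
        · by_cases h4 : k + 1 = D.n
          · have e2 : D.stayCell M P u 0 = D.preCell M P u 0 := if_pos (by omega)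
            rw [if_pos h4, e2]
            refine ⟨?_, Or.inl ⟨by simp [moveCell, h4], by simp [preCell], rfl,
              by simp [preCell], hsrc⟩⟩
            simp only [St.top_cell, preCell]
            rw [if_neg]
            rintro ⟨-, ⟨w, h⟩⟩
            omega
          · rw [if_neg h4]
            refine ⟨?_, Or.inr ⟨by simp [moveCell]; omega, by simp [moveCell], rfl⟩⟩
            simp only [St.top_cell, moveCell]
            rw [if_neg (by omega), if_neg]
            rintro ⟨⟨w, h⟩, -⟩
            omega
      · have e1 : (D.moveCell M P u k).top = none := by
          simp only [moveCell, if_neg h1, if_neg h2]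
        rw [e1]
        simp only
        by_cases h0 : k = 0
        · subst h0
          simp only [inflow, moveCell]
          rw [if_neg (show ¬ u + 1 + 0 + 2 ≤ D.n by omega),
            if_neg (show ¬ (Even (D.n + 0 - (u + 1)) ∧ u + 1 + 2 ≤ D.n + 0) by omega)]
          simp
        · rw [if_neg (show k ≠ u + 1 - D.n by omega)]
          have e2 : decide (k - 1 + 1 = D.n) = false := by
            rw [decide_eq_false_iff_not]; omega
          simp only [inflow, moveCell, h0, decide_false, Bool.false_eq_true, if_false, St.last_cell,
            e2, and_self, if_true, St.top_cell]
          rw [if_neg (show ¬ u + 1 + k + 2 ≤ D.n by omega)]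
          by_cases h3 : u + (k - 1) + 2 ≤ D.n
          · rw [if_pos h3, if_pos ⟨⟨k, by omega⟩, by omega⟩]
            congr 2
            omega
          · rw [if_neg h3]
            have e3 : D.n + (k - 1) - u = D.n + k - (u + 1) := by omega
            have e4 : u + 2 ≤ D.n + (k - 1) ↔ u + 1 + 2 ≤ D.n + k := by omega
            rw [e3]
            simp only [e4]
  rw [hcell]
  simp only [idle]
  rw [htok, haux, htop]
  rfl

theorem headD_cells {P u : ℕ} (hn : 1 ≤ D.n) (hu : u + 2 ≤ 2 * D.n) (d : St κ σ) :
    Right ((D.cells M P u).headD d) ∧ (D.cells M P u).headD d ≠ .off := by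
  rw [cells]
  have h2 : D.stayCell M P u 0 = D.preCell M P u 0 := if_pos (by omega)
  by_cases h : D.src = none
  · rw [if_pos h, moving]
    have h1 : D.n - (u + 1 - D.n) = (D.n - (u + 1 - D.n) - 1) + 1 := by omega
    rw [h1, List.range'_succ]
    exact ⟨Or.inl rfl, by simp⟩
  · rw [if_neg h, staying]
    have h1 : D.n = (D.n - 1) + 1 := by omega
    rw [h1, List.range'_succ]
    refine ⟨Or.inr ?_, by simp⟩
    simpa [h2, preCell] using h

theorem getLastD_staying {P u : ℕ} (hn : 1 ≤ D.n) (d : St κ σ) :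
    (D.staying M P u).getLastD d = .cell (D.stayCell M P u (D.n - 1)) := by
  have h1 : D.n = (D.n - 1) + 1 := by omega
  rw [staying]
  conv_lhs => rw [h1]
  rw [List.range'_concat, List.map_append]
  simp

theorem getLastD_cells {P u : ℕ} (hn : 1 ≤ D.n) (d : St κ σ) :
    (D.cells M P u).getLastD d = .cell (D.stayCell M P u (D.n - 1)) := by
  rw [cells]
  split_ifs
  · rw [← getLastD_staying M hn d]
    have : D.staying M P u ≠ [] := by
      rw [staying, ne_eq, List.map_eq_nil_iff, List.range'_eq_nil_iff]; omega
    rw [List.getLastD_eq_getLast?, List.getLastD_eq_getLast?, List.getLast?_append_of_ne_nil _ this]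
  · exact getLastD_staying M hn d

theorem last_stayCell {P u k : ℕ} : (D.stayCell M P u k).last = decide (k + 1 = D.n) := by
  unfold stayCell; split_ifs <;> rfl

open Classical in
/-- One step inside a phase, in one segment. -/
theorem listStep_cells {P u : ℕ} {l r : St κ σ} (hn : 1 ≤ D.n) (hu : u + 2 ≤ 2 * D.n)
    (hP : D.src = none → 1 ≤ P) (hs : ∀ q, D.src = some q → ∀ j, j + 1 < D.n → D.s j = q)
    (hl : l = .off ∨ l.last = true) (hli : l = .off ↔ D.li = true) (hr : Right r)
    (hre : r = .off ↔ D.re = true) :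
    (listStep (rule M) l (D.cells M P u) r).filter (fun x => x ≠ .del) =
      D.cells M P (u + 1) := by
  have hstay : ∀ l : St κ σ, D.Feeds u l → (l = .off ↔ (D.li && D.src.isSome) = true) →
      (listStep (rule M) l (D.staying M P u) r).filter (fun x => x ≠ .del) =
        D.staying M P (u + 1) := by
    intro l h1 h2
    rw [staying, listStep_map_range', staying]
    have : (List.range' 0 D.n).map (fun k => rule M
        (if k = 0 then l else .cell (D.stayCell M P u (k - 1)))
        (.cell (D.stayCell M P u k))
        (if k + 1 = 0 + D.n then r else .cell (D.stayCell M P u (k + 1)))) =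
        (List.range' 0 D.n).map fun k => .cell (D.stayCell M P (u + 1) k) := by
      apply List.map_congr_left
      intro k hk
      rw [List.mem_range'_1] at hk
      exact rule_stayCell M (by omega) hu h1 h2 hr hre
    rw [this, List.filter_eq_self]
    intro x hx
    obtain ⟨k, -, rfl⟩ := List.mem_map.1 hx
    simp
  by_cases hsrc : D.src = none
  · rw [cells, cells, if_pos hsrc, if_pos hsrc, listStep_append, List.filter_append]
    have hlen : D.n - (u + 1 - D.n) = (D.n - (u + 1 - D.n) - 1) + 1 := by omega
    have hlast : (D.moving M P u).getLastD l = .cell (D.moveCell M P u (D.n - 1)) := by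
      rw [moving, hlen, List.range'_concat, List.map_append]
      simp only [List.map_cons, List.map_nil, List.getLastD_concat]
      congr 2
      omega
    rw [hlast]
    congr 1
    · have hhead : (D.staying M P u).headD r = .cell (D.stayCell M P u 0) := by
        have h1 : D.n = (D.n - 1) + 1 := by omega
        rw [staying]
        conv_lhs => rw [h1]
        rw [List.range'_succ]
        rfl
      rw [hhead, moving, listStep_map_range']
      have : (List.range' (u + 1 - D.n) (D.n - (u + 1 - D.n))).map (fun k => rule M
          (if k = u + 1 - D.n then l else .cell (D.moveCell M P u (k - 1)))
          (.cell (D.moveCell M P u k))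
          (if k + 1 = u + 1 - D.n + (D.n - (u + 1 - D.n)) then .cell (D.stayCell M P u 0)
            else .cell (D.moveCell M P u (k + 1)))) =
          (List.range' (u + 1 - D.n) (D.n - (u + 1 - D.n))).map fun k =>
            if u + 1 = D.n + k then .del else .cell (D.moveCell M P (u + 1) k) := by
        apply List.map_congr_left
        intro k hk
        rw [List.mem_range'_1] at hk
        rw [show u + 1 - D.n + (D.n - (u + 1 - D.n)) = D.n by omega]
        exact rule_moveCell M hsrc (hP hsrc) (by omega) (by omega) hu hl
      rw [this, moving]
      by_cases h : u + 1 < D.n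
      · rw [show u + 1 + 1 - D.n = u + 1 - D.n by omega, List.filter_eq_self.2]
        · apply List.map_congr_left
          intro k hk
          rw [if_neg (by omega)]
        · intro x hx
          obtain ⟨k, -, rfl⟩ := List.mem_map.1 hx
          rw [if_neg (by omega)]
          simp
      · conv_lhs => rw [hlen, List.range'_succ]
        rw [List.map_cons, if_pos (by omega), List.filter_cons_of_neg (by simp),
          show u + 1 + 1 - D.n = u + 1 - D.n + 1 by omega,
          show D.n - (u + 1 - D.n) - 1 = D.n - (u + 1 - D.n + 1) by omega, List.filter_eq_self.2]
        · apply List.map_congr_left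
          intro k hk
          rw [List.mem_range'_1] at hk
          rw [if_neg (by omega)]
        · intro x hx
          obtain ⟨k, hk, rfl⟩ := List.mem_map.1 hx
          rw [List.mem_range'_1] at hk
          rw [if_neg (by omega)]
          simp
    · apply hstay
      · refine ⟨fun _ => ⟨?_, rfl, ?_⟩, hs⟩
        · simp only [St.last_cell, moveCell, decide_eq_true_eq]; omega
        · rintro ⟨v, hv⟩
          simp only [St.top_cell, moveCell]
          rw [if_neg (by omega), if_pos ⟨⟨D.n - 1 - v, by omega⟩, by omega⟩]
          congr 2
          omega
      · simp [hsrc]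
  · rw [cells, cells, if_neg hsrc, if_neg hsrc]
    apply hstay
    · exact ⟨fun h => absurd h hsrc, hs⟩
    · rw [hli]
      simp [Option.isSome_iff_ne_none, hsrc]

/-- Conditions on a sequence of segments: the lengths of blocks are positive, a source feeds its
symbol into the block, segments have a source in the first phase, and exactly the first segment is
the leftmost one, if `li`, and exactly the last one is the rightmost one. -/
def Wf (P : ℕ) : Bool → List Seg → Prop
  | _, [] => True
  | li, D :: Ds => (1 ≤ D.n ∧ (D.src = none → 1 ≤ P) ∧
      (∀ q, D.src = some q → ∀ j, j + 1 < D.n → D.s j = q) ∧ D.li = li ∧ D.re = Ds.isEmpty) ∧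
      Wf P false Ds

/-- The configuration at time `u` of phase `P`. -/
noncomputable def conf (P u : ℕ) (Ds : List Seg) : List (St κ σ) :=
  Ds.flatMap fun D => D.cells M P u

open Classical in
/-- One step inside a phase, in several segments with the left neighbour cell `l`. -/
theorem listStep_conf {P u : ℕ} {Ds : List Seg} {li : Bool} {l : St κ σ} (h : Wf P li Ds)
    (hu : ∀ D ∈ Ds, u + 2 ≤ 2 * D.n) (hl : l = .off ∨ l.last = true)
    (hli : l = .off ↔ li = true) :
    (listStep (rule M) l (conf M P u Ds) .off).filter (fun x => x ≠ .del) =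
      conf M P (u + 1) Ds := by
  induction Ds generalizing li l with
  | nil => rfl
  | cons D Ds ih =>
    obtain ⟨⟨h1, h2, h3, h4, h5⟩, h6⟩ := h
    have hD := hu D (by simp)
    have hne : ((conf M P u Ds).headD .off = .off ↔ Ds.isEmpty = true) ∧
        Right ((conf M P u Ds).headD .off) := by
      cases Ds with
      | nil => exact ⟨by simp [conf], Or.inl rfl⟩
      | cons E Es =>
        have e : ∀ d : St κ σ, (conf M P u (E :: Es)).headD d =
            (E.cells M P u).headD ((conf M P u Es).headD d) := by
          intro d
          rw [conf, List.flatMap_cons]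
          cases E.cells M P u <;> rfl
        rw [e]
        obtain ⟨e1, e2⟩ := headD_cells M (P := P) h6.1.1 (hu E (by simp))
          ((conf M P u Es).headD .off)
        exact ⟨⟨fun h => absurd h e2, fun h => by simp at h⟩, e1⟩
    rw [conf, List.flatMap_cons, listStep_append, List.filter_append]
    rw [show Ds.flatMap (fun D => D.cells M P u) = conf M P u Ds from rfl]
    rw [listStep_cells M h1 hD h2 h3 hl (by rw [h4]; exact hli) hne.2 (by rw [h5]; exact hne.1)]
    rw [getLastD_cells M h1, ih h6 (fun E hE => hu E (by simp [hE]))]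
    · rfl
    · right
      rw [St.last_cell, last_stayCell, decide_eq_true_eq]
      omega
    · simp

/-- One step inside a phase. -/
theorem next_conf {P u : ℕ} {Ds : List Seg} (h : Wf P true Ds)
    (hu : ∀ D ∈ Ds, u + 2 ≤ 2 * D.n) :
    next M (conf M P u Ds) = conf M P (u + 1) Ds :=
  listStep_conf M h hu (Or.inl rfl) (by simp)

theorem iterate_next_conf {P u : ℕ} {Ds : List Seg} (h : Wf P true Ds)
    (hu : ∀ D ∈ Ds, u + 1 ≤ 2 * D.n) :
    (next M)^[u] (conf M P 0 Ds) = conf M P u Ds := by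
  induction u with
  | zero => rfl
  | succ u ih =>
    rw [Function.iterate_succ_apply', ih (fun D hD => by have := hu D hD; omega), next_conf M h]
    exact fun D hD => hu D hD

end Seg

end

/-! ### The transition between two phases -/

section

variable {κ σ : Type} (M : Prog κ σ)

theorem poisoned_filter {u : List (St κ σ)} {p : St κ σ → Bool} (h : Poisoned u)
    (hp : p .err = true) : Poisoned (u.filter p) := by
  obtain ⟨l, r, rfl, hl⟩ := h
  refine ⟨l.filter p, r.filter p, by simp [hp], fun x hx => hl x (List.mem_of_mem_filter hx)⟩

theorem poisoned_append_of_mem {u v : List (St κ σ)} (h : ∀ x ∈ u, ¬ LonePulse x)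
    (he : .err ∈ u) : Poisoned (u ++ v) := by
  obtain ⟨l, r, rfl⟩ := List.append_of_mem he
  exact ⟨l, r ++ v, by simp, fun x hx => h x (by simp [hx])⟩

theorem poisoned_append {u v : List (St κ σ)} (h : ∀ x ∈ u, ¬ LonePulse x)
    (hv : Poisoned v) : Poisoned (u ++ v) := by
  obtain ⟨l, r, rfl, hl⟩ := hv
  refine ⟨u ++ l, r, by simp, fun x hx => ?_⟩
  rcases List.mem_append.1 hx with hx | hx
  · exact h x hx
  · exact hl x hx

theorem pulse_rule_eq_none {l r : St κ σ} {x : Cell κ σ} (h : x.base = none ∨ x.top = none) :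
    (rule M l (.cell x) r).pulse = none := by
  rw [rule]
  split_ifs
  · rfl
  · rfl
  · by_contra hp
    obtain ⟨p, hp⟩ := Option.ne_none_iff_exists'.1 hp
    obtain ⟨-, h1, h2⟩ := pulse_cellNext M hp
    tauto

namespace Seg

variable {D : Seg}

/-- At the end of a phase, the block that moves has been deleted and the other one has been passed
by its pulse. -/
theorem cells_last (D : Seg) (P : ℕ) :
    D.cells M P (2 * D.n - 1) =
      (List.range' 0 D.n).map fun k => .cell (D.postCell M P (2 * D.n - 1) k) := by
  have h1 : D.moving M P (2 * D.n - 1) = [] := by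
    rw [moving, List.map_eq_nil_iff, List.range'_eq_nil_iff]; omega
  have h2 : D.staying M P (2 * D.n - 1) =
      (List.range' 0 D.n).map fun k => .cell (D.postCell M P (2 * D.n - 1) k) := by
    rw [staying]
    apply List.map_congr_left
    intro k hk
    rw [List.mem_range'_1] at hk
    have : D.stayCell M P (2 * D.n - 1) k = D.postCell M P (2 * D.n - 1) k := if_neg (by omega)
    rw [this]
  rw [cells, h1, h2, List.nil_append, ite_self]

open Classical in
/-- The step between two phases, in a cell. -/
theorem rule_postCell {P k : ℕ} {l r : St κ σ} (hk : k < D.n)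
    (hl : Compat l (D.pulse M P D.n)) (hr : r = .off ∨ r.pulse ≠ none) :
    rule M (if k = 0 then l else .cell (D.postCell M P (2 * D.n - 1) (k - 1)))
      (.cell (D.postCell M P (2 * D.n - 1) k))
      (if k + 1 = 0 + D.n then r else .cell (D.postCell M P (2 * D.n - 1) (k + 1))) =
      .cell { D.postCell M P (2 * D.n - 1) k with
        tok := tokAt D.n (2 * D.n * (P + 1) + 0) k
        aux := if D.role = .even then (M.C.inactive, false)
          else auxAt M D.n (2 * D.n * (P + 1) + 0) k
        top := if D.role = .even then
            if k + 1 = D.n ∧ r.top = none ∧ r.first = true ∧ r.base ≠ none ∧ r.src = none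
              then none else some (.real (D.nn k) (D.dg M P k))
          else if k = 0 then
            if D.role = .lone then some .dummy
            else if l.last = true ∧ l.base = none then l.top else none
          else none
        pulse := none } := by
  rw [Nat.zero_add]
  have hτ : 2 * D.n * P + (2 * D.n - 1) + 1 = 2 * D.n * (P + 1) + 0 := by
    rw [Nat.mul_add]; omega
  have hbad : ¬ Bad (if k = 0 then l else .cell (D.postCell M P (2 * D.n - 1) (k - 1)))
      (D.postCell M P (2 * D.n - 1) k)
      (if k + 1 = D.n then r else .cell (D.postCell M P (2 * D.n - 1) (k + 1))) := by
    rintro (⟨h1, p, h2, h3⟩ | ⟨h1, -, h2, h3⟩)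
    · have h0 : k = 0 := by simpa [postCell] using h1
      subst h0
      simp only [postCell] at h2
      rw [if_pos (by omega)] at h2
      simp only [Option.some.injEq, Nat.sub_zero] at h2
      rw [if_pos rfl, ← h2] at h3
      exact h3 hl
    · have h0 : k + 1 = D.n := by simpa [postCell] using h1
      rw [if_pos h0] at h2 h3
      rcases hr with hr | hr
      · exact h2 hr
      · exact hr h3
  have hdead : ∀ l', ¬ Dead l' (D.postCell M P (2 * D.n - 1) k) := fun l' h => by
    obtain ⟨h1, h2, -⟩ := h
    simp only [postCell] at h1 h2
    by_cases hev : D.role = .even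
    · simp [hev] at h2
    · simp [hev] at h1
  rw [rule, if_neg hbad, if_neg (hdead _)]
  have hidle : ∀ l' r', cellNext M l' (D.postCell M P (2 * D.n - 1) k) r' =
      idle M l' (D.postCell M P (2 * D.n - 1) k) r' := by
    intro l' r'
    unfold cellNext
    split
    · rename_i b s hb hs
      simp only [postCell] at hb hs
      by_cases hev : D.role = .even
      · simp [hev] at hb
      · simp [hev] at hs
    · rfl
  rw [hidle]
  have htok : tokStep (if k = 0 then l else .cell (D.postCell M P (2 * D.n - 1) (k - 1)))
      (D.postCell M P (2 * D.n - 1) k) = tokAt D.n (2 * D.n * (P + 1) + 0) k := by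
    rw [← hτ]
    refine tokStep_eq rfl rfl rfl ?_ ?_
    · intro h0 _
      rw [if_neg h0]
      exact ⟨by omega, rfl⟩
    · intro h0 h
      rw [if_neg h0] at h
      simp only [St.last_cell, postCell, decide_eq_true_eq] at h
      omega
  have haux : auxStep M (if k = 0 then l else .cell (D.postCell M P (2 * D.n - 1) (k - 1)))
      (D.postCell M P (2 * D.n - 1) k)
      (if k + 1 = D.n then r else .cell (D.postCell M P (2 * D.n - 1) (k + 1))) =
      if D.role = .even then (M.C.inactive, false)
        else auxAt M D.n (2 * D.n * (P + 1) + 0) k := by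
    by_cases hev : D.role = .even
    · have h1 : (D.postCell M P (2 * D.n - 1) k).aux = (M.C.inactive, false) := by
        simp only [postCell, if_pos hev]
      rw [auxStep, h1, M.C.δ_inactive]
      simp [hev, auxUpdate]
    · have h1 : ∀ k, (D.postCell M P (2 * D.n - 1) k).aux =
          auxAt M D.n (2 * D.n * P + (2 * D.n - 1)) k := fun k => by
        simp only [postCell, if_neg hev]
      rw [if_neg hev, ← hτ]
      refine (auxStep_eq M (n := D.n) (k := k) rfl rfl (h1 k)
        (fun h => ⟨_, if_neg h, h1 _⟩) (fun h => ⟨_, if_neg h, h1 _⟩)).2 ?_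
      intro h
      have h2 : 2 * D.n * P + (2 * D.n - 1) + 2 + k = 2 * D.n * (P + 1) + (1 + k) := by
        rw [Nat.mul_add]; omega
      rw [h2, Nat.dvd_add_right (Dvd.intro _ rfl)] at h
      have := Nat.le_of_dvd (by omega) h
      omega
  have htop : topNext (if k = 0 then l else .cell (D.postCell M P (2 * D.n - 1) (k - 1)))
      (D.postCell M P (2 * D.n - 1) k)
      (if k + 1 = D.n then r else .cell (D.postCell M P (2 * D.n - 1) (k + 1))) =
      if D.role = .even then
            if k + 1 = D.n ∧ r.top = none ∧ r.first = true ∧ r.base ≠ none ∧ r.src = none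
              then none else some (.real (D.nn k) (D.dg M P k))
          else if k = 0 then
            if D.role = .lone then some .dummy
            else if l.last = true ∧ l.base = none then l.top else none
          else none := by
    rw [topNext]
    by_cases hev : D.role = .even
    · have h1 : (D.postCell M P (2 * D.n - 1) k).top = some (.real (D.nn k) (D.dg M P k)) := by
        simp only [postCell, if_pos hev]
      rw [h1, if_pos hev]
      simp only
      congr 1
      rw [eq_iff_iff]
      by_cases hkn : k + 1 = D.n
      · simp [Outflow, hkn, postCell, hev]
      · simp [Outflow, hkn, postCell, hev]
    · have h1 : ∀ k, (D.postCell M P (2 * D.n - 1) k).top = none := fun k => by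
        simp only [postCell, if_neg hev]
      rw [h1, if_neg hev]
      simp only
      by_cases h0 : k = 0
      · subst h0
        simp only [inflow, postCell, if_neg hev]
        by_cases hlo : D.role = .lone <;> simp [hlo]
      · rw [if_neg h0, if_neg h0]
        have h2 : (D.postCell M P (2 * D.n - 1) k).first = false := by simp [postCell, h0]
        simp only [inflow, h2, Bool.false_eq_true, if_false, St.top_cell, h1, ite_self]
  simp only [idle]
  rw [htok, haux, htop]

/-- The segment that is formed by the even block of `A` and the odd block of `B`. -/
noncomputable def pair (P : ℕ) (li re : Bool) (A B : Seg) : Seg where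
  n := B.n
  num := B.nn
  dig := B.dg M P
  s := fun k => .real (A.nn k) (A.dg M P k)
  src := none
  li := li
  re := re

/-- The segment that is formed by the block of `A`, which has no partner. -/
noncomputable def lone (P : ℕ) (li re : Bool) (A : Seg) : Seg where
  n := A.n
  num := A.nn
  dig := A.dg M P
  s := fun _ => .dummy
  src := some .dummy
  li := li
  re := re

open Classical in
/-- The segments of the next phase, if the roles of the blocks alternate. -/
noncomputable def nextSegs (P : ℕ) : Bool → List Seg → List Seg
  | _, [] => []
  | li, [A] => [lone M P li true A]
  | li, A :: B :: Ds => pair M P li Ds.isEmpty A B :: nextSegs P false Ds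

/-- The comparisons have succeeded, and even and odd blocks alternate, starting with an odd one if
`b` holds, and with an even one otherwise. -/
def Alt (P : ℕ) : Prop → List Seg → Prop
  | _, [] => True
  | b, D :: Ds => ((D.pulse M P D.n).ok = true ∧ (D.role = .odd ↔ b)) ∧ Alt P (D.role = .even) Ds

theorem listStep_cells_last {P : ℕ} {l r : St κ σ} {f : ℕ → Cell κ σ}
    (hf : ∀ k < D.n, rule M (if k = 0 then l else .cell (D.postCell M P (2 * D.n - 1) (k - 1)))
      (.cell (D.postCell M P (2 * D.n - 1) k))
      (if k + 1 = 0 + D.n then r else .cell (D.postCell M P (2 * D.n - 1) (k + 1))) =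
      .cell (f k)) :
    listStep (rule M) l (D.cells M P (2 * D.n - 1)) r =
      (List.range' 0 D.n).map fun k => .cell (f k) := by
  rw [cells_last, listStep_map_range']
  apply List.map_congr_left
  intro k hk
  rw [List.mem_range'_1] at hk
  exact hf k (by omega)

theorem filter_map_cell (f : ℕ → Cell κ σ) (u : List ℕ) (p : St κ σ → Bool)
    (hp : ∀ x, p (.cell x) = true) :
    (u.map fun k => St.cell (f k)).filter p = u.map fun k => .cell (f k) := by
  rw [List.filter_eq_self]
  intro x hx
  obtain ⟨k, -, rfl⟩ := List.mem_map.1 hx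
  exact hp _

theorem headD_cells_last {P : ℕ} (hn : 1 ≤ D.n) (u : List (St κ σ)) (e : St κ σ) :
    (D.cells M P (2 * D.n - 1) ++ u).headD e = .cell (D.postCell M P (2 * D.n - 1) 0) := by
  rw [cells_last, List.range'_eq_cons_iff.2 ⟨rfl, hn, rfl⟩]
  rfl

theorem getLastD_cells_last {P : ℕ} (hn : 1 ≤ D.n) (e : St κ σ) :
    (D.cells M P (2 * D.n - 1)).getLastD e =
      .cell (D.postCell M P (2 * D.n - 1) (D.n - 1)) := by
  rw [getLastD_cells M hn, stayCell, if_neg (by omega)]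

theorem tokAt_last {P n : ℕ} (hn : 1 ≤ n) :
    tokAt n (2 * n * P + (2 * n - 1)) (n - 1) = .full ∨
      tokAt n (2 * n * P + (2 * n - 1)) (n - 1) = .done := by
  rcases P with _ | P
  · exact Or.inl (tokAt_full (by omega))
  · have : 2 * n * (P + 1) = 2 * n * P + 2 * n := by ring
    exact Or.inr (tokAt_done (by omega) (by omega))

/-- What a block requires of its left neighbour cell in the step between two phases, where `b` says
whether that cell belongs to an even block. -/
def LeftOk (li : Bool) (b : Prop) (l : St κ σ) : Prop :=
  (l = .off ∧ li = true ∧ ¬ b) ∨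
    (l ≠ .off ∧ li = false ∧ l.last = true ∧ (l.base = none ↔ b) ∧ (l.tok = .full ∨ l.tok = .done))

theorem compat_iff {li : Bool} {b : Prop} {l : St κ σ} (h : LeftOk li b l) (p : Pulse σ) :
    Compat l p ↔ p.ok = true ∧ (p.role = .odd ↔ b) := by
  rw [Compat]
  rcases h with ⟨rfl, -, h⟩ | ⟨h1, -, -, h2, h3⟩
  · simp [h]
  · simp [h1, h2, h3]

theorem leftOk_getLastD {P : ℕ} (hn : 1 ≤ D.n) (e : St κ σ) :
    LeftOk false (D.role = .even) ((D.cells M P (2 * D.n - 1)).getLastD e) := by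
  rw [getLastD_cells_last M hn]
  refine Or.inr ⟨by simp, rfl, ?_, ?_, ?_⟩
  · simp only [St.last_cell, postCell, decide_eq_true_eq]; omega
  · simp only [St.base_cell, postCell]
    split_ifs with h <;> simp [h]
  · exact tokAt_last hn

theorem conf_last_headD {P n : ℕ} {Ds : List Seg} (hn : ∀ D ∈ Ds, D.n = n) (h1 : 1 ≤ n) :
    ((conf M P (2 * n - 1) Ds).headD .off = .off ∨
      ((conf M P (2 * n - 1) Ds).headD .off).pulse ≠ none) := by
  cases Ds with
  | nil => exact Or.inl rfl
  | cons D Ds =>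
    right
    obtain rfl := hn D (by simp)
    rw [conf, List.flatMap_cons, headD_cells_last M h1]
    simp only [St.pulse_cell, postCell]
    rw [if_pos (by omega)]
    simp

open Classical in
/-- The step between two phases, if the roles of the blocks alternate. -/
theorem listStep_conf_of_alt {P n : ℕ} (h1 : 1 ≤ n) : ∀ {Ds : List Seg} {li : Bool} {l : St κ σ},
    Wf P li Ds → (∀ D ∈ Ds, D.n = n) → Alt M P False Ds → LeftOk li False l →
    (listStep (rule M) l (conf M P (2 * n - 1) Ds) .off).filter (fun x => x ≠ .del) =
      conf M (P + 1) 0 (nextSegs M P li Ds)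
  | [], _, _, _, _, _, _ => rfl
  | [A], li, l, hwf, hn, halt, hl => by
    obtain rfl := hn A (by simp)
    have hre : A.re = true := hwf.1.2.2.2.2
    have hodd : A.role ≠ .odd := fun h => halt.1.2.1 h
    have hlone : A.role = .lone := by
      rw [role] at hodd ⊢
      split_ifs at hodd ⊢
      · exact absurd rfl hodd
      · rfl
    have hcompat : Compat l (A.pulse M P A.n) := by
      rw [compat_iff hl, role_pulse]
      exact halt.1
    have hcells : conf M P (2 * A.n - 1) [A] = A.cells M P (2 * A.n - 1) := by
      simp [conf]
    have hres : conf M (P + 1) 0 (nextSegs M P li [A]) =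
        (List.range' 0 A.n).map fun k => .cell ((lone M P li true A).preCell M (P + 1) 0 k) := by
      simp only [conf, nextSegs, List.flatMap_cons, List.flatMap_nil, List.append_nil]
      rw [cells, if_neg (by simp [lone]), staying]
      apply List.map_congr_left
      intro k hk
      rw [List.mem_range'_1] at hk
      have e : (lone M P li true A).n = A.n := rfl
      rw [stayCell, if_pos]
      omega
    rw [hres, hcells, listStep_cells_last M (fun k hk => rule_postCell M hk hcompat (Or.inl rfl)),
      filter_map_cell _ _ _ (by simp)]
    apply List.map_congr_left
    intro k _
    simp only [postCell, hlone, preCell, lone]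
    by_cases h0 : k = 0
    · simp [h0]
    · simp [h0]
      rfl
  | A :: B :: Ds, li, l, hwf, hn, halt, hl => by
    obtain rfl := hn A (by simp)
    have hBn : B.n = A.n := hn B (by simp)
    have hre : A.re = false := hwf.1.2.2.2.2
    have hodd : A.role ≠ .odd := fun h => halt.1.2.1 h
    have heven : A.role = .even := by
      rw [role] at hodd ⊢
      split_ifs at hodd ⊢ with h2 h3
      · exact absurd rfl hodd
      · simp [hre] at h3
      · rfl
    have hcompat : Compat l (A.pulse M P A.n) := by
      rw [compat_iff hl, role_pulse]
      exact halt.1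
    have hBodd : B.role = .odd := halt.2.1.2.2 heven
    have hleft := leftOk_getLastD M (D := A) (P := P) h1 l
    have hcompatB : Compat ((A.cells M P (2 * A.n - 1)).getLastD l) (B.pulse M P B.n) := by
      rw [compat_iff hleft, role_pulse]
      exact halt.2.1
    have hleftB := leftOk_getLastD M (D := B) (P := P) (by omega)
      ((A.cells M P (2 * A.n - 1)).getLastD l)
    have hBne : (B.role = .even) = False := by simp [hBodd]
    have haltD : Alt M P False Ds := by
      have := halt.2.2
      rwa [hBne] at this
    rw [hBne] at hleftB
    have ih := listStep_conf_of_alt h1 hwf.2.2 (fun D hD => hn D (by simp [hD])) haltD hleftB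
    have hcells : conf M P (2 * A.n - 1) (A :: B :: Ds) = A.cells M P (2 * A.n - 1) ++
        (B.cells M P (2 * B.n - 1) ++ conf M P (2 * A.n - 1) Ds) := by
      rw [hBn]
      simp [conf]
    have hmov : (pair M P li Ds.isEmpty A B).moving M (P + 1) 0 =
        (List.range' 0 A.n).map fun k =>
          .cell ((pair M P li Ds.isEmpty A B).moveCell M (P + 1) 0 k) := by
      have e : (pair M P li Ds.isEmpty A B).n = A.n := hBn
      rw [moving, e, show 0 + 1 - A.n = 0 by omega, Nat.sub_zero]
    have hsta : (pair M P li Ds.isEmpty A B).staying M (P + 1) 0 =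
        (List.range' 0 B.n).map fun k =>
          .cell ((pair M P li Ds.isEmpty A B).preCell M (P + 1) 0 k) := by
      rw [staying]
      apply List.map_congr_left
      intro k hk
      rw [List.mem_range'_1] at hk
      have e : (pair M P li Ds.isEmpty A B).n = B.n := rfl
      rw [stayCell, if_pos]
      omega
    have hres : conf M (P + 1) 0 (nextSegs M P li (A :: B :: Ds)) =
        (pair M P li Ds.isEmpty A B).moving M (P + 1) 0 ++
          ((pair M P li Ds.isEmpty A B).staying M (P + 1) 0 ++
            conf M (P + 1) 0 (nextSegs M P false Ds)) := by
      rw [nextSegs, conf, List.flatMap_cons, cells, if_pos (by rfl), List.append_assoc]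
      rfl
    rw [hres, hcells, listStep_append, listStep_append, List.filter_append, List.filter_append, ih,
      headD_cells_last M (by omega)]
    congr 1
    · rw [listStep_cells_last M (fun k hk => rule_postCell M hk hcompat (Or.inr _)),
        filter_map_cell _ _ _ (by simp), hmov]
      · apply List.map_congr_left
        intro k hk
        rw [List.mem_range'_1] at hk
        simp only [postCell, heven, if_true, moveCell, pair, hBn, hBodd]
        by_cases hkn : k + 1 = A.n
        · have e1 : ¬ 0 + k + 2 ≤ A.n := by omega
          have e2 : ¬ (Even (A.n + k - 0) ∧ 0 + 2 ≤ A.n + k) := by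
            rintro ⟨⟨v, h⟩, -⟩
            omega
          rw [if_neg e1, if_neg e2, if_pos]
          · simp
          · simp [hkn]
        · have e1 : 0 + k + 2 ≤ A.n := by omega
          rw [if_pos e1, if_neg]
          · simp
          · simp [hkn]
      · simp only [St.pulse_cell, postCell]
        rw [if_pos (by omega)]
        simp
    · congr 1
      rw [listStep_cells_last M (fun k hk => rule_postCell M hk hcompatB
          (conf_last_headD M (fun D hD => hn D (by simp [hD])) h1)),
        filter_map_cell _ _ _ (by simp), hsta]
      apply List.map_congr_left
      intro k hk
      rw [List.mem_range'_1] at hk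
      rw [getLastD_cells_last M h1]
      simp only [postCell, hBodd, preCell, pair, heven, St.last_cell, St.base_cell, St.top_cell]
      have e1 : A.n - 1 + 1 = A.n := by omega
      by_cases h0 : k = 0
      · simp [h0, e1, hBn]
      · simp [h0]
        rfl

/-- The step between two phases leads to an error, if the roles of the blocks do not alternate. -/
theorem poisoned_of_not_alt {P n : ℕ} (h1 : 1 ≤ n) {Ds : List Seg} {b : Prop} {li : Bool}
    {l : St κ σ} (hn : ∀ D ∈ Ds, D.n = n) (halt : ¬ Alt M P b Ds) (hl : LeftOk li b l) :
    Poisoned (listStep (rule M) l (conf M P (2 * n - 1) Ds) .off) := by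
  induction Ds generalizing b li l with
  | nil => exact absurd trivial halt
  | cons D Ds ih =>
    obtain rfl := hn D (by simp)
    by_cases hc : Compat l (D.pulse M P D.n)
    · rw [compat_iff hl, role_pulse] at hc
      have halt' : ¬ Alt M P (D.role = .even) Ds := fun h => halt ⟨hc, h⟩
      have := ih (fun D hD => hn D (by simp [hD])) halt' (leftOk_getLastD M (P := P) h1 l)
      rw [conf, List.flatMap_cons, listStep_append]
      refine poisoned_append ?_ this
      rintro x hx ⟨p, hp, -⟩
      obtain ⟨a, c, i, hi, -, rfl⟩ := exists_of_mem_listStep hx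
      have hmem := List.getElem_mem hi
      clear hx
      generalize (D.cells M P (2 * D.n - 1))[i] = y at hmem hp
      rw [cells_last] at hmem
      obtain ⟨k, -, rfl⟩ := List.mem_map.1 hmem
      rw [pulse_rule_eq_none] at hp
      · cases hp
      · simp only [postCell]
        split_ifs <;> simp
    · have hhead : ∃ u, conf M P (2 * D.n - 1) (D :: Ds) =
          .cell (D.postCell M P (2 * D.n - 1) 0) :: u := by
        rw [conf, List.flatMap_cons, cells_last, List.range'_eq_cons_iff.2 ⟨rfl, h1, rfl⟩]
        exact ⟨_, rfl⟩
      obtain ⟨u, hu⟩ := hhead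
      rw [hu, listStep]
      refine ⟨[], listStep (rule M) (.cell (D.postCell M P (2 * D.n - 1) 0)) u .off, ?_, by simp⟩
      rw [List.nil_append]
      congr 1
      rw [rule, if_pos]
      refine Or.inl ⟨by simp [postCell], D.pulse M P D.n, ?_, hc⟩
      simp only [postCell]
      rw [if_pos (by omega), Nat.sub_zero]

theorem next_conf_of_alt {P n : ℕ} {Ds : List Seg} (h1 : 1 ≤ n) (hwf : Wf P true Ds)
    (hn : ∀ D ∈ Ds, D.n = n) (halt : Alt M P False Ds) :
    next M (conf M P (2 * n - 1) Ds) = conf M (P + 1) 0 (nextSegs M P true Ds) :=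
  listStep_conf_of_alt M h1 hwf hn halt (Or.inl ⟨rfl, rfl, id⟩)

theorem poisoned_next_conf {P n : ℕ} {Ds : List Seg} (h1 : 1 ≤ n)
    (hn : ∀ D ∈ Ds, D.n = n) (halt : ¬ Alt M P False Ds) :
    Poisoned (next M (conf M P (2 * n - 1) Ds)) :=
  poisoned_filter (poisoned_of_not_alt M h1 hn halt (li := true) (Or.inl ⟨rfl, rfl, id⟩)) (by simp)

theorem wf_nextSegs {P : ℕ} : ∀ {Ds : List Seg} {li : Bool}, (∀ D ∈ Ds, 1 ≤ D.n) →
    Wf (P + 1) li (nextSegs M P li Ds)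
  | [], _, _ => trivial
  | [A], li, h => ⟨⟨h A (by simp), by simp, fun q hq j _ => by simpa [lone] using hq, rfl, rfl⟩,
      trivial⟩
  | A :: B :: Ds, li, h => by
    refine ⟨⟨h B (by simp), by simp, fun q hq => by simp [pair] at hq, rfl, ?_⟩,
      wf_nextSegs (fun D hD => h D (by simp [hD]))⟩
    cases Ds with
    | nil => rfl
    | cons C Ds => cases Ds <;> rfl

/-- Acceptance happens at the end of a phase only, and only if there is a single block. -/
theorem eq_of_accept {P u : ℕ} {Ds : List Seg} (hwf : Wf P true Ds)
    (hu : ∀ D ∈ Ds, u + 1 ≤ 2 * D.n)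
    (h : (conf M P u Ds).headD .off ∈ (machine M).accept) :
    ∃ D, Ds = [D] ∧ u + 1 = 2 * D.n ∧ (D.pulse M P D.n).acc = true := by
  cases Ds with
  | nil => exact absurd h (machine M).inactive_not_accept
  | cons D Ds =>
    obtain ⟨p, hp, hacc⟩ := h
    have hn := hwf.1.1
    have hD := hu D (by simp)
    have hhead : (conf M P u (D :: Ds)).headD .off = .cell (D.stayCell M P u 0) ∨
        ((conf M P u (D :: Ds)).headD .off).pulse = none := by
      have e : ∀ (a b : List (St κ σ)) d, a ≠ [] → (a ++ b).headD d = a.headD d := by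
        rintro (_ | ⟨x, a⟩) b d h
        · exact absurd rfl h
        · rfl
      have e1 : D.staying M P u ≠ [] := by
        rw [staying, ne_eq, List.map_eq_nil_iff, List.range'_eq_nil_iff]; omega
      have e2 : ∀ d, (D.staying M P u).headD d = .cell (D.stayCell M P u 0) := by
        intro d
        rw [staying, List.range'_eq_cons_iff.2 ⟨rfl, hn, rfl⟩]
        rfl
      rw [conf, List.flatMap_cons, cells]
      split_ifs with hs
      · by_cases e3 : D.moving M P u = []
        · left
          rw [e3, List.nil_append, e _ _ _ e1, e2]
        · right
          rw [List.append_assoc, e _ _ _ e3]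
          obtain ⟨x, v, hv⟩ := List.exists_cons_of_ne_nil e3
          have : x ∈ D.moving M P u := by rw [hv]; simp
          rw [moving] at this
          obtain ⟨k, -, rfl⟩ := List.mem_map.1 this
          rw [hv]
          rfl
      · left
        rw [e _ _ _ e1, e2]
    rcases hhead with hhead | hhead
    · rw [hhead, St.pulse_cell, stayCell] at hp
      split_ifs at hp with h2
      · simp [preCell] at hp
      · simp only [postCell] at hp
        rw [if_pos (by omega)] at hp
        simp only [Nat.sub_zero, Option.some.injEq] at hp
        subst hp
        have hrole : (D.pulse M P D.n).role = .lone := by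
          rw [show D.n = D.n - 1 + 1 by omega, pulse] at hacc ⊢
          simp only [outAt, outPulse, Bool.and_eq_true, decide_eq_true_eq] at hacc ⊢
          exact hacc.1.1.1.2
        rw [role_pulse, role] at hrole
        split_ifs at hrole with h3 h4
        have hre := hwf.1.2.2.2.2
        rw [h4] at hre
        have hDs : Ds = [] := by
          cases Ds with
          | nil => rfl
          | cons => simp at hre
        subst hDs
        exact ⟨D, rfl, by omega, hacc⟩
    · rw [hhead] at hp
      cases hp

end Seg

end

/-! ### Block numbers and counters -/

/-- The digit with weight `2 ^ j` of a counter of length `n` with value `c`. The most significant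
digit takes the rest of the value, so that the value `2 ^ n` can be represented. -/
def digit (n c j : ℕ) : ℕ := if j + 1 = n then c / 2 ^ j else c / 2 ^ j % 2

/-- The digits in cell `k` of counters of length `n`. -/
def digitsAt (n : ℕ) (c : Bool → ℕ) (k : ℕ) : Dig :=
  fun b => Fin.ofNat 4 (digit n (c b) (n - 1 - k))

/-- The bits of a block number in cell `k` of a block of length `n`, after `p` bits have been
removed. -/
def numberAt (n p x k : ℕ) : Option Bool := if k < p then none else some (x.testBit (n - 1 - k))

/-- The carry into the position with weight `2 ^ j` in the addition of `a` and `b`. -/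
def carryAt (a b j : ℕ) : ℕ := if 2 ^ j ≤ a % 2 ^ j + b % 2 ^ j then 1 else 0

theorem add_div_two_pow (a b j : ℕ) :
    (a + b) / 2 ^ j = a / 2 ^ j + b / 2 ^ j + carryAt a b j :=
  Nat.add_div (Nat.two_pow_pos j)

theorem carryAt_succ (a b j : ℕ) :
    (a / 2 ^ j % 2 + b / 2 ^ j % 2 + carryAt a b j) / 2 = carryAt a b (j + 1) := by
  have h1 := add_div_two_pow a b j
  have h2 := add_div_two_pow a b (j + 1)
  simp only [Nat.pow_succ, ← Nat.div_div_eq_div_mul] at h2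
  omega

theorem carryAt_le (a b j : ℕ) : carryAt a b j ≤ 1 := by
  rw [carryAt]; split_ifs <;> omega

theorem val_ofNat_four {v : ℕ} (h : v < 4) : ((Fin.ofNat 4 v : Fin 4) : ℕ) = v :=
  Nat.mod_eq_of_lt h

theorem digit_lt_four {n c j : ℕ} (hc : c ≤ 2 ^ n) : digit n c j < 4 := by
  rw [digit]
  split_ifs with h
  · subst h
    rw [Nat.div_lt_iff_lt_mul (Nat.two_pow_pos j)]
    have := Nat.two_pow_pos j
    rw [Nat.pow_succ] at hc
    omega
  · omega

section

variable {κ σ : Type} (M : Prog κ σ)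

namespace Seg

variable {D : Seg}

/-- The pulse carries the carry of the addition. -/
theorem carry_pulse {P : ℕ} {a b : Bool → ℕ} (hab : ∀ t, a t + b t ≤ 2 ^ D.n)
    (ha : ∀ k < D.n, D.dig k = digitsAt D.n a k)
    (hb : ∀ k < D.n, (D.s k).cnt = digitsAt D.n b k) {j : ℕ} (hj : j < D.n) (t : Bool) :
    (D.pulse M P j).carry t = Fin.ofNat 4 (carryAt (a t) (b t) j) := by
  induction j with
  | zero => simp [pulse, startPulse, carryAt, Nat.mod_one]
  | succ j ih =>
    have h1 := ih (by omega)
    have h2 : ¬ D.n - 1 - j = 0 := by omega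
    have h3 : ¬ j + 1 = D.n := by omega
    simp only [pulse, outAt, outPulse, h2, decide_false, Bool.false_eq_true, if_false, total]
    rw [ha _ (by omega), hb _ (by omega), h1, digitsAt, digitsAt,
      val_ofNat_four (digit_lt_four (by have := hab t; omega)),
      val_ofNat_four (digit_lt_four (by have := hab t; omega)),
      val_ofNat_four (by have := carryAt_le (a t) (b t) j; omega),
      show D.n - 1 - (D.n - 1 - j) = j by omega, digit, digit, if_neg h3, if_neg h3, carryAt_succ]

/-- The counters are added. -/
theorem dg_eq {P : ℕ} {a b : Bool → ℕ} (hab : ∀ t, a t + b t ≤ 2 ^ D.n)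
    (ha : ∀ k < D.n, D.dig k = digitsAt D.n a k)
    (hb : ∀ k < D.n, (D.s k).cnt = digitsAt D.n b k) {k : ℕ} (hk : k < D.n) :
    D.dg M P k = digitsAt D.n (a + b) k := by
  funext t
  have h1 := carry_pulse M (P := P) hab ha hb (j := D.n - 1 - k) (by omega) t
  simp only [dg, newDig, total]
  rw [ha _ hk, hb _ hk, h1, digitsAt, digitsAt,
      val_ofNat_four (digit_lt_four (by have := hab t; omega)),
      val_ofNat_four (digit_lt_four (by have := hab t; omega)),
      val_ofNat_four (by have := carryAt_le (a t) (b t) (D.n - 1 - k); omega), digitsAt,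
      Pi.add_apply]
  have h2 := add_div_two_pow (a t) (b t) (D.n - 1 - k)
  by_cases h0 : k = 0
  · have h3 : D.n - 1 - k + 1 = D.n := by omega
    simp only [h0, decide_true, if_true, digit]
    rw [h0] at h2 h3
    rw [if_pos h3, if_pos h3, if_pos h3, h2]
  · have h3 : ¬ D.n - 1 - k + 1 = D.n := by omega
    simp only [h0, decide_false, Bool.false_eq_true, if_false, digit, if_neg h3]
    rw [h2]
    congr 1
    omega

/-- The comparison in cell `k` succeeds. -/
def Agree (D : Seg) (k : ℕ) : Prop := ∀ a d, D.s k = .real a d → k + 1 = D.n ∨ a = D.num k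

theorem ok_pulse {P j : ℕ} (hj : j ≤ D.n) : (D.pulse M P j).ok = true ↔
    (D.pulse M P 0).ok = true ∧ ∀ k, D.n ≤ k + j → k < D.n → D.Agree k := by
  induction j with
  | zero =>
    refine ⟨fun h => ⟨h, fun k h1 h2 => by omega⟩, fun h => h.1⟩
  | succ j ih =>
    have h1 : (D.pulse M P (j + 1)).ok = true ↔ (D.pulse M P j).ok = true ∧
        D.Agree (D.n - 1 - j) := by
      simp only [pulse, outAt, outPulse, Bool.and_eq_true, Agree]
      refine and_congr_right fun _ => ?_
      cases D.s (D.n - 1 - j) <;> simp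
    rw [h1, ih (by omega), and_assoc]
    refine and_congr_right fun _ => ?_
    constructor
    · rintro ⟨h2, h3⟩ k h4 h5
      by_cases h6 : D.n ≤ k + j
      · exact h2 k h6 h5
      · rwa [show k = D.n - 1 - j by omega]
    · intro h2
      exact ⟨fun k h3 h4 => h2 k (by omega) h4, h2 _ (by omega) (by omega)⟩

/-- The evaluation is conclusive if the block number is used up and no cell of the auxiliary layer
has changed since the previous pulse. -/
theorem good_pulse {P j : ℕ} (hj : j ≤ D.n) : (D.pulse M P j).good = true ↔
    ∀ k, D.n ≤ k + j → k < D.n → D.nn k = none ∧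
      (auxAt M D.n (2 * D.n * P + (2 * D.n - 2 - k)) k).2 = false := by
  induction j with
  | zero =>
    exact ⟨fun h k h1 h2 => by omega, fun h => rfl⟩
  | succ j ih =>
    have h1 : (D.pulse M P (j + 1)).good = true ↔ (D.pulse M P j).good = true ∧
        (D.nn (D.n - 1 - j) = none ∧ (auxAt M D.n (2 * D.n * P + (2 * D.n - 2 - (D.n - 1 - j)))
          (D.n - 1 - j)).2 = false) := by
      simp [pulse, outAt, outPulse, and_assoc]
    rw [h1, ih (by omega)]
    constructor
    · rintro ⟨h2, h3⟩ k h4 h5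
      by_cases h6 : D.n ≤ k + j
      · exact h2 k h6 h5
      · rwa [show k = D.n - 1 - j by omega]
    · intro h2
      exact ⟨fun k h3 h4 => h2 k (by omega) h4, h2 _ (by omega) (by omega)⟩

theorem acc_pulse {P : ℕ} (hn : 1 ≤ D.n) : (D.pulse M P D.n).acc = true ↔
    D.li = true ∧ D.src ≠ none ∧ D.role = .lone ∧ (D.pulse M P D.n).ok = true ∧
      (D.pulse M P D.n).good = true ∧ M.final (D.pulse M P D.n).reg := by
  obtain ⟨n, hn'⟩ : ∃ n, D.n = n + 1 := ⟨D.n - 1, by omega⟩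
  rw [hn', pulse]
  have h0 : D.n - 1 - n = 0 := by omega
  simp only [h0, outAt, outPulse, role_pulse, Bool.and_eq_true, decide_true, Bool.true_and,
    decide_eq_true_eq, and_assoc, Option.isSome_iff_ne_none]

theorem reg_pulse {P j : ℕ} : (D.pulse M P (j + 1)).reg =
    M.next (D.pulse M P j).reg
      (newDig (decide (D.n - 1 - j = 0)) (D.dig (D.n - 1 - j)) (D.s (D.n - 1 - j))
        (D.pulse M P j))
      (@decide ((auxAt M D.n (2 * D.n * P + (2 * D.n - 2 - (D.n - 1 - j)))
        (D.n - 1 - j)).1 = M.one) (Classical.propDecidable _)) := rfl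

/-- The block has length `n`, and after phase `p` its number is `b.1` and its counters have the
values `b.2`. -/
structure Yields (n p : ℕ) (D : Seg) (b : ℕ × (Bool → ℕ)) : Prop where
  n_eq : D.n = n
  nn_eq : ∀ k < n, D.nn k = numberAt n p b.1 k
  dg_eq : ∀ k < n, D.dg M p k = digitsAt n b.2 k
  lt : b.1 < 2 ^ (n - p)
  le : ∀ t, b.2 t ≤ 2 ^ min p n

theorem Yields.role_eq_odd_iff {n p : ℕ} {b : ℕ × (Bool → ℕ)} (h : Yields M n p D b)
    (hn : 1 ≤ n) : D.role = .odd ↔ p < n ∧ Odd b.1 := by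
  rw [role, h.n_eq, h.nn_eq _ (by omega), numberAt]
  have h0 : n - 1 - (n - 1) = 0 := by omega
  by_cases hp : n - 1 < p
  · rw [if_pos hp]
    have : ¬ p < n := by omega
    simp only [this, false_and, iff_false]
    split_ifs <;> simp_all
  · rw [if_neg hp, h0]
    have h1 : p < n := by omega
    simp only [h1, true_and, Option.some.injEq, Nat.testBit_zero, decide_eq_true_eq, Nat.odd_iff]
    split_ifs <;> simp_all

theorem numberAt_succ {n p x k : ℕ} (hk : k < n) :
    newNum (decide (k = 0)) (numberAt n p x (k - 1)) (numberAt n p x k) .dummy =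
      numberAt n (p + 1) (x / 2) k := by
  simp only [newNum, numberAt, decide_eq_true_eq]
  by_cases h0 : k = 0
  · simp [h0]
  · rw [if_neg h0]
    by_cases h1 : k < p + 1
    · rw [if_pos h1, if_pos (by omega)]
    · rw [if_neg h1, if_neg (by omega), ← Nat.testBit_succ,
        show n - 1 - (k - 1) = (n - 1 - k) + 1 by omega]

theorem div_two_lt {n p x : ℕ} (h : x < 2 ^ (n - p)) : x / 2 < 2 ^ (n - (p + 1)) := by
  by_cases hp : p < n
  · rw [show n - p = n - (p + 1) + 1 by omega, Nat.pow_succ] at h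
    omega
  · rw [show n - p = 0 by omega] at h
    have : x = 0 := by simpa using h
    simp [this]

/-- When an even block is joined with the odd block to its right, the counters are added. -/
theorem yields_pair {n p : ℕ} {A B : Seg} {a b : ℕ × (Bool → ℕ)} (li re : Bool) (hp : p < n)
    (hA : Yields M n p A a) (hB : Yields M n p B b) :
    Yields M n (p + 1) (pair M p li re A B) (b.1 / 2, b.2 + a.2) where
  n_eq := hB.n_eq
  nn_eq := fun k hk => by
    rw [← numberAt_succ hk, ← hB.nn_eq k hk, ← hB.nn_eq (k - 1) (by omega)]
    rfl
  dg_eq := fun k hk => by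
    have hn : (pair M p li re A B).n = n := hB.n_eq
    have := dg_eq M (D := pair M p li re A B) (P := p + 1) (a := b.2) (b := a.2) (k := k)
      (fun t => by
        have h1 := hA.le t
        have h2 := hB.le t
        rw [min_eq_left (by omega)] at h1 h2
        have h3 : 2 ^ (p + 1) ≤ 2 ^ n := Nat.pow_le_pow_right (by omega) hp
        rw [Nat.pow_succ] at h3
        rw [hn]
        omega)
      (fun k hk => by rw [hn] at hk ⊢; exact hB.dg_eq k hk)
      (fun k hk => by rw [hn] at hk ⊢; exact hA.dg_eq k hk) (by omega)
    rw [this, hn]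
  lt := div_two_lt hB.lt
  le := fun t => by
    have h1 := hA.le t
    have h2 := hB.le t
    rw [min_eq_left (by omega)] at h1 h2 ⊢
    change b.2 t + a.2 t ≤ _
    rw [Nat.pow_succ]
    omega

theorem yields_lone {n p : ℕ} {A : Seg} {a : ℕ × (Bool → ℕ)} (li re : Bool)
    (hA : Yields M n p A a) :
    Yields M n (p + 1) (lone M p li re A) (a.1 / 2, a.2) where
  n_eq := hA.n_eq
  nn_eq := fun k hk => by
    rw [← numberAt_succ hk, ← hA.nn_eq k hk, ← hA.nn_eq (k - 1) (by omega)]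
    rfl
  dg_eq := fun k hk => by
    have hn : (lone M p li re A).n = n := hA.n_eq
    have := dg_eq M (D := lone M p li re A) (P := p + 1) (a := a.2) (b := 0) (k := k)
      (fun t => by
        have h1 := hA.le t
        have h3 : 2 ^ min p n ≤ 2 ^ n := Nat.pow_le_pow_right (by omega) (by omega)
        rw [hn, Pi.zero_apply]
        omega)
      (fun k hk => by rw [hn] at hk ⊢; exact hA.dg_eq k hk)
      (fun k hk => by funext t; simp [lone, Sym.cnt, digitsAt, digit]) (by omega)
    rw [this, hn, add_zero]
  lt := div_two_lt hA.lt
  le := fun t => (hA.le t).trans (Nat.pow_le_pow_right (by omega) (by omega))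

/-- The bits that are compared in a phase are all bits except for the last one. -/
theorem testBit_eq_of_agree {n p x y : ℕ} (hx : x < 2 ^ (n - p)) (hy : y < 2 ^ (n - p))
    (hp : p < n) : (∀ k, k + 1 < n → numberAt n p x k = numberAt n p y k) ↔ x / 2 = y / 2 := by
  constructor
  · intro h
    apply Nat.eq_of_testBit_eq
    intro i
    rw [← Nat.testBit_succ, ← Nat.testBit_succ]
    by_cases hi : i + 1 < n - p
    · have := h (n - 1 - (i + 1)) (by omega)
      rw [numberAt, numberAt, if_neg (by omega), if_neg (by omega),
        show n - 1 - (n - 1 - (i + 1)) = i + 1 by omega] at this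
      simpa using this
    · have h2 : 2 ^ (n - p) ≤ 2 ^ (i + 1) := Nat.pow_le_pow_right (by omega) (by omega)
      rw [Nat.testBit_lt_two_pow (by omega), Nat.testBit_lt_two_pow (by omega)]
  · intro h k hk
    rw [numberAt, numberAt, show n - 1 - k = (n - 1 - k - 1) + 1 by omega, Nat.testBit_succ,
      Nat.testBit_succ, h]

theorem nn_pair_last {n p : ℕ} {A B : Seg} {a b : ℕ × (Bool → ℕ)} {li re : Bool} (hp : p < n)
    (hA : Yields M n p A a) (hB : Yields M n p B b) :
    (pair M p li re A B).nn (n - 1) = none ↔ n ≤ p + 1 := by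
  rw [(yields_pair M li re hp hA hB).nn_eq _ (by omega), numberAt]
  split_ifs <;> simp <;> omega

/-- The checks in a pair of blocks: block numbers may not be used up while other blocks follow, and
the numbers of the partners may differ in the last bit only. -/
theorem ok_pair {n p : ℕ} {A B : Seg} {a b : ℕ × (Bool → ℕ)} {li re : Bool} (hp : p < n)
    (hA : Yields M n p A a) (hB : Yields M n p B b) :
    ((pair M p li re A B).pulse M (p + 1) n).ok = true ↔
      (n ≤ p + 1 → re = true) ∧ a.1 / 2 = b.1 / 2 := by
  have hn : (pair M p li re A B).n = n := hB.n_eq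
  have h1 := ok_pulse M (D := pair M p li re A B) (P := p + 1) (j := n) hn.ge
  rw [hn] at h1
  rw [h1, ← testBit_eq_of_agree hA.lt hB.lt hp]
  apply and_congr
  · simp only [pulse, startPulse, hn, decide_eq_true_eq]
    rw [nn_pair_last M hp hA hB]
    constructor
    · exact fun h => h.1
    · exact fun h => ⟨h, by simp [pair]⟩
  · constructor
    · intro h k hk
      rcases h k (by omega) (by omega) (A.nn k) (A.dg M p k) rfl with h | h
      · rw [hn] at h; omega
      · rw [← hA.nn_eq k (by omega), ← hB.nn_eq k (by omega), h]
        rfl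
    · intro h k _ hk x d hs
      rw [hn]
      by_cases hk' : k + 1 = n
      · exact Or.inl hk'
      · right
        have := h k (by omega)
        rw [← hA.nn_eq k (by omega), ← hB.nn_eq k (by omega)] at this
        simp only [pair, Sym.real.injEq] at hs
        rw [← hs.1, this]
        rfl

/-- The check in a rightmost block without a partner: the most significant bit of the block numbers
may not be zero in all blocks, unless block numbers have a single bit. -/
theorem ok_lone {n p : ℕ} {A : Seg} {a : ℕ × (Bool → ℕ)} {li : Bool} (hn1 : 1 ≤ n)
    (hA : Yields M n p A a) (ha : p < n → ¬ Odd a.1) :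
    ((lone M p li true A).pulse M (p + 1) n).ok = true ↔ ¬ (p + 1 = n ∧ 2 ≤ n) := by
  have hn : (lone M p li true A).n = n := hA.n_eq
  have h1 := ok_pulse M (D := lone M p li true A) (P := p + 1) (j := n) hn.ge
  rw [hn] at h1
  rw [h1]
  have h2 : ∀ k, (lone M p li true A).Agree k := by
    intro k x d hs
    simp [lone] at hs
  have h3 : (∀ k, n ≤ k + n → k < n → (lone M p li true A).Agree k) ↔ True := by
    simp [h2]
  rw [h3, and_true]
  have h4 : (lone M p li true A).nn (n - 1) = none ↔ n ≤ p + 1 := by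
    rw [(yields_lone M li true hA).nn_eq _ (by omega), numberAt]
    split_ifs <;> simp <;> omega
  have h5 : (lone M p li true A).num (n - 1) = some false ↔ p < n := by
    change A.nn (n - 1) = some false ↔ p < n
    rw [hA.nn_eq _ (by omega), numberAt]
    by_cases hp : p < n
    · rw [if_neg (by omega), Nat.sub_self, Nat.testBit_zero]
      have := ha hp
      simp only [Nat.odd_iff] at this
      simp [hp, this]
    · rw [if_pos (by omega)]
      simp [hp]
  simp only [pulse, startPulse, hn, decide_eq_true_eq, h4, h5]
  simp only [lone, true_and, implies_true, decide_eq_false_iff_not]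
  omega

end Seg

end

/-! ### Merging blocks -/

/-- Blocks are merged in pairs. A block is given by its number and the values of its counters. -/
def merge : List (ℕ × (Bool → ℕ)) → List (ℕ × (Bool → ℕ))
  | [] => []
  | [a] => [(a.1 / 2, a.2)]
  | a :: b :: bs => (b.1 / 2, b.2 + a.2) :: merge bs

theorem length_merge : ∀ bs, (merge bs).length = (bs.length + 1) / 2
  | [] => rfl
  | [a] => by simp [merge]
  | a :: b :: bs => by
    rw [merge, List.length_cons, length_merge bs]
    simp only [List.length_cons]
    omega

theorem sum_merge : ∀ bs, ((merge bs).map Prod.snd).sum = (bs.map Prod.snd).sum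
  | [] => rfl
  | [a] => rfl
  | a :: b :: bs => by
    simp only [merge, List.map_cons, List.sum_cons, sum_merge bs]
    ac_rfl

/-- The blocks are numbered consecutively from `s`, and there are so many of them that none of the
`n - p` bits of their numbers is dispensable, unless `n ≤ 1`. -/
def Numbered (n p s : ℕ) (bs : List (ℕ × (Bool → ℕ))) : Prop :=
  bs.map Prod.fst = List.range' s bs.length ∧
    (2 ≤ n → p < n → bs ≠ [] → 2 ^ (n - 1 - p) < s + bs.length)

theorem numbered_merge {n p : ℕ} : ∀ {bs : List (ℕ × (Bool → ℕ))} {y : ℕ},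
    Numbered n p (2 * y) bs → Numbered n (p + 1) y (merge bs) := by
  have key : ∀ (bs : List (ℕ × (Bool → ℕ))) (y : ℕ),
      bs.map Prod.fst = List.range' (2 * y) bs.length →
      (merge bs).map Prod.fst = List.range' y (merge bs).length := by
    intro bs
    induction bs using merge.induct with
    | case1 => intro y _; rfl
    | case2 a =>
      intro y h
      simp only [List.map_cons, List.map_nil, List.length_cons, List.length_nil, zero_add,
        List.range'_one, List.cons.injEq, and_true] at h
      simp [merge, h]
    | case3 a b bs ih =>
      intro y h
      simp only [List.map_cons, List.length_cons, List.range'_succ, List.cons.injEq] at h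
      have := ih (y + 1) (by rw [h.2.2]; congr 1)
      simp only [merge, List.map_cons, List.length_cons, List.range'_succ, this, List.cons.injEq,
        and_true]
      omega
  intro bs y h
  refine ⟨key bs y h.1, fun hn hp hbs => ?_⟩
  have hne : bs ≠ [] := by rintro rfl; exact hbs rfl
  have h1 := h.2 hn (by omega) hne
  rw [length_merge]
  rw [show n - 1 - p = n - 1 - (p + 1) + 1 by omega, Nat.pow_succ] at h1
  omega

section

variable {κ σ : Type} (M : Prog κ σ)

namespace Seg

/-- Roles alternate if and only if blocks form pairs of an even block and an odd one, except for a
last even block. -/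
theorem alt_cons_cons {P : ℕ} {li : Bool} {A B : Seg} {Ds : List Seg}
    (hwf : Wf P li (A :: B :: Ds)) : Alt M P False (A :: B :: Ds) ↔
      ((A.pulse M P A.n).ok = true ∧ A.role ≠ .odd) ∧
        ((B.pulse M P B.n).ok = true ∧ B.role = .odd) ∧ Alt M P False Ds := by
  have hre : A.re = false := hwf.1.2.2.2.2
  have hA : A.role ≠ .odd → A.role = .even := by
    intro h
    rw [role] at h ⊢
    split_ifs at h ⊢ with h1 h2
    · exact absurd rfl h
    · simp [hre] at h2
    · rfl
  constructor
  · rintro ⟨⟨h1, h2⟩, ⟨h3, h4⟩, h5⟩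
    have h6 : A.role ≠ .odd := fun h => h2.1 h
    have h7 := h4.2 (hA h6)
    have h8 : (B.role = .even) = False := by simp [h7]
    rw [h8] at h5
    exact ⟨⟨h1, h6⟩, ⟨h3, h7⟩, h5⟩
  · rintro ⟨⟨h1, h2⟩, ⟨h3, h4⟩, h5⟩
    have h8 : (B.role = .even) = False := by simp [h4]
    refine ⟨⟨h1, by simp [h2]⟩, ⟨h3, by simp [h4, hA h2]⟩, ?_⟩
    rwa [h8]

theorem alt_singleton {P : ℕ} {A : Seg} : Alt M P False [A] ↔
    (A.pulse M P A.n).ok = true ∧ A.role ≠ .odd := by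
  simp [Alt]

/-- Merging describes the result of a phase. -/
theorem yields_nextSegs {n P : ℕ} (hn : 1 ≤ n) : ∀ {Ds : List Seg} {bs : List (ℕ × (Bool → ℕ))}
    {li : Bool}, Wf P li Ds → List.Forall₂ (Yields M n P) Ds bs → Alt M P False Ds →
    List.Forall₂ (Yields M n (P + 1)) (nextSegs M P li Ds) (merge bs)
  | [], _, _, _, .nil, _ => .nil
  | [A], _, li, _, .cons hA .nil, _ => .cons (yields_lone M li true hA) .nil
  | A :: B :: Ds, _, li, hwf, .cons hA (.cons hB h), halt => by
    rw [alt_cons_cons M hwf] at halt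
    obtain ⟨-, ⟨-, h1⟩, h2⟩ := halt
    exact .cons (yields_pair M li _ ((hB.role_eq_odd_iff M hn).1 h1).1 hA hB)
      (yields_nextSegs hn hwf.2.2 h h2)

/-- All comparisons in phase `P` have succeeded. -/
def AllOk (P : ℕ) (Ds : List Seg) : Prop := ∀ D ∈ Ds, (D.pulse M P D.n).ok = true

/-- If the blocks are numbered consecutively, all comparisons of the next phase succeed. -/
theorem allOk_nextSegs {n P : ℕ} (hn : 1 ≤ n) : ∀ {Ds : List Seg} {bs : List (ℕ × (Bool → ℕ))}
    {li : Bool} {y : ℕ}, Wf P li Ds → List.Forall₂ (Yields M n P) Ds bs → Alt M P False Ds →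
    Numbered n P (2 * y) bs → AllOk M (P + 1) (nextSegs M P li Ds)
  | [], _, _, _, _, .nil, _, _ => by simp [AllOk, nextSegs]
  | [A], _, li, y, _, .cons (b := a) hA .nil, halt, hnum => by
    intro D hD
    obtain rfl : D = lone M P li true A := by simpa [nextSegs] using hD
    rw [alt_singleton] at halt
    have e : (lone M P li true A).n = n := hA.n_eq
    rw [e, ok_lone M hn hA]
    · rintro ⟨h1, h2⟩
      have h3 := hnum.2 h2 (by omega) (by simp)
      have h4 : a.1 = 2 * y := by simpa using hnum.1
      have h5 := hA.lt
      rw [show n - P = 1 by omega] at h5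
      rw [show n - 1 - P = 0 by omega] at h3
      simp at h3
      omega
    · intro h1 h2
      exact halt.2 ((hA.role_eq_odd_iff M hn).2 ⟨h1, h2⟩)
  | A :: B :: Ds, _, li, y, hwf, .cons (b := a) hA (.cons (b := b) (l₂ := bs) hB h), halt,
      hnum => by
    rw [alt_cons_cons M hwf] at halt
    obtain ⟨-, ⟨-, h1⟩, h2⟩ := halt
    have hP := ((hB.role_eq_odd_iff M hn).1 h1).1
    obtain ⟨h3, h4⟩ := hnum
    simp only [List.map_cons, List.length_cons, List.range'_succ, List.cons.injEq] at h3
    intro D hD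
    rw [nextSegs, List.mem_cons] at hD
    rcases hD with rfl | hD
    · have e : (pair M P li Ds.isEmpty A B).n = n := hB.n_eq
      rw [e, ok_pair M hP hA hB]
      refine ⟨fun h5 => ?_, by omega⟩
      cases h with
      | nil => rfl
      | cons hC h =>
        have h6 := hC.lt
        simp only [List.map_cons, List.length_cons, List.range'_succ, List.cons.injEq] at h3
        rw [show n - P = 1 by omega] at h6
        omega
    · refine allOk_nextSegs hn (y := y + 1) hwf.2.2 h h2 ⟨?_, ?_⟩ D hD
      · rw [h3.2.2]; congr 1
      · intro h5 h6 _
        have := h4 h5 h6 (by simp)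
        simp only [List.length_cons] at this
        omega

/-- If the blocks are numbered consecutively, even and odd blocks alternate. -/
theorem alt_of_numbered {n P : ℕ} (hn : 1 ≤ n) (hP : P < n) : ∀ {Ds : List Seg}
    {bs : List (ℕ × (Bool → ℕ))} {li : Bool} {y : ℕ}, Wf P li Ds →
    List.Forall₂ (Yields M n P) Ds bs → AllOk M P Ds →
    bs.map Prod.fst = List.range' (2 * y) bs.length → Alt M P False Ds
  | [], _, _, _, _, .nil, _, _ => trivial
  | [A], _, li, y, _, .cons (b := a) hA .nil, hok, hnum => by
    rw [alt_singleton]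
    refine ⟨hok A (by simp), fun h => ?_⟩
    have h1 := ((hA.role_eq_odd_iff M hn).1 h).2
    have h4 : a.1 = 2 * y := by simpa using hnum
    rw [Nat.odd_iff] at h1
    omega
  | A :: B :: Ds, _, li, y, hwf, .cons (b := a) hA (.cons (b := b) (l₂ := bs) hB h), hok,
      hnum => by
    rw [alt_cons_cons M hwf]
    simp only [List.map_cons, List.length_cons, List.range'_succ, List.cons.injEq] at hnum
    refine ⟨⟨hok A (by simp), fun h => ?_⟩, ⟨hok B (by simp),
      (hB.role_eq_odd_iff M hn).2 ⟨hP, ?_⟩⟩,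
      alt_of_numbered hn hP (y := y + 1) hwf.2.2 h (fun D hD => hok D (by simp [hD])) ?_⟩
    · have h1 := ((hA.role_eq_odd_iff M hn).1 h).2
      rw [Nat.odd_iff] at h1
      omega
    · rw [Nat.odd_iff]; omega
    · rw [hnum.2.2]; congr 1

/-- If all checks succeed, consecutive numbers after merging come from consecutive numbers. -/
theorem numbered_of_merge {n P : ℕ} (hn : 1 ≤ n) (hP : P < n) : ∀ {Ds : List Seg}
    {bs : List (ℕ × (Bool → ℕ))} {li : Bool} {y : ℕ}, Wf P li Ds →
    List.Forall₂ (Yields M n P) Ds bs → Alt M P False Ds →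
    AllOk M (P + 1) (nextSegs M P li Ds) → Numbered n (P + 1) y (merge bs) →
    Numbered n P (2 * y) bs
  | [], _, _, _, _, .nil, _, _, _ => ⟨rfl, fun _ _ h => absurd rfl h⟩
  | [A], _, li, y, _, .cons (b := a) hA .nil, halt, hok, hnum => by
    rw [alt_singleton] at halt
    have hodd : ¬ Odd a.1 := fun h => halt.2 ((hA.role_eq_odd_iff M hn).2 ⟨hP, h⟩)
    have e : (lone M P li true A).n = n := hA.n_eq
    have hok1 := hok (lone M P li true A) (by simp [nextSegs])
    rw [e, ok_lone M hn hA (fun _ => hodd)] at hok1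
    have h1 : a.1 / 2 = y := by simpa [merge] using hnum.1
    rw [Nat.odd_iff] at hodd
    refine ⟨by simp; omega, fun h2 _ _ => ?_⟩
    have h3 := hnum.2 h2 (by omega) (by simp [merge])
    rw [show n - 1 - P = n - 1 - (P + 1) + 1 by omega, Nat.pow_succ]
    simp [merge] at h3 ⊢
    omega
  | A :: B :: Ds, _, li, y, hwf, .cons (b := a) hA (.cons (b := b) (l₂ := bs) hB h), halt,
      hok, hnum => by
    rw [alt_cons_cons M hwf] at halt
    obtain ⟨⟨-, h0⟩, ⟨-, h1⟩, h2⟩ := halt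
    have hbodd := ((hB.role_eq_odd_iff M hn).1 h1).2
    have haodd : ¬ Odd a.1 := fun h => h0 ((hA.role_eq_odd_iff M hn).2 ⟨hP, h⟩)
    have e : (pair M P li Ds.isEmpty A B).n = n := hB.n_eq
    have hok1 := hok (pair M P li Ds.isEmpty A B) (by simp [nextSegs])
    rw [e, ok_pair M hP hA hB] at hok1
    obtain ⟨h3, h4⟩ := hnum
    simp only [merge, List.map_cons, List.length_cons, List.range'_succ, List.cons.injEq] at h3
    have ih := numbered_of_merge hn hP (y := y + 1) hwf.2.2 h h2
      (fun D hD => hok D (by simp [nextSegs, hD])) ⟨h3.2, fun h5 h6 _ => by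
        have := h4 h5 h6 (by simp [merge])
        simp only [merge, List.length_cons] at this
        omega⟩
    rw [Nat.odd_iff] at hbodd haodd
    refine ⟨?_, fun h5 _ _ => ?_⟩
    · simp only [List.map_cons, List.length_cons, List.range'_succ, List.cons.injEq]
      exact ⟨by omega, by omega, ih.1⟩
    · by_cases h6 : P + 1 < n
      · have := h4 h5 h6 (by simp [merge])
        simp only [merge, List.length_cons, length_merge] at this ⊢
        rw [show n - 1 - P = n - 1 - (P + 1) + 1 by omega, Nat.pow_succ]
        omega
      · simp only [List.length_cons]
        rw [show n - 1 - P = 0 by omega]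
        omega

end Seg

end

/-! ### The sequence of phases for blocks of the same length -/

section

variable {κ σ : Type} (M : Prog κ σ)

/-- A configuration after which an error is present is never followed by acceptance. -/
theorem not_accept_of_poisoned_next {u : List (St κ σ)} (h : Poisoned (next M u)) (hoff : .off ∉ u)
    {s : ℕ} (hs : 1 ≤ s) : ((next M)^[s] u).headD .off ∉ (machine M).accept := by
  obtain ⟨s, rfl⟩ : ∃ t, s = t + 1 := ⟨s - 1, by omega⟩
  rw [Function.iterate_succ_apply]
  refine not_accept_of_poisoned M h (off_notMem_next M hoff) (fun x hx => ?_) s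
  obtain ⟨a, c, i, hi, -, rfl⟩ := exists_of_mem_listStep (List.mem_of_mem_filter hx)
  exact rule_accSound M _ _ _

namespace Seg

theorem off_notMem_conf {P u : ℕ} {Ds : List Seg} : (.off : St κ σ) ∉ conf M P u Ds := by
  intro h
  obtain ⟨D, -, h⟩ := List.mem_flatMap.1 h
  rw [cells] at h
  split_ifs at h
  · rcases List.mem_append.1 h with h | h <;>
    · obtain ⟨k, -, h⟩ := List.mem_map.1 h
      cases h
  · obtain ⟨k, -, h⟩ := List.mem_map.1 h
    cases h

theorem allOk_of_alt {P : ℕ} : ∀ {Ds : List Seg} {b : Prop}, Alt M P b Ds → AllOk M P Ds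
  | [], _, _ => by simp [AllOk]
  | D :: Ds, b, h => by
    intro E hE
    rcases List.mem_cons.1 hE with rfl | hE
    · exact h.1.1
    · exact allOk_of_alt h.2 E hE

/-- The segments in phase `P` if the roles have always alternated before. -/
noncomputable def segsAt (Ds : List Seg) : ℕ → List Seg
  | 0 => Ds
  | P + 1 => nextSegs M P true (segsAt Ds P)

/-- The segments of the first phase, for nonempty blocks of length `n` with the numbers and counters
that are given by `bs`. -/
structure Start (n : ℕ) (Ds : List Seg) (bs : List (ℕ × (Bool → ℕ))) : Prop where
  one_le : 1 ≤ n
  wf : Wf 0 true Ds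
  yields : List.Forall₂ (Yields M n 0) Ds bs
  allOk : AllOk M 0 Ds

theorem n_eq_of_yields {n P : ℕ} {Ds : List Seg} {bs : List (ℕ × (Bool → ℕ))}
    (h : List.Forall₂ (Yields M n P) Ds bs) : ∀ D ∈ Ds, D.n = n := by
  induction h with
  | nil => simp
  | cons h1 _ ih =>
    intro D hD
    rcases List.mem_cons.1 hD with rfl | hD
    · exact h1.n_eq
    · exact ih D hD

variable {M}

/-- As long as the roles alternate, a phase takes `2 * n` steps and ends with the merged blocks. -/
theorem Start.segsAt {n : ℕ} {Ds : List Seg} {bs : List (ℕ × (Bool → ℕ))} (h : Start M n Ds bs)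
    {P : ℕ} (halt : ∀ P' < P, Alt M P' False (segsAt M Ds P')) :
    Wf P true (segsAt M Ds P) ∧ List.Forall₂ (Yields M n P) (segsAt M Ds P) (merge^[P] bs) ∧
      (next M)^[2 * n * P] (conf M 0 0 Ds) = conf M P 0 (segsAt M Ds P) := by
  induction P with
  | zero => exact ⟨h.wf, h.yields, rfl⟩
  | succ P ih =>
    obtain ⟨h1, h2, h3⟩ := ih fun P' hP => halt P' (by omega)
    have h4 := halt P (by omega)
    have h5 := n_eq_of_yields M h2
    have h6 := h.one_le
    rw [Function.iterate_succ_apply']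
    refine ⟨wf_nextSegs M fun D hD => by rw [h5 D hD]; exact h6, yields_nextSegs M h6 h1 h2 h4, ?_⟩
    rw [show 2 * n * (P + 1) = (2 * n - 1 + 1) + 2 * n * P by rw [Nat.mul_succ]; omega,
      Function.iterate_add_apply, h3, Function.iterate_succ_apply', iterate_next_conf M h1
      (fun D hD => by rw [h5 D hD]; omega), next_conf_of_alt M h6 h1 h5 h4]
    rfl

/-- When block numbers are used up, no block is odd, so that there can only be one block. -/
theorem Start.alt_of_le {n P : ℕ} {Ds : List Seg} {bs : List (ℕ × (Bool → ℕ))} (hn : 1 ≤ n)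
    (hP : n ≤ P) (hwf : Wf P true Ds) (hy : List.Forall₂ (Yields M n P) Ds bs)
    (hok : AllOk M P Ds) :
    Alt M P False Ds ↔ Ds.length ≤ 1 := by
  have key : ∀ D b, Yields M n P D b → D.role ≠ .odd := fun D b hD h => by
    have := ((hD.role_eq_odd_iff M hn).1 h).1
    omega
  cases hy with
  | nil => simp [Alt]
  | cons hA hy =>
    cases hy with
    | nil => simpa [alt_singleton] using ⟨hok _ (by simp), key _ _ hA⟩
    | cons hB hy =>
      rw [alt_cons_cons M hwf]
      simp [key _ _ hB]

/-- If the blocks are numbered consecutively, the roles of the blocks alternate in all phases. -/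
theorem Start.alt_of_numbered {n : ℕ} {Ds : List Seg} {bs : List (ℕ × (Bool → ℕ))}
    (h : Start M n Ds bs) (hnum : Numbered n 0 0 bs) (P : ℕ) :
    Alt M P False (Seg.segsAt M Ds P) ∧ (∀ P' < P, Alt M P' False (Seg.segsAt M Ds P')) ∧
      Numbered n P 0 (merge^[P] bs) := by
  have key : ∀ P, (∀ P' < P, Alt M P' False (Seg.segsAt M Ds P')) → Numbered n P 0 (merge^[P] bs) →
      AllOk M P (Seg.segsAt M Ds P) → Alt M P False (Seg.segsAt M Ds P) := by
    intro P h1 h2 h3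
    obtain ⟨h4, h5, -⟩ := h.segsAt h1
    rcases lt_or_ge P n with hP | hP
    · exact Seg.alt_of_numbered M h.one_le hP (y := 0) h4 h5 h3 h2.1
    · rw [alt_of_le h.one_le hP h4 h5 h3, h5.length_eq]
      generalize merge^[P] bs = bs' at h2 h5
      by_contra hlen
      obtain ⟨a, b, bs'', rfl⟩ : ∃ a b bs'', bs' = a :: b :: bs'' := by
        rcases bs' with _ | ⟨a, _ | ⟨b, bs''⟩⟩
        · simp at hlen
        · simp at hlen
        · exact ⟨_, _, _, rfl⟩
      have h6 := h2.1
      simp only [List.map_cons, List.length_cons, List.range'_succ, List.cons.injEq] at h6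
      generalize Seg.segsAt M Ds P = Es at h5
      cases h5 with
      | cons hA h5 =>
        cases h5 with
        | cons hB h5 =>
          have := hB.lt
          rw [show n - P = 0 by omega] at this
          omega
  have main : (∀ P' < P, Alt M P' False (Seg.segsAt M Ds P')) ∧ Numbered n P 0 (merge^[P] bs) ∧
      AllOk M P (Seg.segsAt M Ds P) := by
    induction P with
    | zero => exact ⟨fun P' h => by omega, hnum, h.allOk⟩
    | succ P ih =>
      obtain ⟨h1, h2, h3⟩ := ih
      have h4 := key P h1 h2 h3
      obtain ⟨h5, h6, -⟩ := h.segsAt h1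
      refine ⟨fun P' hP' => ?_, ?_, allOk_nextSegs M h.one_le (y := 0) h5 h6 h4 h2⟩
      · rcases Nat.lt_succ_iff_lt_or_eq.1 hP' with h7 | rfl
        · exact h1 P' h7
        · exact h4
      · rw [Function.iterate_succ_apply']
        exact numbered_merge h2
  exact ⟨key P main.1 main.2.1 main.2.2, main.1, main.2.1⟩

/-- If the roles of the blocks alternate until their numbers are used up, the blocks are numbered
consecutively. -/
theorem Start.numbered_of_alt {n : ℕ} {Ds : List Seg} {bs : List (ℕ × (Bool → ℕ))}
    (h : Start M n Ds bs) (halt : ∀ P ≤ n, Alt M P False (Seg.segsAt M Ds P)) :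
    Numbered n 0 0 bs := by
  have key : ∀ i ≤ n, Numbered n (n - i) 0 (merge^[n - i] bs) := by
    intro i hi
    induction i with
    | zero =>
      obtain ⟨h4, h5, -⟩ := h.segsAt (P := n) fun P' h => halt P' h.le
      have h6 := (alt_of_le h.one_le le_rfl h4 h5 (allOk_of_alt M (halt n le_rfl))).1
        (halt n le_rfl)
      rw [Nat.sub_zero]
      rw [h5.length_eq] at h6
      refine ⟨?_, fun _ h _ => absurd h (lt_irrefl _)⟩
      generalize merge^[n] bs = bs' at h5 h6
      generalize Seg.segsAt M Ds n = Es at h5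
      cases h5 with
      | nil => rfl
      | cons hA h5 =>
        cases h5 with
        | nil =>
          have := hA.lt
          rw [Nat.sub_self] at this
          simp
          omega
        | cons hB h5 => simp at h6
    | succ i ih =>
      have ih := ih (by omega)
      obtain ⟨h4, h5, -⟩ := h.segsAt (P := n - (i + 1)) fun P' h => halt P' (by omega)
      rw [show n - i = n - (i + 1) + 1 by omega, Function.iterate_succ_apply'] at ih
      refine numbered_of_merge M h.one_le (by omega) (y := 0) h4 h5 (halt _ (by omega)) ?_ ih
      exact allOk_of_alt M (halt (n - (i + 1) + 1) (by omega))
  simpa using key n le_rfl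

variable (M)

/-- The auxiliary automaton has not changed the states of the cells of a block of length `n` between
the pulses of the phases `P - 1` and `P`. -/
def Quiet (n P : ℕ) : Prop := ∀ k < n, (auxAt M n (2 * n * P + (2 * n - 2 - k)) k).2 = false

/-- The bit of weight `2 ^ j` that the auxiliary automaton shows to the pulse of phase `P`. -/
noncomputable def auxBit (n P j : ℕ) : Bool :=
  @decide ((auxAt M n (2 * n * P + (n - 1 + j)) (n - 1 - j)).1 = M.one) (Classical.propDecidable _)

/-- The state of the evaluating automaton after the `j` least significant digits of the counters `c`
and of the number with the bits `K`. -/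
def runAt (n : ℕ) (c : Bool → ℕ) (K : ℕ → Bool) : ℕ → σ
  | 0 => M.start
  | j + 1 => M.next (runAt n c K j) (digitsAt n c (n - 1 - j)) (K j)

theorem reg_pulse_eq_runAt {n P : ℕ} {D : Seg} {b : ℕ × (Bool → ℕ)} (h : Yields M n P D b) {j : ℕ}
    (hj : j ≤ n) : (D.pulse M P j).reg = runAt M n b.2 (auxBit M n P) j := by
  induction j with
  | zero => rfl
  | succ j ih =>
    have h1 := h.n_eq
    have h2 := h.dg_eq (n - 1 - j) (by omega)
    rw [reg_pulse, runAt, ih (by omega), ← h2, dg, h1, show n - 1 - (n - 1 - j) = j by omega,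
      auxBit, show 2 * n - 2 - (n - 1 - j) = n - 1 + j by omega]

variable {M}

theorem snd_merge_iterate {bs : List (ℕ × (Bool → ℕ))} (P : ℕ) :
    ((merge^[P] bs).map Prod.snd).sum = (bs.map Prod.snd).sum := by
  induction P with
  | zero => rfl
  | succ P ih => rw [Function.iterate_succ_apply', sum_merge, ih]

/-- A single block accepts at the end of a phase if it has not just been joined with a partner, if
the block numbers are used up and the auxiliary automaton has come to rest, and if the evaluation is
positive. -/
theorem Start.acc_iff {n P : ℕ} {Ds : List Seg} {bs : List (ℕ × (Bool → ℕ))} {D : Seg}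
    (h : Start M n Ds bs) (halt : ∀ P' < P, Alt M P' False (Seg.segsAt M Ds P'))
    (hD : Seg.segsAt M Ds P = [D]) :
    (D.pulse M P D.n).acc = true ↔ D.src ≠ none ∧ Alt M P False [D] ∧ n ≤ P ∧ Quiet M n P ∧
      M.final (runAt M n (bs.map Prod.snd).sum (auxBit M n P) n) := by
  obtain ⟨h1, h2, -⟩ := h.segsAt halt
  rw [hD] at h1 h2
  obtain ⟨⟨-, -, -, hli, hre⟩, -⟩ := h1
  have h4 := snd_merge_iterate (bs := bs) P
  generalize merge^[P] bs = bs' at h2 h4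
  cases h2 with
  | @cons _ b _ _ hy h3 =>
    cases h3
    simp only [List.map_cons, List.map_nil, List.sum_cons, List.sum_nil, add_zero] at h4
    have h5 : D.n = n := hy.n_eq
    have hn := h.one_le
    have h6 : (D.pulse M P D.n).good = true ↔ n ≤ P ∧ Quiet M n P := by
      rw [good_pulse M le_rfl, Quiet, h5]
      constructor
      · intro h7
        refine ⟨?_, fun k hk => (h7 k (by omega) hk).2⟩
        have h8 := (h7 (n - 1) (by omega) (by omega)).1
        rw [hy.nn_eq _ (by omega), numberAt] at h8
        split_ifs at h8
        omega
      · rintro ⟨h7, h8⟩ k - hk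
        refine ⟨?_, h8 k hk⟩
        rw [hy.nn_eq _ hk, numberAt, if_pos (by omega)]
    have h7 : D.role = .lone ↔ D.role ≠ .odd := by
      rw [role, hre]
      simp only [List.isEmpty_nil, if_true]
      split_ifs <;> simp
    rw [acc_pulse M (by omega), h6, alt_singleton, h7, h5, reg_pulse_eq_runAt M hy le_rfl, h4]
    constructor
    · rintro ⟨-, a, b, c, ⟨d, e⟩, f⟩
      exact ⟨a, ⟨c, b⟩, d, e, f⟩
    · rintro ⟨a, ⟨c, b⟩, d, e, f⟩
      exact ⟨hli, a, b, c, ⟨d, e⟩, f⟩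

/-- Acceptance implies that the blocks are numbered consecutively and that the evaluation is
positive. -/
theorem Start.sound {n s : ℕ} {Ds : List Seg} {bs : List (ℕ × (Bool → ℕ))} (h : Start M n Ds bs)
    (hs : ((next M)^[s] (conf M 0 0 Ds)).headD .off ∈ (machine M).accept) :
    Numbered n 0 0 bs ∧ ∃ P ≥ 1, Quiet M n P ∧
      M.final (runAt M n (bs.map Prod.snd).sum (auxBit M n P) n) := by
  have hn := h.one_le
  have hmod : s % (2 * n) < 2 * n := Nat.mod_lt _ (by omega)
  have hdiv := Nat.div_add_mod s (2 * n)
  generalize s / (2 * n) = P at hdiv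
  generalize s % (2 * n) = u at hmod hdiv
  by_cases halt : ∀ P' < P, Alt M P' False (Seg.segsAt M Ds P')
  · obtain ⟨h1, h2, h3⟩ := h.segsAt halt
    have hlen := n_eq_of_yields M h2
    rw [← hdiv, add_comm, Function.iterate_add_apply, h3, iterate_next_conf M h1
      (fun D hD => by rw [hlen D hD]; omega)] at hs
    obtain ⟨D, h4, -, h5⟩ := eq_of_accept M h1 (fun D hD => by rw [hlen D hD]; omega) hs
    obtain ⟨-, h6, h7, h8, h9⟩ := (h.acc_iff halt h4).1 h5
    refine ⟨h.numbered_of_alt fun P' hP' => ?_, P, by omega, h8, h9⟩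
    rcases (hP'.trans h7).lt_or_eq with h10 | rfl
    · exact halt P' h10
    · rw [h4]; exact h6
  · classical
    push Not at halt
    have h1 := Nat.find_spec halt
    have h2 : ∀ P' < Nat.find halt, Alt M P' False (Seg.segsAt M Ds P') := fun P' hP' => by
      have := Nat.find_min halt hP'
      by_contra h3
      exact this ⟨by have := h1.1; omega, h3⟩
    generalize Nat.find halt = Q at h1 h2
    obtain ⟨h3, h4, h5⟩ := h.segsAt h2
    have hlen := n_eq_of_yields M h4
    have h6 : 2 * n * Q + 2 * n ≤ 2 * n * P := by
      rw [← Nat.mul_succ]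
      exact Nat.mul_le_mul_left _ h1.1
    rw [show s = (s - (2 * n * Q + (2 * n - 1))) + (2 * n - 1) + 2 * n * Q by omega,
      Function.iterate_add_apply, Function.iterate_add_apply, h5, iterate_next_conf M h3
      (fun D hD => by rw [hlen D hD]; omega)] at hs
    exact absurd hs (not_accept_of_poisoned_next M (poisoned_next_conf M hn hlen h1.2)
      (off_notMem_conf M) (by omega))

/-- If the blocks are numbered consecutively, the evaluation takes place at the end of all
sufficiently late phases. -/
theorem Start.complete {n P : ℕ} {Ds : List Seg} {bs : List (ℕ × (Bool → ℕ))} (h : Start M n Ds bs)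
    (hne : bs ≠ []) (hnum : Numbered n 0 0 bs) (hP : n + 1 ≤ P) (hq : Quiet M n P)
    (hf : M.final (runAt M n (bs.map Prod.snd).sum (auxBit M n P) n)) :
    ((next M)^[2 * n * P + (2 * n - 1)] (conf M 0 0 Ds)).headD .off ∈ (machine M).accept := by
  have hn := h.one_le
  have key : ∀ Q ≥ n, ∃ D, Seg.segsAt M Ds Q = [D] := by
    intro Q hQ
    obtain ⟨h1, h2, h3⟩ := h.alt_of_numbered hnum Q
    obtain ⟨h4, h5, -⟩ := h.segsAt h2
    have h6 := (alt_of_le hn hQ h4 h5 (allOk_of_alt M h1)).1 h1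
    have h7 : Seg.segsAt M Ds Q ≠ [] := by
      have : 0 < (merge^[Q] bs).length := by
        clear h1 h2 h3 h4 h5 h6 hQ
        induction Q with
        | zero => exact List.length_pos_of_ne_nil hne
        | succ Q ih =>
          rw [Function.iterate_succ_apply', length_merge]
          omega
      rw [← h5.length_eq] at this
      exact List.ne_nil_of_length_pos this
    exact List.length_eq_one_iff.1 (by have := List.length_pos_of_ne_nil h7; omega)
  obtain ⟨P, rfl⟩ : ∃ Q, P = Q + 1 := ⟨P - 1, by omega⟩
  obtain ⟨A, hA⟩ := key P (by omega)
  have hD : Seg.segsAt M Ds (P + 1) = [lone M P true true A] := by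
    rw [Seg.segsAt, hA]
    rfl
  obtain ⟨h1, h2, -⟩ := h.alt_of_numbered hnum (P + 1)
  obtain ⟨h4, h5, h6⟩ := h.segsAt h2
  have hlen := n_eq_of_yields M h5
  rw [add_comm, Function.iterate_add_apply, h6, iterate_next_conf M h4
    (fun D hD => by rw [hlen D hD]; omega)]
  have hacc := (h.acc_iff h2 hD).2 ⟨by simp [lone], by rw [← hD]; exact h1, by omega, hq, hf⟩
  rw [hD] at hlen ⊢
  have h7 := hlen _ (List.mem_singleton_self _)
  have h8 := headD_cells_last M (D := lone M P true true A) (P := P + 1) (by omega) [] .off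
  rw [h7] at h8
  simp only [conf, List.flatMap_cons, List.flatMap_nil]
  rw [h8]
  rw [h7] at hacc
  refine ⟨(lone M P true true A).pulse M (P + 1) n, ?_, hacc⟩
  simp [postCell, h7, show 2 * n - 1 + 1 = 2 * n by omega]

end Seg

end

end BlockCount

/-! ### The auxiliary automaton -/

namespace CA

theorem iterate_step_eq_inactive {α Q : Type} (C : CA α Q) {c : ℤ → Q} {i : ℤ}
    (h : c i = C.inactive) (τ : ℕ) : C.step^[τ] c i = C.inactive := by
  induction τ with
  | zero => exact h
  | succ τ ih => rw [Function.iterate_succ_apply', CA.step, ih, C.δ_inactive]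

theorem iterate_step_of_fixed {α Q : Type} (C : CA α Q) {c W : ℤ → Q} {s τ : ℕ}
    (hs : C.step^[s] c = W) (hW : C.step W = W) (h : s ≤ τ) : C.step^[τ] c = W := by
  obtain ⟨d, rfl⟩ := Nat.exists_eq_add_of_le' h
  rw [Function.iterate_add_apply, hs]
  exact Function.iterate_fixed hW d

end CA

namespace BlockCount

section

variable {κ σ : Type} (M : Prog κ σ)

/-- The auxiliary layer of a block of length `n` is the auxiliary automaton on the input `n` in
unary. -/
theorem fst_auxAt {n : ℕ} (τ : ℕ) {k : ℕ} (hk : k < n) :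
    (auxAt M n τ k).1 = M.C.step^[τ] (M.C.init (List.replicate n ())) k := by
  induction τ generalizing k with
  | zero =>
    rw [auxAt, Function.iterate_zero_apply, CA.init]
    change _ = List.getD _ k _
    rw [List.getD_eq_getElem _ _ (by simpa using hk)]
    simp
  | succ τ ih =>
    have h0 : ∀ i, (i < 0 ∨ (n : ℤ) ≤ i) →
        M.C.step^[τ] (M.C.init (List.replicate n ())) i = M.C.inactive := by
      intro i hi
      apply CA.iterate_step_eq_inactive
      rw [CA.init]
      cases i with
      | negSucc i => rfl
      | ofNat i =>
        have : n ≤ i := by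
          rcases hi with hi | hi
          · exact absurd hi (by simp)
          · simpa using hi
        change List.getD _ i _ = _
        exact List.getD_eq_default _ _ (by simpa using this)
    have h1 : (auxAt M n (τ + 1) k).1 =
        M.C.δ (if k = 0 then M.C.inactive else (auxAt M n τ (k - 1)).1) (auxAt M n τ k).1
          (if k + 1 = n then M.C.inactive else (auxAt M n τ (k + 1)).1) := by
      rw [auxAt]
      split_ifs <;> rfl
    rw [h1, Function.iterate_succ_apply', CA.step, ih hk]
    congr 1
    · split_ifs with h
      · rw [h0]; left; omega
      · rw [ih (by omega), Nat.cast_sub (by omega)]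
        rfl
    · split_ifs with h
      · rw [h0]; right; omega
      · rw [ih (by omega)]
        congr 1

/-- The change flag of a cell says whether its state has changed since the previous pulse, which
reaches cell `k` in the step to time `2 * n * P - 1 - k`. -/
theorem snd_auxAt {n P k : ℕ} (hk : k < n) (hP : 1 ≤ P) {i : ℕ} (hi : i < 2 * n) :
    (auxAt M n (2 * n * P - 1 - k + i) k).2 = false ↔
      ∀ i' < i, (auxAt M n (2 * n * P - 1 - k + (i' + 1)) k).1 =
        (auxAt M n (2 * n * P - 1 - k + i') k).1 := by
  have hnP : 2 * n ≤ 2 * n * P := Nat.le_mul_of_pos_right _ hP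
  induction i with
  | zero =>
    simp only [add_zero, Nat.not_lt_zero, false_imp_iff, implies_true, iff_true]
    rw [show 2 * n * P - 1 - k = (2 * n * P - 2 - k) + 1 by omega]
    apply Seg.snd_auxAt_succ
    rw [show 2 * n * P - 2 - k + 2 + k = 2 * n * P by omega]
    exact dvd_mul_right _ _
  | succ i ih =>
    have ih := ih (by omega)
    rw [Nat.forall_lt_succ_right]
    refine Iff.trans ?_ (and_congr_left fun _ => ih)
    rw [← add_assoc, auxAt]
    have h1 : ¬ 2 * n ∣ 2 * n * P - 1 - k + i + 2 + k := by
      rw [show 2 * n * P - 1 - k + i + 2 + k = 2 * n * P + (i + 1) by omega,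
        Nat.dvd_add_right (dvd_mul_right _ _)]
      intro h
      have := Nat.le_of_dvd (by omega) h
      omega
    rw [if_neg h1]
    simp [auxUpdate]

namespace Seg

variable {M}

/-- If no cell changes between two pulses, the auxiliary automaton is at rest: the periods in which
the cells are observed differ, but they all contain the step from time `2 * n * P - 1` to `2 * n *
P`. -/
theorem fst_auxAt_of_quiet {n P s : ℕ} {W : ℤ → κ} (hn : 1 ≤ n) (hP : 1 ≤ P)
    (hs : M.C.step^[s] (M.C.init (List.replicate n ())) = W) (hW : M.C.step W = W)
    (hq : Quiet M n P) {τ k : ℕ} (hτ : 2 * n * P ≤ τ) (hk : k < n) :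
    (auxAt M n τ k).1 = W k := by
  have hnP : 2 * n ≤ 2 * n * P := Nat.le_mul_of_pos_right _ hP
  have h1 : ∀ k < n, (auxAt M n (2 * n * P) k).1 = (auxAt M n (2 * n * P - 1) k).1 := by
    intro k hk
    have h := hq k hk
    rw [show 2 * n * P + (2 * n - 2 - k) = 2 * n * P - 1 - k + (2 * n - 1) by omega,
      snd_auxAt M hk hP (by omega)] at h
    have := h k (by omega)
    rwa [show 2 * n * P - 1 - k + (k + 1) = 2 * n * P by omega,
      show 2 * n * P - 1 - k + k = 2 * n * P - 1 by omega] at this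
  have h2 : M.C.step (M.C.step^[2 * n * P - 1] (M.C.init (List.replicate n ()))) =
      M.C.step^[2 * n * P - 1] (M.C.init (List.replicate n ())) := by
    rw [← Function.iterate_succ_apply' (f := M.C.step),
      show (2 * n * P - 1).succ = 2 * n * P by omega]
    funext i
    by_cases hi : 0 ≤ i ∧ i < n
    · lift i to ℕ using hi.1
      have hi' : i < n := by simpa using hi.2
      rw [← fst_auxAt M _ hi', ← fst_auxAt M _ hi', h1 i hi']
    · have h0 : M.C.init (List.replicate n ()) i = M.C.inactive := by
        rw [CA.init]
        cases i with
        | negSucc i => rfl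
        | ofNat i =>
          change List.getD _ i _ = _
          refine List.getD_eq_default _ _ ?_
          simp only [Int.ofNat_eq_natCast, not_and, not_lt] at hi
          simpa using hi (by positivity)
      rw [CA.iterate_step_eq_inactive _ h0, CA.iterate_step_eq_inactive _ h0]
  have h3 : ∀ τ ≥ 2 * n * P - 1, M.C.step^[τ] (M.C.init (List.replicate n ())) = W := by
    intro τ hτ
    rw [CA.iterate_step_of_fixed M.C rfl h2 hτ,
      ← CA.iterate_step_of_fixed M.C rfl h2 (le_max_right s _)]
    exact CA.iterate_step_of_fixed M.C hs hW (le_max_left _ _)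
  rw [fst_auxAt M _ hk, h3 τ (by omega)]

theorem fst_auxAt_of_le {n s : ℕ} {W : ℤ → κ}
    (hs : M.C.step^[s] (M.C.init (List.replicate n ())) = W) (hW : M.C.step W = W)
    {τ k : ℕ} (hτ : s ≤ τ) (hk : k < n) : (auxAt M n τ k).1 = W k := by
  rw [fst_auxAt M _ hk, CA.iterate_step_of_fixed M.C hs hW hτ]

/-- If the auxiliary automaton has come to rest early enough, this is noticed. -/
theorem quiet_of_le {n P s : ℕ} {W : ℤ → κ} (hP : 1 ≤ P)
    (hs : M.C.step^[s] (M.C.init (List.replicate n ())) = W) (hW : M.C.step W = W)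
    (h : s + n ≤ 2 * n * P) : Quiet M n P := by
  have hnP : 2 * n ≤ 2 * n * P := Nat.le_mul_of_pos_right _ hP
  intro k hk
  rw [show 2 * n * P + (2 * n - 2 - k) = 2 * n * P - 1 - k + (2 * n - 1) by omega,
    snd_auxAt M hk hP (by omega)]
  intro i _
  rw [fst_auxAt_of_le hs hW (by omega) hk, fst_auxAt_of_le hs hW (by omega) hk]

theorem runAt_congr {n : ℕ} {c : Bool → ℕ} {K K' : ℕ → Bool} {i : ℕ} (h : ∀ j < i, K j = K' j) :
    runAt M n c K i = runAt M n c K' i := by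
  induction i with
  | zero => rfl
  | succ i ih => rw [runAt, runAt, ih fun j hj => h j (by omega), h i (by omega)]

theorem auxBit_eq {n P : ℕ} {bit : Bool → κ} (hbit : Function.Injective bit)
    (hone : M.one = bit true) {x : ℕ}
    (h : ∀ τ ≥ 2 * n * P, ∀ k < n,
      (auxAt M n τ k).1 = M.C.wordConfig ((binWord n x).map bit) k) {j : ℕ} (hj : j < n) :
    auxBit M n P j = x.testBit j := by
  have h1 : M.C.wordConfig ((binWord n x).map bit) ((n - 1 - j : ℕ) : ℤ) = bit (x.testBit j) := by
    change List.getD _ (n - 1 - j) _ = _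
    rw [List.getD_eq_getElem _ _ (by simp [binWord]; omega)]
    simp only [binWord, List.map_map, List.getElem_map, List.getElem_range, Function.comp_apply]
    rw [show n - 1 - (n - 1 - j) = j by omega]
  rw [auxBit, h _ (by omega) _ (by omega), h1, hone]
  cases h2 : x.testBit j <;> simp [hbit.eq_iff]

end Seg

end

/-! ### Blocks of different lengths -/

section

variable {κ σ : Type} (M : Prog κ σ)

theorem pulse_cellNext_of_rule {l r : St κ σ} {x : Cell κ σ} {p : Pulse σ}
    (h : (rule M l (.cell x) r).pulse = some p) : (cellNext M l x r).pulse = some p := by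
  rw [rule] at h
  split_ifs at h
  · cases h
  · cases h
  · exact h

namespace Seg

variable {M} in
theorem pulse_stayCell {D : Seg} {P u k : ℕ} {p : Pulse σ}
    (h : (D.stayCell M P u k).pulse = some p) : p.role = D.role := by
  rw [stayCell] at h
  split_ifs at h
  · cases h
  · simp only [postCell] at h
    split_ifs at h
    · cases h
      exact role_pulse M D P _

/-- No pulse of role `lone` appears in a block that is not the rightmost one. -/
theorem not_lonePulse_of_re_eq_false {D : Seg} {P u : ℕ} (hsrc : D.src ≠ none) (hre : D.re = false)
    {l r : St κ σ} (hr : r ≠ .off) :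
    ∀ x ∈ listStep (rule M) l (D.cells M P u) r, ¬ LonePulse x := by
  have hrole : D.role ≠ .lone := by
    rw [role, hre]
    split_ifs <;> simp_all
  rw [cells, if_neg hsrc, staying, listStep_map_range']
  rintro x hx ⟨p, hp, hl⟩
  obtain ⟨k, hk, rfl⟩ := List.mem_map.1 hx
  rw [List.mem_range'_1] at hk
  obtain ⟨⟨q, h4, h5, h6, -⟩, -⟩ := pulse_cellNext M (pulse_cellNext_of_rule M hp)
  rw [last_stayCell] at h4 h5
  rw [hl] at h6
  by_cases hkn : k + 1 = D.n
  · rw [if_pos (by omega)] at h4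
    exact hr (h4 (by simpa using hkn) h6.symm)
  · have h7 := h5 (by simpa using hkn)
    rw [if_neg (by omega), St.pulse_cell] at h7
    exact hrole (by rw [h6, pulse_stayCell h7])

theorem cells_eq_cons {D : Seg} {P u : ℕ} (hsrc : D.src ≠ none) (hn : 1 ≤ D.n) :
    ∃ v, D.cells M P u = .cell (D.stayCell M P u 0) :: v := by
  rw [cells, if_neg hsrc, staying, List.range'_eq_cons_iff.2 ⟨rfl, hn, rfl⟩]
  exact ⟨_, rfl⟩

theorem tok_stayCell {D : Seg} {P u k : ℕ} :
    (D.stayCell M P u k).tok = tokAt D.n (2 * D.n * P + u) k := by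
  unfold stayCell
  split_ifs <;> rfl

/-- At the time when the token leaves the shortest blocks, these have a pulse in their first cells,
and the others have not: a neighbouring block of a different length causes an error. -/
theorem poisoned_of_ne {m : ℕ} (hm : 1 ≤ m) : ∀ {Ds : List Seg} {l : St κ σ} {li : Bool},
    Wf 0 li Ds → (∀ D ∈ Ds, m ≤ D.n ∧ D.src ≠ none) → (∃ D ∈ Ds, D.n = m) → (∃ D ∈ Ds, D.n ≠ m) →
    Poisoned (listStep (rule M) l (conf M 0 (2 * m - 1) Ds) .off)
  | [], _, _, _, _, ⟨_, h, _⟩, _ => by simp at h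
  | [X], _, _, _, _, ⟨D, hD, h1⟩, ⟨E, hE, h2⟩ => by
    simp only [List.mem_singleton] at hD hE
    subst hD hE
    exact absurd h1 h2
  | X :: Y :: Ds, l, li, hwf, hD, h1, h2 => by
    have hX := hD X (by simp)
    have hY := hD Y (by simp)
    have hre : X.re = false := hwf.1.2.2.2.2
    obtain ⟨v, hv⟩ := cells_eq_cons M (P := 0) (u := 2 * m - 1) hY.2 (hm.trans hY.1)
    have hYs : conf M 0 (2 * m - 1) (Y :: Ds) =
        .cell (Y.stayCell M 0 (2 * m - 1) 0) :: (v ++ conf M 0 (2 * m - 1) Ds) := by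
      rw [conf, List.flatMap_cons, hv]
      rfl
    rw [conf, List.flatMap_cons, ← conf, listStep_append, getLastD_cells M (hm.trans hX.1), hYs,
      List.headD_cons]
    have hlone := not_lonePulse_of_re_eq_false M (D := X) (P := 0) (u := 2 * m - 1) hX.2 hre
      (l := l) (r := .cell (Y.stayCell M 0 (2 * m - 1) 0)) (by simp)
    by_cases hXm : X.n = m
    · by_cases hYm : Y.n = m
      · rw [← hYs]
        refine poisoned_append hlone (poisoned_of_ne hm hwf.2 (fun D h => hD D (by simp [h]))
          ⟨Y, by simp, hYm⟩ ?_)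
        obtain ⟨E, hE, h3⟩ := h2
        rcases List.mem_cons.1 hE with rfl | hE
        · exact absurd hXm h3
        · exact ⟨E, hE, h3⟩
      · refine poisoned_append_of_mem hlone ?_
        rw [cells, if_neg hX.2, staying, listStep_map_range', List.mem_map]
        refine ⟨X.n - 1, by rw [List.mem_range'_1]; omega, ?_⟩
        rw [rule, if_pos]
        right
        rw [last_stayCell, tok_stayCell, if_pos (by omega)]
        refine ⟨by simp; omega, tokAt_full (by omega), by simp, ?_⟩
        rw [St.pulse_cell, stayCell, if_pos (by omega)]
        rfl
    · by_cases hYm : Y.n = m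
      · refine poisoned_append hlone ⟨[], listStep (rule M) (.cell (Y.stayCell M 0 (2 * m - 1) 0))
          (v ++ conf M 0 (2 * m - 1) Ds) .off, ?_, by simp⟩
        rw [listStep, List.nil_append]
        congr 1
        rw [rule, if_pos]
        left
        have h3 : Y.stayCell M 0 (2 * m - 1) 0 = Y.postCell M 0 (2 * m - 1) 0 := if_neg (by omega)
        rw [h3]
        refine ⟨by simp [postCell], Y.pulse M 0 (Y.n - 0), ?_, ?_⟩
        · simp only [postCell]
          rw [if_pos (by omega)]
        · rintro ⟨-, ⟨h4, -⟩ | ⟨h4, -⟩⟩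
          · cases h4
          · rw [St.tok_cell, tok_stayCell, tokAt, if_neg (by omega), if_neg (by omega),
              if_neg (by omega)] at h4
            simp at h4
      · rw [← hYs]
        refine poisoned_append hlone (poisoned_of_ne hm hwf.2 (fun D h => hD D (by simp [h])) ?_
          ⟨Y, by simp, hYm⟩)
        obtain ⟨E, hE, h3⟩ := h1
        rcases List.mem_cons.1 hE with rfl | hE
        · exact absurd h3 hXm
        · exact ⟨E, hE, h3⟩

/-- Inputs with blocks of different lengths are not accepted. -/
theorem n_eq_of_accept {Ds : List Seg} (hwf : Wf 0 true Ds) (hsrc : ∀ D ∈ Ds, D.src ≠ none)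
    {s : ℕ} (hs : ((next M)^[s] (conf M 0 0 Ds)).headD .off ∈ (machine M).accept) :
    ∃ n ≥ 1, ∀ D ∈ Ds, D.n = n := by
  by_contra hcon
  have hpos : ∀ {Ds : List Seg} {li}, Wf 0 li Ds → ∀ D ∈ Ds, 1 ≤ D.n := by
    intro Ds
    induction Ds with
    | nil => simp
    | cons E Ds ih =>
      intro li h D hD
      rcases List.mem_cons.1 hD with rfl | hD
      · exact h.1.1
      · exact ih h.2 D hD
  have hne : Ds ≠ [] := by
    rintro rfl
    exact hcon ⟨1, le_rfl, by simp⟩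
  obtain ⟨X, hX, hmin⟩ : ∃ X ∈ Ds, ∀ D ∈ Ds, X.n ≤ D.n := by
    obtain ⟨X, hX, h⟩ := Set.exists_min_image {D | D ∈ Ds} Seg.n (List.finite_toSet Ds)
      (List.exists_mem_of_ne_nil Ds hne)
    exact ⟨X, hX, h⟩
  have h1 := hpos hwf X hX
  obtain ⟨Y, hY, hYn⟩ : ∃ Y ∈ Ds, Y.n ≠ X.n := by
    by_contra h
    push Not at h
    exact hcon ⟨X.n, h1, h⟩
  rcases lt_or_ge s (2 * X.n) with h | h
  · rw [iterate_next_conf M hwf (fun D hD => by have := hmin D hD; omega)] at hs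
    obtain ⟨D, rfl, -⟩ := eq_of_accept M hwf (fun D hD => by have := hmin D hD; omega) hs
    simp only [List.mem_singleton] at hX hY
    subst hX hY
    exact hYn rfl
  · rw [show s = (s - (2 * X.n - 1)) + (2 * X.n - 1) by omega, Function.iterate_add_apply,
      iterate_next_conf M hwf (fun D hD => by have := hmin D hD; omega)] at hs
    refine absurd hs (not_accept_of_poisoned_next M (poisoned_filter ?_ (by simp))
      (off_notMem_conf M) (by omega))
    exact poisoned_of_ne M h1 hwf (fun D hD => ⟨hmin D hD, hsrc D hD⟩) ⟨X, hX, rfl⟩ ⟨Y, hY, hYn⟩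

end Seg

end

/-! ### The first step -/

/-- A block of an input word: its length, its number, and its symbol on the lower track. -/
structure Block where
  n : ℕ
  x : ℕ
  z : Bool

/-- The block number fits into a block of positive length. -/
def Block.Valid (B : Block) : Prop := 1 ≤ B.n ∧ B.x < 2 ^ B.n

/-- The word that a block consists of. -/
def Block.word (B : Block) : List BlockSymbol :=
  (List.range' 0 B.n).map fun k =>
    .pair (some (B.x.testBit (B.n - 1 - k))) (some (decide (k = 0) && B.z))

/-- The input word that consists of the given blocks. -/
def encode (Bs : List Block) : List BlockSymbol :=
  List.intercalate [BlockSymbol.sep] (Bs.map Block.word)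

/-- Blocks that follow another block, with the preceding separator. -/
def encodeTail (Bs : List Block) : List BlockSymbol :=
  if Bs = [] then [] else .sep :: encode Bs

theorem encode_cons (B : Block) (Bs : List Block) :
    encode (B :: Bs) = B.word ++ encodeTail Bs := by
  cases Bs with
  | nil => simp [encode, encodeTail, List.intercalate]
  | cons C Bs => simp [encode, encodeTail, List.intercalate]

theorem exists_testBit_eq (u : List Bool) :
    ∃ x < 2 ^ u.length, ∀ k (hk : k < u.length), x.testBit (u.length - 1 - k) = u[k] := by
  refine ⟨Nat.ofBits fun i : Fin u.length => u[u.length - 1 - i], Nat.ofBits_lt_two_pow _,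
    fun k hk => ?_⟩
  rw [Nat.testBit_ofBits_lt _ _ (by omega)]
  congr 1
  change u.length - 1 - (u.length - 1 - k) = k
  omega

section

variable {κ σ : Type} (M : Prog κ σ)

/-- The segment of the first phase that belongs to a block. -/
def initSeg (li re : Bool) (B : Block) : Seg where
  n := B.n
  num := fun k => some (B.x.testBit (B.n - 1 - k))
  dig := fun _ => 0
  s := fun k => .keep (if k + 1 = B.n then bitDig B.z else 0)
  src := some (.keep 0)
  li := li
  re := re

/-- The segments of the first phase that belong to the given blocks. -/
def initSegs : Bool → List Block → List Seg
  | _, [] => []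
  | li, B :: Bs => initSeg li Bs.isEmpty B :: initSegs false Bs

theorem isEmpty_initSegs (li : Bool) (Bs : List Block) : (initSegs li Bs).isEmpty = Bs.isEmpty := by
  cases Bs <;> rfl

theorem wf_initSegs : ∀ {Bs : List Block} {li : Bool}, (∀ B ∈ Bs, B.Valid) →
    Seg.Wf 0 li (initSegs li Bs)
  | [], _, _ => trivial
  | B :: Bs, li, h => by
    refine ⟨⟨(h B (by simp)).1, by simp [initSeg], fun q hq j hj => ?_, rfl, ?_⟩,
      wf_initSegs fun C hC => h C (by simp [hC])⟩
    · simp only [initSeg, Option.some.injEq] at hq hj ⊢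
      rw [if_neg (by omega), hq]
    · rw [isEmpty_initSegs]; rfl

theorem exists_of_mem_initSegs {D : Seg} : ∀ {Bs : List Block} {li : Bool}, D ∈ initSegs li Bs →
    ∃ B ∈ Bs, ∃ li re, D = initSeg li re B
  | [], _, h => by simp [initSegs] at h
  | B :: Bs, li, h => by
    rcases List.mem_cons.1 h with rfl | h
    · exact ⟨B, by simp, _, _, rfl⟩
    · obtain ⟨C, hC, h⟩ := exists_of_mem_initSegs h
      exact ⟨C, by simp [hC], h⟩

theorem exists_mem_initSegs {B : Block} : ∀ {Bs : List Block} {li : Bool}, B ∈ Bs →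
    ∃ D ∈ initSegs li Bs, D.n = B.n
  | C :: Bs, li, h => by
    rcases List.mem_cons.1 h with rfl | h
    · exact ⟨_, List.mem_cons_self, rfl⟩
    · obtain ⟨D, hD, h⟩ := exists_mem_initSegs (li := false) h
      exact ⟨D, List.mem_cons_of_mem _ hD, h⟩

theorem isEdge_pair {a b : Option Bool} : ¬ IsEdge (.inp (.pair a b) : St κ σ) := by simp [IsEdge]

/-- The first step in a block. -/
theorem listStep_word {B : Block} (hB : B.Valid) {l r : St κ σ} (hl : IsEdge l) (hr : IsEdge r)
    (li re : Bool) :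
    listStep (rule M) l (B.word.map .inp) r = (initSeg li re B).cells M 0 0 := by
  have hn := hB.1
  have h0 : (initSeg li re B).src ≠ none := by simp [initSeg]
  rw [Seg.cells, if_neg h0, Seg.staying, Block.word, List.map_map, listStep_map_range']
  apply List.map_congr_left
  intro k hk
  rw [List.mem_range'_1] at hk
  have h1 : (initSeg li re B).stayCell M 0 0 k = (initSeg li re B).preCell M 0 0 k :=
    if_pos (by simp only [initSeg]; omega)
  have h2 : IsEdge (if k = 0 then l else (St.inp ∘ fun k => BlockSymbol.pair
      (some (B.x.testBit (B.n - 1 - k))) (some (decide (k = 0) && B.z))) (k - 1)) ↔ k = 0 := by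
    split_ifs with h
    · simp [hl, h]
    · simp [isEdge_pair, h]
  have h3 : IsEdge (if k + 1 = 0 + B.n then r else (St.inp ∘ fun k => BlockSymbol.pair
      (some (B.x.testBit (B.n - 1 - k))) (some (decide (k = 0) && B.z))) (k + 1)) ↔
      k + 1 = B.n := by
    split_ifs with h
    · simp only [hr, true_iff]; omega
    · simp only [Function.comp_apply, isEdge_pair, false_iff]; omega
  rw [h1]
  change inpNext M _ (.pair (some _) (some _)) _ = _
  rw [inpNext, if_neg (by rw [h2]; simp; tauto)]
  simp only [h2, h3]
  have e1 : (if k = 0 then Tok.half else .none) = tokAt B.n (2 * B.n * 0 + 0) k := by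
    rw [Nat.mul_zero, Nat.add_zero, tokAt, if_neg (by omega : ¬ 0 = 2 * k + 1),
      if_neg (by omega : ¬ (2 * k + 1 < 0 ∧ k + 1 = B.n))]
    by_cases hk0 : k = 0
    · simp [hk0]
    · rw [if_neg hk0, if_neg (by omega)]
  have e2 : (M.C.inp (), true) = auxAt M B.n (2 * B.n * 0 + 0) k := by
    rw [Nat.mul_zero, Nat.add_zero, auxAt]
  have e3 : (if k = 0 then some (Sym.keep (bitDig (decide (k = 0) && B.z))) else none) =
      if k ≤ 0 ∧ Even (0 - k) then some ((initSeg li re B).s (B.n - 1 - (0 - k) / 2))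
      else none := by
    by_cases hk0 : k = 0
    · subst hk0
      rw [if_pos rfl, if_pos (by simp)]
      simp only [initSeg]
      rw [if_pos (by omega)]
      simp
    · rw [if_neg hk0, if_neg (by omega)]
  simp only [Seg.preCell, St.cell.injEq, Cell.mk.injEq]
  refine ⟨by simp, decide_eq_decide.2 Iff.rfl, ?_, e2, rfl, ?_, rfl, trivial⟩
  · convert e1 <;> rfl
  · convert e3 using 5; rfl

theorem not_isEdge_getLastD_word {B : Block} (hB : B.Valid) (l : St κ σ) :
    ¬ IsEdge ((B.word.map St.inp).getLastD l) := by
  have hn := hB.1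
  obtain ⟨n, h⟩ : ∃ n, B.n = n + 1 := ⟨B.n - 1, by omega⟩
  rw [Block.word, h, List.range'_concat]
  simp [isEdge_pair]

theorem not_isEdge_headD_encode {B : Block} {Bs : List Block} (hB : B.Valid) (l : St κ σ) :
    ¬ IsEdge (((encode (B :: Bs)).map St.inp).headD l) := by
  have hn := hB.1
  obtain ⟨n, h⟩ : ∃ n, B.n = n + 1 := ⟨B.n - 1, by omega⟩
  rw [encode_cons, Block.word, h, List.range'_succ]
  simp [isEdge_pair]

open Classical in
/-- The first step on an input word that consists of blocks. -/
theorem filter_listStep_encode : ∀ {Bs : List Block} {l : St κ σ} (li : Bool), (∀ B ∈ Bs, B.Valid) →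
    IsEdge l → (listStep (rule M) l ((encode Bs).map .inp) .off).filter
      (fun x => x ≠ .del) = Seg.conf M 0 0 (initSegs li Bs)
  | [], _, _, _, _ => rfl
  | B :: Bs, l, li, h, hl => by
    have hB := h B (by simp)
    have hr : IsEdge (((encodeTail Bs).map St.inp).headD (.off : St κ σ)) := by
      rw [encodeTail]
      split_ifs <;> simp [IsEdge]
    rw [encode_cons, List.map_append, listStep_append, listStep_word M hB hl hr li Bs.isEmpty,
      List.filter_append, initSegs, Seg.conf, List.flatMap_cons, ← Seg.conf]
    congr 1
    · rw [Seg.cells, if_neg (by simp [initSeg]), Seg.staying]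
      exact Seg.filter_map_cell _ _ _ (by simp)
    · rw [← filter_listStep_encode (l := .inp .sep) false (fun C hC => h C (by simp [hC]))
        (Or.inr rfl)]
      cases Bs with
      | nil => rfl
      | cons C Bs =>
        rw [encodeTail, if_neg (by simp), List.map_cons, listStep, rule, inpNext, if_neg,
          List.filter_cons_of_neg (by simp)]
        rw [not_or]
        exact ⟨not_isEdge_getLastD_word hB _, not_isEdge_headD_encode (h C (by simp)) _⟩

/-- An input word on which the first step does not detect an error consists of blocks. -/
theorem exists_encode_of_err_notMem : ∀ {w : List BlockSymbol} {l : St κ σ},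
    .err ∉ listStep (rule M) l (w.map .inp) .off →
    (w ≠ [] → IsEdge l → ∃ Bs, Bs ≠ [] ∧ (∀ B ∈ Bs, B.Valid) ∧ w = encode Bs) ∧
      (¬ IsEdge l → ∃ (u : List Bool) (Bs : List Block), (∀ B ∈ Bs, B.Valid) ∧
        w = u.map (fun b => .pair (some b) (some false)) ++ encodeTail Bs)
  | [], _, _ => ⟨by simp, fun _ => ⟨[], [], by simp, rfl⟩⟩
  | s :: w, l, h => by
    rw [List.map_cons, listStep, List.mem_cons, not_or, rule] at h
    obtain ⟨h1, h2⟩ := h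
    obtain ⟨ih1, ih2⟩ := exists_encode_of_err_notMem h2
    rcases s with _ | ⟨_ | b, _ | z⟩
    · rw [inpNext] at h1
      split_ifs at h1 with h3
      · exact absurd rfl h1
      · rw [not_or] at h3
        refine ⟨fun _ h => absurd h h3.1, fun _ => ?_⟩
        have hw : w ≠ [] := by
          rintro rfl
          exact h3.2 (Or.inl rfl)
        obtain ⟨Bs, hne, hB, rfl⟩ := ih1 hw (Or.inr rfl)
        exact ⟨[], Bs, hB, by simp [encodeTail, hne]⟩
    · exact absurd rfl h1
    · exact absurd rfl h1
    · exact absurd rfl h1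
    · obtain ⟨u, Bs, hB, rfl⟩ := ih2 isEdge_pair
      rw [inpNext] at h1
      constructor
      · intro _ _
        obtain ⟨x, hx, hbit⟩ := exists_testBit_eq (b :: u)
        refine ⟨⟨u.length + 1, x, z⟩ :: Bs, by simp, ?_, ?_⟩
        · intro C hC
          rcases List.mem_cons.1 hC with rfl | hC
          · exact ⟨by simp, hx⟩
          · exact hB C hC
        · rw [encode_cons, ← List.cons_append]
          congr 1
          apply List.ext_getElem
          · simp [Block.word]
          · intro k h3 h4
            simp only [List.length_cons, List.length_map] at h3
            have := hbit k (by simpa using h3)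
            simp only [List.length_cons] at this
            simp only [Block.word, List.getElem_map, List.getElem_range', zero_add, one_mul, this]
            cases k with
            | zero => simp
            | succ k => simp
      · intro hl
        obtain rfl : z = false := by
          by_contra hz
          rw [if_pos ⟨hl, by simpa using hz⟩] at h1
          exact h1 rfl
        exact ⟨b :: u, Bs, hB, rfl⟩

/-- An accepted input word consists of blocks. -/
theorem exists_encode_of_accept {w : List BlockSymbol} (hw : w ≠ []) {s : ℕ}
    (hs : ((next M)^[s] (w.map .inp)).headD .off ∈ (machine M).accept) :
    ∃ Bs, Bs ≠ [] ∧ (∀ B ∈ Bs, B.Valid) ∧ w = encode Bs := by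
  by_contra hcon
  have herr : .err ∈ listStep (rule M) .off (w.map .inp) .off := by
    by_contra h
    exact hcon ((exists_encode_of_err_notMem M h).1 hw (Or.inl rfl))
  have h1 : Poisoned (next M (w.map .inp)) := by
    refine poisoned_filter ?_ (by simp)
    rw [← List.append_nil (listStep _ _ _ _)]
    refine poisoned_append_of_mem ?_ herr
    rintro x hx ⟨p, hp, -⟩
    obtain ⟨a, c, i, hi, -, rfl⟩ := exists_of_mem_listStep hx
    rw [List.getElem_map, pulse_rule_inp] at hp
    cases hp
  rcases s with _ | s
  · cases w with
    | nil => exact hw rfl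
    | cons a w =>
      obtain ⟨p, hp, -⟩ := hs
      cases hp
  · exact not_accept_of_poisoned_next M h1 (by simp) (by omega) hs

end

/-! ### Block words -/

theorem blockParam_eq_iff {m n : ℕ} (hn : 1 ≤ n) :
    n = blockParam m ↔ m ≤ 2 ^ n ∧ (2 ≤ n → 2 ^ (n - 1) < m) := by
  have h1 : m ≤ 2 ^ n ↔ Nat.clog 2 m ≤ n := (Nat.clog_le_iff_le_pow (by norm_num)).symm
  have h2 : 2 ^ (n - 1) < m ↔ n - 1 < Nat.clog 2 m := (Nat.lt_clog_iff_pow_lt (by norm_num)).symm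
  rw [h1, h2, blockParam]
  omega

/-- The blocks of the block word of `z`, if they have length `n`. -/
def blocksOf (n : ℕ) (z : List Bool) : List Block := z.mapIdx fun i a => ⟨n, i, a⟩

theorem word_eq_twoTrack {n i : ℕ} {a : Bool} (hn : 1 ≤ n) :
    (Block.mk n i a).word = twoTrack (binWord n i) (a :: List.replicate (n - 1) false) := by
  apply List.ext_getElem
  · simp [Block.word, twoTrack, binWord]
    omega
  · intro k h1 h2
    simp only [Block.word, List.length_map, List.length_range'] at h1
    simp only [Block.word, twoTrack, List.getElem_map, List.getElem_range', List.getElem_range,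
      zero_add, one_mul, BlockSymbol.pair.injEq]
    constructor
    · rw [List.getElem?_eq_getElem (by simpa [binWord] using h1)]
      simp [binWord]
    · rw [List.getElem?_eq_getElem (by simp; omega)]
      cases k <;> simp

theorem blockEncode_eq_encode {z : List Bool} :
    blockEncode id z = encode (blocksOf (blockParam z.length) z) := by
  rw [blockEncode, encode]
  congr 1
  apply List.ext_getElem
  · simp [blocksOf]
  · intro i h1 h2
    simp only [blocksOf, List.getElem_mapIdx, List.getElem_map]
    exact (word_eq_twoTrack (le_max_left _ _)).symm

/-- The number and the counters of a block in the beginning. -/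
def Block.value (B : Block) : ℕ × (Bool → ℕ) := (B.x, fun b => if b = B.z then 1 else 0)

theorem sum_value (Bs : List Block) : ((Bs.map Block.value).map Prod.snd).sum =
    fun t => (Bs.map Block.z).count t := by
  induction Bs with
  | nil => rfl
  | cons B Bs ih =>
    funext t
    simp only [List.map_cons, List.sum_cons, ih, Pi.add_apply, List.count_cons, Block.value]
    rw [add_comm]
    congr 1
    cases t <;> cases B.z <;> rfl

theorem eq_blocksOf {n : ℕ} {Bs : List Block} (h : ∀ B ∈ Bs, B.n = n)
    (hx : Bs.map Block.x = List.range' 0 Bs.length) : Bs = blocksOf n (Bs.map Block.z) := by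
  apply List.ext_getElem
  · simp [blocksOf]
  · intro i h1 h2
    have h3 : (Bs.map Block.x)[i]'(by simpa using h1) = i := by
      simp only [hx, List.getElem_range', zero_add, one_mul]
    rw [List.getElem_map] at h3
    have h4 := h _ (List.getElem_mem h1)
    simp only [blocksOf, List.getElem_mapIdx, List.getElem_map]
    have h5 : ∀ B : Block, B.n = n → B.x = i → B = ⟨n, i, B.z⟩ := by
      rintro ⟨⟩ rfl rfl
      rfl
    exact h5 _ h4 h3

section

variable {κ σ : Type} (M : Prog κ σ)

theorem yields_initSeg {B : Block} (hB : B.Valid) (li re : Bool) :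
    Seg.Yields M B.n 0 (initSeg li re B) B.value where
  n_eq := rfl
  nn_eq := fun k _ => rfl
  dg_eq := fun k hk => by
    have h1 := Seg.dg_eq M (D := initSeg li re B) (P := 0) (a := 0) (b := B.value.2) (k := k)
      (fun t => by
        have : 1 ≤ 2 ^ B.n := Nat.one_le_two_pow
        simp only [Pi.zero_apply, zero_add, Block.value]
        split_ifs
        · exact this
        · exact Nat.zero_le _)
      (fun k hk => by
        funext t
        simp [initSeg, digitsAt, digit])
      (fun k hk => by
        change k < B.n at hk
        change (Sym.keep (if k + 1 = B.n then bitDig B.z else 0)).cnt = digitsAt B.n _ k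
        funext t
        simp only [Sym.cnt, digitsAt, Block.value]
        by_cases hkn : k + 1 = B.n
        · rw [if_pos hkn, show B.n - 1 - k = 0 by omega, bitDig, digit]
          split_ifs <;> rfl
        · rw [if_neg hkn]
          have h2 : (if t = B.z then 1 else 0) / 2 ^ (B.n - 1 - k) = 0 := by
            apply Nat.div_eq_of_lt
            have : 1 < 2 ^ (B.n - 1 - k) := Nat.one_lt_two_pow (by omega)
            split_ifs <;> omega
          rw [digit, h2]
          simp)
      hk
    rw [h1, zero_add]
    rfl
  lt := hB.2
  le := fun t => by
    simp only [Block.value]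
    split_ifs <;> simp

theorem yields_initSegs {n : ℕ} : ∀ {Bs : List Block} (li : Bool), (∀ B ∈ Bs, B.Valid ∧ B.n = n) →
    List.Forall₂ (Seg.Yields M n 0) (initSegs li Bs) (Bs.map Block.value)
  | [], _, _ => .nil
  | B :: Bs, li, h => by
    obtain ⟨h1, rfl⟩ := h B (by simp)
    exact .cons (yields_initSeg M h1 _ _) (yields_initSegs false fun C hC => h C (by simp [hC]))

theorem allOk_initSegs {Bs : List Block} {li : Bool} : Seg.AllOk M 0 (initSegs li Bs) := by
  intro D hD
  obtain ⟨B, -, li, re, rfl⟩ := exists_of_mem_initSegs hD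
  rw [Seg.ok_pulse M le_rfl]
  constructor
  · simp [Seg.pulse, startPulse, initSeg, Seg.nn, newNum]
  · intro k _ _ a d h
    simp [initSeg] at h

theorem start_initSegs {n : ℕ} {Bs : List Block} (hn : 1 ≤ n) (h : ∀ B ∈ Bs, B.Valid ∧ B.n = n) :
    Seg.Start M n (initSegs true Bs) (Bs.map Block.value) where
  one_le := hn
  wf := wf_initSegs fun B hB => (h B hB).1
  yields := yields_initSegs M true h
  allOk := allOk_initSegs M

theorem next_encode {Bs : List Block} (h : ∀ B ∈ Bs, B.Valid) :
    next M ((encode Bs).map .inp) = Seg.conf M 0 0 (initSegs true Bs) :=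
  filter_listStep_encode M true h (Or.inl rfl)

theorem acceptsAt_machine_iff {w : List BlockSymbol} {s : ℕ} : (machine M).AcceptsAt w s ↔
    ((next M)^[s] (w.map .inp)).headD .off ∈ (machine M).accept :=
  (machine M).acceptsAt_iff w s

/-- The blocks are numbered consecutively, without dispensable bits, if and only if the input is a
block word. -/
theorem numbered_value_iff {n : ℕ} {Bs : List Block} (hne : Bs ≠ []) (hn : 1 ≤ n)
    (h : ∀ B ∈ Bs, B.Valid ∧ B.n = n) : Numbered n 0 0 (Bs.map Block.value) ↔
      Bs = blocksOf n (Bs.map Block.z) ∧ n = blockParam Bs.length := by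
  have hlen : 1 ≤ Bs.length := List.length_pos_of_ne_nil hne
  have hfst : (Bs.map Block.value).map Prod.fst = Bs.map Block.x := by
    rw [List.map_map]; rfl
  rw [Numbered, hfst, List.length_map, blockParam_eq_iff hn, zero_add, Nat.sub_zero]
  constructor
  · rintro ⟨h1, h2⟩
    refine ⟨eq_blocksOf (fun B hB => (h B hB).2) h1, ?_, fun h3 => h2 h3 hn (by simpa using hne)⟩
    have h3 : (Bs.map Block.x)[Bs.length - 1]'(by simp; omega) = Bs.length - 1 := by
      simp only [h1, List.getElem_range', zero_add, one_mul]
    have h4 : Bs.length - 1 < Bs.length := by omega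
    have h5 := h _ (List.getElem_mem h4)
    have h6 := h5.1.2
    rw [List.getElem_map] at h3
    rw [h5.2, h3] at h6
    omega
  · rintro ⟨h1, -, h2⟩
    refine ⟨?_, fun h3 _ _ => h2 h3⟩
    rw [h1, blocksOf]
    apply List.ext_getElem
    · simp
    · intro i _ _
      simp

variable {M}

/-- An accepted input is the block word of a word with positive evaluation. -/
theorem exists_blockEncode_of_acceptsAt {bit : Bool → κ} (hbit : Function.Injective bit)
    (hone : M.one = bit true) {g : ℕ → ℕ}
    (hg : ∀ n, 1 ≤ n → ∃ s,
      M.C.step^[s] (M.C.init (List.replicate n ())) =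
        M.C.wordConfig ((binWord n (g n - 1)).map bit) ∧
      M.C.step (M.C.wordConfig ((binWord n (g n - 1)).map bit)) =
        M.C.wordConfig ((binWord n (g n - 1)).map bit))
    {w : List BlockSymbol} (hw : w ≠ []) {s : ℕ} (hs : (machine M).AcceptsAt w s) :
    ∃ z ≠ [], w = blockEncode id z ∧ M.final (Seg.runAt M (blockParam z.length) (fun t => z.count t)
      (fun j => (g (blockParam z.length) - 1).testBit j) (blockParam z.length)) := by
  rw [acceptsAt_machine_iff] at hs
  obtain ⟨Bs, hne, hvalid, rfl⟩ := exists_encode_of_accept M hw hs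
  obtain ⟨s, rfl⟩ : ∃ s', s = s' + 1 := by
    cases s with
    | succ s => exact ⟨s, rfl⟩
    | zero =>
      cases h : encode Bs with
      | nil => exact absurd h hw
      | cons a w =>
        rw [h] at hs
        obtain ⟨p, hp, -⟩ := hs
        cases hp
  rw [Function.iterate_succ_apply, next_encode M hvalid] at hs
  have hsrc : ∀ D ∈ initSegs true Bs, D.src ≠ none := fun D hD => by
    obtain ⟨B, -, li, re, rfl⟩ := exists_of_mem_initSegs hD
    simp [initSeg]
  obtain ⟨n, hn, hlen⟩ := Seg.n_eq_of_accept M (wf_initSegs hvalid) hsrc hs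
  have hBs : ∀ B ∈ Bs, B.Valid ∧ B.n = n := fun B hB => by
    obtain ⟨D, hD, h⟩ := exists_mem_initSegs (li := true) hB
    exact ⟨hvalid B hB, by rw [← h, hlen D hD]⟩
  obtain ⟨hnum, P, hP, hq, hf⟩ := (start_initSegs M hn hBs).sound hs
  obtain ⟨h1, h2⟩ := (numbered_value_iff hne hn hBs).1 hnum
  obtain ⟨s', hs', hfix⟩ := hg n hn
  have hz : blockParam (Bs.map Block.z).length = n := by rw [List.length_map, ← h2]
  refine ⟨Bs.map Block.z, by simpa using hne, ?_, ?_⟩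
  · rw [blockEncode_eq_encode, hz, ← h1]
  · rw [hz]
    rw [sum_value, Seg.runAt_congr (K' := fun j => (g n - 1).testBit j)] at hf
    · exact hf
    · intro j hj
      exact Seg.auxBit_eq hbit hone
        (fun τ hτ k hk => Seg.fst_auxAt_of_quiet hn hP hs' hfix hq hτ hk) hj

/-- The block word of a word with positive evaluation is accepted in time. -/
theorem acceptsAt_blockEncode {bit : Bool → κ} (hbit : Function.Injective bit)
    (hone : M.one = bit true) {x s t n : ℕ} (hst : s ≤ t)
    (hs : M.C.step^[s] (M.C.init (List.replicate n ())) = M.C.wordConfig ((binWord n x).map bit))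
    (hfix : M.C.step (M.C.wordConfig ((binWord n x).map bit)) =
        M.C.wordConfig ((binWord n x).map bit))
    {z : List Bool} (hz : z ≠ []) (hn : n = blockParam z.length)
    (hf : M.final (Seg.runAt M n (fun t => z.count t) (fun j => x.testBit j) n)) :
    ∃ s ≤ 6 * n ^ 2 + t, (machine M).AcceptsAt (blockEncode id z) s := by
  have hn1 : 1 ≤ n := hn ▸ le_max_left _ _
  have hlen : (blocksOf n z).length = z.length := by simp [blocksOf]
  have hmap : (blocksOf n z).map Block.z = z := by
    apply List.ext_getElem
    · simp [blocksOf]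
    · intro i _ _; simp [blocksOf]
  have hne : blocksOf n z ≠ [] := by
    intro h
    rw [h] at hlen
    exact hz (List.length_eq_zero_iff.1 hlen.symm)
  have hm : z.length ≤ 2 ^ n :=
    ((blockParam_eq_iff hn1).1 hn).1
  have hBs : ∀ B ∈ blocksOf n z, B.Valid ∧ B.n = n := by
    intro B hB
    obtain ⟨i, hi, rfl⟩ := List.mem_mapIdx.1 hB
    exact ⟨⟨hn1, hi.trans_le hm⟩, rfl⟩
  have hnum : Numbered n 0 0 ((blocksOf n z).map Block.value) :=
    (numbered_value_iff hne hn1 hBs).2 ⟨by rw [hmap], by rw [hlen, hn]⟩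
  have h1 : 2 * n * (t / (2 * n)) ≤ t := Nat.mul_div_le _ _
  have h2 : t < 2 * n * (t / (2 * n)) + 2 * n := by
    have := Nat.div_add_mod t (2 * n)
    have := Nat.mod_lt t (by omega : 2 * n > 0)
    omega
  have h3 : 2 * n * (n + 1 + t / (2 * n)) = 2 * n ^ 2 + 2 * n + 2 * n * (t / (2 * n)) := by ring
  have h4 : n ≤ n ^ 2 := Nat.le_self_pow (by norm_num) n
  generalize t / (2 * n) = q at h1 h2 h3
  refine ⟨2 * n * (n + 1 + q) + (2 * n - 1) + 1, by omega, ?_⟩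
  rw [acceptsAt_machine_iff, Function.iterate_succ_apply, blockEncode_eq_encode, ← hn,
    next_encode M fun B hB => (hBs B hB).1]
  refine (start_initSegs M hn1 hBs).complete (by simpa using hne) hnum (by omega)
    (Seg.quiet_of_le (by omega) hs hfix (by omega)) ?_
  rw [sum_value, hmap, Seg.runAt_congr (K' := fun j => x.testBit j)]
  · exact hf
  · intro j hj
    exact Seg.auxBit_eq hbit hone
      (fun τ hτ k hk => Seg.fst_auxAt_of_le hs hfix (by omega) hk) hj

/-- The length of blocks is at most the logarithm of the length of the block word. -/
theorem blockParam_le_logb {z : List Bool} (hz : z ≠ []) (hN : 2 ≤ (blockEncode id z).length) :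
    (blockParam z.length : ℝ) ≤ Real.logb 2 (blockEncode id z).length := by
  rw [Real.le_logb_iff_rpow_le (by norm_num) (by positivity), Real.rpow_natCast]
  have h1 := length_blockEncode z hz
  have hm : 1 ≤ z.length := List.length_pos_of_ne_nil hz
  generalize (blockEncode id z).length = N at *
  obtain ⟨n, hn⟩ : ∃ n, n = blockParam z.length := ⟨_, rfl⟩
  have hn1 : 1 ≤ n := hn ▸ le_max_left _ _
  obtain ⟨-, h2⟩ := (blockParam_eq_iff hn1).1 hn
  rw [← hn] at h1 ⊢
  have h3 : 2 ^ n ≤ N := by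
    rcases hn1.eq_or_lt with rfl | h3
    · simpa using hN
    · have h4 := h2 h3
      have h5 : 2 ^ n = 2 * 2 ^ (n - 1) := by
        rw [← Nat.pow_succ', Nat.succ_eq_add_one, Nat.sub_add_cancel hn1]
      nlinarith
  exact_mod_cast h3

/-- A language whose words are recognized by the evaluating automaton from the numbers of their
zeros and ones and from the number that the auxiliary automaton constructs has a block version that
can be recognized fast. -/
theorem blockVersion_mem_SCATime [Finite κ] [Finite σ] (M : Prog κ σ) {bit : Bool → κ}
    (hbit : Function.Injective bit) (hone : M.one = bit true) {g t : ℕ → ℕ}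
    (hg : ∀ n, 1 ≤ n → ∃ s ≤ t n,
      M.C.step^[s] (M.C.init (List.replicate n ())) =
        M.C.wordConfig ((binWord n (g n - 1)).map bit) ∧
      M.C.step (M.C.wordConfig ((binWord n (g n - 1)).map bit)) =
        M.C.wordConfig ((binWord n (g n - 1)).map bit))
    {L : Language Bool} (hL : ∀ z ≠ [], z ∈ L ↔ M.final (Seg.runAt M (blockParam z.length)
      (fun t => z.count t) (fun j => (g (blockParam z.length) - 1).testBit j)
      (blockParam z.length))) :
    BlockVersion id L ∈ SCATime (fun N => Real.logb 2 N ^ 2 + t (blockIndex N)) := by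
  have key : ∀ z ≠ [], z ∈ L → ∃ s ≤ 6 * blockParam z.length ^ 2 + t (blockParam z.length),
      (machine M).AcceptsAt (blockEncode id z) s := by
    intro z hz hzL
    obtain ⟨s, h1, h2, h3⟩ := hg (blockParam z.length) (le_max_left _ _)
    exact acceptsAt_blockEncode hbit hone h1 h2 h3 hz rfl ((hL z hz).1 hzL)
  refine ⟨St κ σ, inferInstance, machine M, ?_, 6, 2, ?_⟩
  · ext w
    constructor
    · rintro ⟨hw, s, hs⟩
      obtain ⟨z, hz, rfl, hf⟩ := exists_blockEncode_of_acceptsAt hbit hone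
        (fun n hn => by obtain ⟨s, -, h⟩ := hg n hn; exact ⟨s, h⟩) hw hs
      exact ⟨z, (hL z hz).2 hf, hz, rfl⟩
    · rintro ⟨z, hzL, hz, rfl⟩
      obtain ⟨s, -, hs⟩ := key z hz hzL
      refine ⟨?_, s, hs⟩
      intro h
      have h1 := length_blockEncode z hz
      rw [h] at h1
      have h2 : 0 < z.length := List.length_pos_of_ne_nil hz
      have h3 : 1 ≤ blockParam z.length := le_max_left _ _
      simp only [List.length_nil] at h1
      nlinarith
  · rintro w ⟨z, hzL, hz, rfl⟩ hN
    obtain ⟨s, hs, hacc⟩ := key z hz hzL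
    have h1 : (machine M).acceptTime (blockEncode id z) ≤
        6 * blockParam z.length ^ 2 + t (blockParam z.length) := (Nat.sInf_le hacc).trans hs
    have h2 := blockParam_le_logb hz hN
    beta_reduce
    rw [blockIndex_length_blockEncode z hz]
    have h3 : (blockParam z.length : ℝ) ^ 2 ≤ Real.logb 2 (blockEncode id z).length ^ 2 :=
      pow_le_pow_left₀ (by positivity) h2 2
    have h4 : ((machine M).acceptTime (blockEncode id z) : ℝ) ≤
        6 * (blockParam z.length : ℝ) ^ 2 + t (blockParam z.length) := by exact_mod_cast h1
    have h5 : (0 : ℝ) ≤ t (blockParam z.length) := by positivity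
    linarith

end

/-! ### Evaluation of digits -/

/-- The value of the `j` least significant digits of `c`. -/
def lowPart (n c j : ℕ) : ℕ := if j = n then c else c % 2 ^ j

theorem lowPart_zero {n c : ℕ} (hn : 1 ≤ n) : lowPart n c 0 = 0 := by
  rw [lowPart, if_neg (by omega), pow_zero, Nat.mod_one]

theorem lowPart_self {n c : ℕ} : lowPart n c n = c := if_pos rfl

theorem lowPart_succ {n c j : ℕ} (hj : j < n) :
    lowPart n c (j + 1) = lowPart n c j + 2 ^ j * digit n c j := by
  rw [lowPart, lowPart, digit, if_neg (by omega : ¬ j = n)]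
  split_ifs
  · exact (Nat.mod_add_div c (2 ^ j)).symm
  · rw [Nat.pow_succ, Nat.mod_mul]

theorem lowPart_lt {n c j : ℕ} (hj : j < n) : lowPart n c j < 2 ^ j := by
  rw [lowPart, if_neg (by omega)]
  exact Nat.mod_lt _ (Nat.two_pow_pos j)

/-- The more significant digit decides a comparison, unless the digits agree. -/
theorem lowPart_succ_lt_iff {n a b j : ℕ} (hj : j < n) :
    lowPart n a (j + 1) < lowPart n b (j + 1) ↔
      digit n a j < digit n b j ∨ (digit n a j = digit n b j ∧ lowPart n a j < lowPart n b j) := by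
  have ha := lowPart_lt (c := a) hj
  have hb := lowPart_lt (c := b) hj
  rw [lowPart_succ hj, lowPart_succ hj]
  rcases lt_trichotomy (digit n a j) (digit n b j) with h | h | h
  · simp only [h, true_or, iff_true]
    have : 2 ^ j * (digit n a j + 1) ≤ 2 ^ j * digit n b j := Nat.mul_le_mul_left _ h
    rw [Nat.mul_succ] at this
    omega
  · simp [h]
  · have h1 : ¬ digit n a j < digit n b j := by omega
    have h2 : ¬ digit n a j = digit n b j := by omega
    simp only [h1, h2, false_and, or_self, iff_false]
    have : 2 ^ j * (digit n b j + 1) ≤ 2 ^ j * digit n a j := Nat.mul_le_mul_left _ h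
    rw [Nat.mul_succ] at this
    omega

/-- One step of the comparison of two numbers, least significant digits first. -/
def compareStep (a b : ℕ) (s : Bool) : Bool := decide (a < b) || (decide (a = b) && s)

theorem compareStep_lowPart {n a b j : ℕ} (hj : j < n) :
    compareStep (digit n a j) (digit n b j) (decide (lowPart n a j < lowPart n b j)) =
      decide (lowPart n a (j + 1) < lowPart n b (j + 1)) := by
  rw [Bool.eq_iff_iff]
  simp [compareStep, lowPart_succ_lt_iff hj]

theorem val_digitsAt {n j : ℕ} {c : Bool → ℕ} {t : Bool} (hj : j < n) (hc : c t ≤ 2 ^ n) :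
    (digitsAt n c (n - 1 - j) t : ℕ) = digit n (c t) j := by
  rw [digitsAt, show n - 1 - (n - 1 - j) = j by omega, val_ofNat_four (digit_lt_four hc)]

theorem digit_eq_toNat_testBit {n x j : ℕ} (hx : x < 2 ^ n) :
    digit n x j = (x.testBit j).toNat := by
  rw [Nat.toNat_testBit, digit]
  split_ifs with h
  · subst h
    rw [Nat.mod_eq_of_lt]
    rw [Nat.div_lt_iff_lt_mul (Nat.two_pow_pos j), Nat.mul_comm, ← Nat.pow_succ]
    exact hx
  · rfl

theorem count_le_two_pow (z : List Bool) (t : Bool) : z.count t ≤ 2 ^ blockParam z.length :=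
  List.count_le_length.trans ((blockParam_eq_iff (le_max_left _ _)).1 rfl).1

/-! ### The counting languages -/

/-- The auxiliary automaton that constructs the number zero without taking any step. -/
def zeroCA : CA Unit (Option Bool) where
  δ := fun _ x _ => x
  inp := fun _ => some false
  inp_injective := fun _ _ _ => rfl
  inactive := none
  inactive_not_inp := by simp
  δ_inactive := fun _ _ => rfl
  accept := ∅
  inactive_not_accept := by simp

theorem zeroCA_constructs (n : ℕ) : ∃ s ≤ 0,
    zeroCA.step^[s] (zeroCA.init (List.replicate n ())) =
      zeroCA.wordConfig ((binWord n (1 - 1)).map some) ∧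
    zeroCA.step (zeroCA.wordConfig ((binWord n (1 - 1)).map some)) =
      zeroCA.wordConfig ((binWord n (1 - 1)).map some) := by
  refine ⟨0, le_rfl, ?_, rfl⟩
  rw [Function.iterate_zero_apply, CA.init]
  congr 1
  simp only [binWord, List.map_replicate, zeroCA, List.map_map]
  rw [eq_comm, List.eq_replicate_iff]
  simp

/-- The evaluation of the number of ones modulo `q`. The state consists of the weight of the next
digit and the value of the digits so far. -/
def modProg (q : ℕ) : Prog (Option Bool) (ZMod q × ZMod q) where
  C := zeroCA
  one := some true
  start := (1, 0)
  next := fun s d _ => (2 * s.1, s.2 + s.1 * ((d true : ℕ) : ZMod q))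
  final := fun s => s.2 = 0

theorem runAt_modProg {q n : ℕ} (hn : 1 ≤ n) {c : Bool → ℕ} {K : ℕ → Bool} (hc : c true ≤ 2 ^ n)
    {j : ℕ} (hj : j ≤ n) : Seg.runAt (modProg q) n c K j =
      (((2 ^ j : ℕ) : ZMod q), (lowPart n (c true) j : ZMod q)) := by
  induction j with
  | zero => simp [Seg.runAt, modProg, lowPart_zero hn]
  | succ j ih =>
    rw [Seg.runAt, ih (by omega), lowPart_succ hj, ← val_digitsAt hj hc, Nat.pow_succ']
    simp only [modProg]
    push_cast
    rfl

/-- The comparison of the numbers of ones and zeros. The state says whether the number of ones is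
smaller, as far as the digits have been compared. -/
def majProg : Prog (Option Bool) Bool where
  C := zeroCA
  one := some true
  start := false
  next := fun s d _ => compareStep (d true) (d false) s
  final := fun s => s = false

theorem runAt_majProg {n : ℕ} (hn : 1 ≤ n) {c : Bool → ℕ} {K : ℕ → Bool} (hc : ∀ t, c t ≤ 2 ^ n)
    {j : ℕ} (hj : j ≤ n) : Seg.runAt majProg n c K j =
      decide (lowPart n (c true) j < lowPart n (c false) j) := by
  induction j with
  | zero => simp [Seg.runAt, majProg, lowPart_zero hn]
  | succ j ih =>
    rw [Seg.runAt, ih (by omega), ← compareStep_lowPart hj, ← val_digitsAt hj (hc true),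
      ← val_digitsAt hj (hc false)]
    rfl

/-- The comparison of the number of ones with a number constructed by `C`. The state says whether
the number of ones is greater, as far as the digits have been compared. -/
def thrProg {κ : Type} (C : CA Unit κ) (one : κ) : Prog κ Bool where
  C := C
  one := one
  start := false
  next := fun s d b => compareStep b.toNat (d true) s
  final := fun s => s = true

theorem runAt_thrProg {κ : Type} {C : CA Unit κ} {one : κ} {n x : ℕ} (hn : 1 ≤ n) (hx : x < 2 ^ n)
    {c : Bool → ℕ} (hc : c true ≤ 2 ^ n) {j : ℕ} (hj : j ≤ n) :
    Seg.runAt (thrProg C one) n c (fun j => x.testBit j) j =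
      decide (lowPart n x j < lowPart n (c true) j) := by
  induction j with
  | zero => simp [Seg.runAt, thrProg, lowPart_zero hn]
  | succ j ih =>
    rw [Seg.runAt, ih (by omega), ← compareStep_lowPart hj, ← val_digitsAt hj hc,
      digit_eq_toNat_testBit hx]
    rfl

/-- No number has to be constructed for the first three languages. -/
theorem blockVersion_mem_of_zeroCA {σ : Type} [Finite σ] {M : Prog (Option Bool) σ}
    (hC : M.C = zeroCA) (hone : M.one = some true) {L : Language Bool}
    (hL : ∀ z ≠ [], z ∈ L ↔ M.final (Seg.runAt M (blockParam z.length)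
      (fun t => z.count t) (fun j => Nat.testBit (1 - 1) j) (blockParam z.length))) :
    BlockVersion id L ∈ SCATime (fun N => Real.logb 2 N ^ 2) := by
  have := blockVersion_mem_SCATime M (Option.some_injective _) hone (g := fun _ => 1)
    (t := fun _ => 0) (fun n _ => by rw [hC]; exact zeroCA_constructs n) hL
  simpa using this

theorem blockVersion_MODq_mem {q : ℕ} (hq : 2 ≤ q) :
    BlockVersion id (MODq q) ∈ SCATime (fun N => Real.logb 2 N ^ 2) := by
  have : NeZero q := ⟨by omega⟩
  refine blockVersion_mem_of_zeroCA (M := modProg q) rfl rfl fun z hz => ?_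
  have hn : 1 ≤ blockParam z.length := le_max_left _ _
  rw [runAt_modProg hn (count_le_two_pow z true) le_rfl, lowPart_self]
  change z ≠ [] ∧ _ ↔ ((z.count true : ℕ) : ZMod q) = 0
  rw [ZMod.natCast_eq_zero_iff, Nat.modEq_zero_iff_dvd]
  simp [hz]

theorem PAR_eq_MODq : PAR = MODq 2 := by
  ext w
  change _ ∧ _ ↔ _ ∧ _
  rw [Nat.even_iff]
  rfl

theorem blockVersion_MAJ_mem :
    BlockVersion id MAJ ∈ SCATime (fun N => Real.logb 2 N ^ 2) := by
  refine blockVersion_mem_of_zeroCA (M := majProg) rfl rfl fun z hz => ?_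
  have hn : 1 ≤ blockParam z.length := le_max_left _ _
  rw [runAt_majProg hn (count_le_two_pow z) le_rfl, lowPart_self, lowPart_self]
  change z ≠ [] ∧ _ ↔ decide _ = false
  simp [hz]

theorem blockVersion_THR_mem {k t : ℕ → ℕ} (hk : ∀ n, 1 ≤ n → 1 ≤ k n)
    (h : ConstructibleInPlace k t) : BlockVersion id (THR fun m => k (blockParam m)) ∈
      SCATime (fun N => Real.logb 2 N ^ 2 + t (blockIndex N)) := by
  obtain ⟨hle, Q, hQ, C, bit, hbit, -, hC⟩ := h
  refine blockVersion_mem_SCATime (thrProg C (bit true)) hbit rfl hC fun z hz => ?_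
  have hn : 1 ≤ blockParam z.length := le_max_left _ _
  have h1 := hk _ hn
  have h2 := hle _ hn
  rw [runAt_thrProg hn (by omega) (count_le_two_pow z true) le_rfl, lowPart_self, lowPart_self]
  change z ≠ [] ∧ _ ↔ decide _ = true
  simp only [ne_eq, hz, not_false_eq_true, true_and, decide_eq_true_eq]
  omega

end BlockCount

theorem mainTheorem9 :
    (∀ L : Language Bool, (L = PAR ∨ (∃ q : ℕ, 2 < q ∧ L = MODq q) ∨ L = MAJ) →
      BlockVersion id L ∈ SCATime (fun N => Real.logb 2 N ^ 2)) ∧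
    (∀ k t : ℕ → ℕ, (∀ n, 1 ≤ n → 1 ≤ k n) → ConstructibleInPlace k t →
      BlockVersion id (THR fun m => k (blockParam m)) ∈
        SCATime (fun N => Real.logb 2 N ^ 2 + t (blockIndex N))) := by
  refine ⟨?_, fun k t hk h => BlockCount.blockVersion_THR_mem hk h⟩
  rintro L (rfl | ⟨q, hq, rfl⟩ | rfl)
  · rw [BlockCount.PAR_eq_MODq]
    exact BlockCount.blockVersion_MODq_mem le_rfl
  · exact BlockCount.blockVersion_MODq_mem hq.le
  · exact BlockCount.blockVersion_MAJ_mem
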